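/- Let $\tilde G=\langle z,t_1,t_2,t_3\mid z^2=1,\ t_i^2=z,\ (t_1t_2)^3=(t_2t_3)^3=z,\ (t_1t_3)^2=z\rangle$ be the binary octahedral group. It is a central extension of $\mathfrak S_4$ by $\langle z\rangle\simeq\mathbb Z/2$, with $t_i\mapsto(i,i+1)$. Let $D(\tilde G)$ be its Drinfeld double over $\mathbb C$, with basis $(e_gh)_{g,h\in\tilde G}$, product $(e_gh)(e_{g'}h')=\delta_{g,hg'h^{-1}}e_ghh'$, coproduct $\Delta(e_gh)=\sum_{g_1g_2=g}e_{g_1}h\otimes e_{g_2}h$, antipode $S(e_gh)=e_{h^{-1}g^{-1}h}h^{-1}$ and $R$-matrix $\sum_g g\otimes e_g$. The category $\mathcal C=D(\tilde G)\text{-mod}$ of finite-dimensional modules is braided (by the $R$-matrix followed by the flip) and spherical, with pivotal structure $a$ the canonical isomorphism of a vector space with its bidual. The twist $\theta$ is defined by $a=u\theta$, with $u$ the Drinfeld morphism, and $S_{X,Y}=\mathrm{tr}^R_{X\otimes Y}(c_{Y,X}c_{X,Y})$. For $g\in\tilde G$ and a representation $\rho$ of its centralizer $Z(g)$, let $V_{g,\rho}$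 be the $D(\tilde G)$-module supported on the conjugacy class of $g$ which is induced from $\rho$. Put $\varepsilon=V_{z,1}$. A module $X$ has degree $d\in\mathbb Z/2$ if its double braiding with $\varepsilon$ is $(-1)^d\,\mathrm{id}$, and $\mathcal C_0$ is the component of degree $0$. The irreducible characters of $\tilde G$ are $$\begin{array}{c|cccccccc} &1&z&t_1&t_1t_3&t_1t_2&zt_1t_2&t_1t_2t_3&zt_1t_2t_3\\\hline 1&1&1&1&1&1&1&1&1\\ \mathrm{sgn}&1&1&-1&1&1&1&-1&-1\\ \chi_2&2&2&0&2&-1&-1&0&0\\ \chi_3&3&3&1&-1&0&0&-1&-1\\ \chi_3'&3&3&-1&-1&0&0&1&1\\ \psi_2&2&-2&0&0&1&-1&\sqrt2&-\sqrt2\\ \psi_2'&2&-2&0&0&1&-1&-\sqrt2&\sqrt2\\ \psi_4&4&-4&0&0&-1&1&0&0\end{array}$$ The centralizers of $t_1$, of $t_1t_3$, of $t_1t_2$ and $zt_1t_2$, and of $t_1t_2t_3$ and $zt_1t_2t_3$ are cyclic of order $4,8,6,8$, generated by $t_1$, $t_1t_2t_1t_3t_2$, $t_1t_2$, $t_1t_2t_3$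 respectively; for these elements $g$, write $V_{g,\omega}$ for $V_{g,\rho}$ with $\rho$ the character taking the value $\omega$ at this generator. Let $\zeta_6$ be a primitive sixth root of unity and $\zeta_8$ a primitive eighth root of unity with $\zeta_8+\zeta_8^{-1}=\sqrt2$; put $\zeta_3=\zeta_6^2$ and $\zeta_4=\zeta_8^2$. Consider the ordered families of modules $$V_{z,\chi_3'},V_{t_1t_2,1},V_{z,\chi_2},V_{1,1},V_{zt_1t_2t_3,1},V_{t_1t_2t_3,\zeta_8^6},V_{t_1t_2t_3,\zeta_8^2},V_{t_1t_3,\zeta_8^2},V_{z,\chi_3},V_{z,\mathrm{sgn}},V_{t_1t_2,\zeta_6^4},V_{t_1t_2,\zeta_6^2},V_{zt_1t_2t_3,\zeta_8^4}$$ and $$V_{t_1t_3,\zeta_8},V_{t_1t_3,\zeta_8^3},V_{t_1,\zeta_4},V_{1,\psi_4},V_{1,\psi_2},V_{1,\psi_2'},V_{t_1t_2t_3,\zeta_8^5},V_{t_1t_2t_3,\zeta_8^3},V_{t_1t_2t_3,\zeta_8^7},V_{t_1t_2t_3,\zeta_8},V_{zt_1t_2,\zeta_6},V_{zt_1t_2,\zeta_6^5},V_{zt_1t_2,\zeta_6^3}.$$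 The first family represents, up to isomorphism, each orbit under $\varepsilon\otimes-$ of simple modules of degree $0$ with trivial stabilizer exactly once; the second one represents each orbit of simple modules of degree $1$ exactly once. Moreover $\dim(\mathcal C_0)/2=24^2$. Let $S_{0,1}$ be the crossed $S$-matrix, with entries $S_{X,Y}$ for $X$ in the first family (rows) and $Y$ in the second one (columns), and let $T_0$ and $T_1$ be the diagonal matrices of the scalars by which the inverse of the twist acts on the members of the first and of the second family. Then $\frac1{24}S_{0,1}$ is equal to the Fourier matrix of the family of $13$ unipotent characters of ${}^2F_4$ given by Geck and Malle, $$\frac1{12}\left(\begin{smallmatrix}3&3&6&-6&-3&-3&-3&-3&-3&-3&0&0&0\\0&0&0&-4&4&4&0&0&0&0&4&4&-8\\-6&-6&0&-4&-2&-2&0&0&0&0&4&4&4\\3&3&6&2&1&1&3&3&3&3&4&4&4\\3\sqrt2&-3\sqrt2&0&0&-3\sqrt2&3\sqrt2&3\sqrt2&3\sqrt2&-3\sqrt2&-3\sqrt2&0&0&0\\3\sqrt2&-3\sqrt2&0&0&3\sqrt2&-3\sqrt2&-3\sqrt2&3\sqrt2&-3\sqrt2&3\sqrt2&0&0&0\\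3\sqrt2&-3\sqrt2&0&0&3\sqrt2&-3\sqrt2&3\sqrt2&-3\sqrt2&3\sqrt2&-3\sqrt2&0&0&0\\0&0&0&0&0&0&6&-6&-6&6&0&0&0\\3&3&-6&-6&-3&-3&3&3&3&3&0&0&0\\-3&-3&6&-2&-1&-1&3&3&3&3&-4&-4&-4\\0&0&0&-4&4&4&0&0&0&0&4&-8&4\\0&0&0&-4&4&4&0&0&0&0&-8&4&4\\3\sqrt2&-3\sqrt2&0&0&-3\sqrt2&3\sqrt2&-3\sqrt2&-3\sqrt2&3\sqrt2&3\sqrt2&0&0&0\end{smallmatrix}\right),$$ and the matrices $F_1=\mathrm{diag}(1,1,1,1,1,\zeta_4,-\zeta_4,-1,1,1,\zeta_3,\zeta_3^2,-1)$ and $F_2=\mathrm{diag}(1,1,1,-1,-1,-1,-\zeta_4,\zeta_4,\zeta_4,-\zeta_4,-\zeta_3,-\zeta_3^2,-1)$ satisfy $F_1=T_0$ and $F_2=-T_1^{-2}$. -/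

import Mathlib

set_option linter.all false
set_option linter.unusedSimpArgs false

/-- Names of the generators `z, t₁, t₂, t₃` of the binary octahedral group. -/
inductive BOGen : Type
  | z | t1 | t2 | t3

/-- The relators `z²`, `tᵢ² z⁻¹`, `(t₁t₂)³ z⁻¹`, `(t₂t₃)³ z⁻¹`, `(t₁t₃)² z⁻¹`. -/
def relators {F : Type*} [Group F] (z t1 t2 t3 : F) : Set F :=
  {z ^ 2, t1 ^ 2 * z⁻¹, t2 ^ 2 * z⁻¹, t3 ^ 2 * z⁻¹, (t1 * t2) ^ 3 * z⁻¹, (t2 * t3) ^ 3 * z⁻¹,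
    (t1 * t3) ^ 2 * z⁻¹}

/-- The relators of the binary octahedral group, in the free group on the four generators. -/
def boRels : Set (FreeGroup BOGen) :=
  relators (FreeGroup.of .z) (FreeGroup.of .t1) (FreeGroup.of .t2) (FreeGroup.of .t3)

/-- The binary octahedral group
`⟨z, t₁, t₂, t₃ ∣ z² = 1, tᵢ² = z, (t₁t₂)³ = z, (t₂t₃)³ = z, (t₁t₃)² = z⟩`. -/
abbrev BinOct : Type := PresentedGroup boRels

namespace BinOct

def z : BinOct := PresentedGroup.of .z
def t1 : BinOct := PresentedGroup.of .t1
def t2 : BinOct := PresentedGroup.of .t2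
def t3 : BinOct := PresentedGroup.of .t3

/-- The assignment of elements to the names of the generators. -/
def genMap {H : Type*} (Z A B C : H) : BOGen → H
  | .z => Z | .t1 => A | .t2 => B | .t3 => C

theorem lift_aux {H : Type*} [Group H] (Z A B C : H) (hz : Z ^ 2 = 1) (hA : A ^ 2 = Z)
    (hB : B ^ 2 = Z) (hC : C ^ 2 = Z) (hAB : (A * B) ^ 3 = Z) (hBC : (B * C) ^ 3 = Z)
    (hAC : (A * C) ^ 2 = Z) (r : FreeGroup BOGen) (hr : r ∈ boRels) :
    FreeGroup.lift (genMap Z A B C) r = 1 := by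
  rcases hr with rfl | rfl | rfl | rfl | rfl | rfl | rfl <;>
    simp only [map_mul, map_pow, map_inv, FreeGroup.lift_apply_of, genMap, hz, hA, hB, hC, hAB,
      hBC, hAC, mul_inv_cancel]

/-- The homomorphism out of the binary octahedral group defined by elements satisfying the
defining relations. -/
def lift {H : Type*} [Group H] (Z A B C : H) (hz : Z ^ 2 = 1) (hA : A ^ 2 = Z) (hB : B ^ 2 = Z)
    (hC : C ^ 2 = Z) (hAB : (A * B) ^ 3 = Z) (hBC : (B * C) ^ 3 = Z) (hAC : (A * C) ^ 2 = Z) :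
    BinOct →* H :=
  PresentedGroup.toGroup (lift_aux Z A B C hz hA hB hC hAB hBC hAC)

section lift
variable {H : Type*} [Group H] (Z A B C : H) (hz : Z ^ 2 = 1) (hA : A ^ 2 = Z) (hB : B ^ 2 = Z)
    (hC : C ^ 2 = Z) (hAB : (A * B) ^ 3 = Z) (hBC : (B * C) ^ 3 = Z) (hAC : (A * C) ^ 2 = Z)

@[simp] theorem lift_z : lift Z A B C hz hA hB hC hAB hBC hAC z = Z := PresentedGroup.toGroup.of _
@[simp] theorem lift_t1 : lift Z A B C hz hA hB hC hAB hBC hAC t1 = A := PresentedGroup.toGroup.of _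
@[simp] theorem lift_t2 : lift Z A B C hz hA hB hC hAB hBC hAC t2 = B := PresentedGroup.toGroup.of _
@[simp] theorem lift_t3 : lift Z A B C hz hA hB hC hAB hBC hAC t3 = C := PresentedGroup.toGroup.of _

end lift

theorem rel_aux {F H : Type*} [Group F] [Group H] (f : F →* H) (z t1 t2 t3 : F)
    (h : ∀ r ∈ relators z t1 t2 t3, f r = 1) :
    f z ^ 2 = 1 ∧ f t1 ^ 2 = f z ∧ f t2 ^ 2 = f z ∧ f t3 ^ 2 = f z ∧
      (f t1 * f t2) ^ 3 = f z ∧ (f t2 * f t3) ^ 3 = f z ∧ (f t1 * f t3) ^ 2 = f z := by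
  simpa only [relators, Set.forall_mem_insert, Set.mem_singleton_iff, forall_eq, map_mul, map_pow,
    map_inv, mul_inv_eq_one] using h

theorem relations : z ^ 2 = 1 ∧ t1 ^ 2 = z ∧ t2 ^ 2 = z ∧ t3 ^ 2 = z ∧
    (t1 * t2) ^ 3 = z ∧ (t2 * t3) ^ 3 = z ∧ (t1 * t3) ^ 2 = z :=
  rel_aux (PresentedGroup.mk boRels) (FreeGroup.of .z) (FreeGroup.of .t1) (FreeGroup.of .t2)
    (FreeGroup.of .t3) (fun _ hr => PresentedGroup.one_of_mem hr)

theorem z_sq : z ^ 2 = 1 := relations.1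
theorem t1_sq : t1 ^ 2 = z := relations.2.1
theorem t2_sq : t2 ^ 2 = z := relations.2.2.1
theorem t3_sq : t3 ^ 2 = z := relations.2.2.2.1
theorem t12_cube : (t1 * t2) ^ 3 = z := relations.2.2.2.2.1
theorem t23_cube : (t2 * t3) ^ 3 = z := relations.2.2.2.2.2.1
theorem t13_sq : (t1 * t3) ^ 2 = z := relations.2.2.2.2.2.2

theorem z_comm1 : t1 * z = z * t1 := by rw [← t1_sq]; simp only [pow_succ, pow_zero, one_mul, mul_one, mul_assoc]
theorem z_comm2 : t2 * z = z * t2 := by rw [← t2_sq]; simp only [pow_succ, pow_zero, one_mul, mul_one, mul_assoc]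
theorem z_comm3 : t3 * z = z * t3 := by rw [← t3_sq]; simp only [pow_succ, pow_zero, one_mul, mul_one, mul_assoc]

/-- In a group where `a² = b² = (ab)³ = z` and `z² = 1`, the braid relation holds. -/
theorem braid_aux {H : Type*} [Group H] {a b z : H} (hz : z ^ 2 = 1) (ha : a ^ 2 = z)
    (hb : b ^ 2 = z) (hab : (a * b) ^ 3 = z) : a * b * a = b * a * b := by
  have hza : a * z = z * a := by rw [← ha]; simp only [pow_succ, pow_zero, one_mul, mul_one, mul_assoc]
  have hzb : b * z = z * b := by rw [← hb]; simp only [pow_succ, pow_zero, one_mul, mul_one, mul_assoc]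
  have h1 : (a * b * a) * (b * a * b) = z := by rw [← hab]; simp only [pow_succ, pow_zero, one_mul, mul_one, mul_assoc]
  have h2 : (b * a * b) * (b * a * b) = z := by
    calc (b * a * b) * (b * a * b) = b * a * (b ^ 2) * (a * b) := by simp only [pow_succ, pow_zero, one_mul, mul_one, mul_assoc]
      _ = b * (a * z) * a * b := by rw [hb]; simp only [pow_succ, pow_zero, one_mul, mul_one, mul_assoc]
      _ = b * z * (a ^ 2) * b := by rw [hza]; simp only [pow_succ, pow_zero, one_mul, mul_one, mul_assoc]
      _ = b * z ^ 2 * b := by rw [ha]; simp only [pow_succ, pow_zero, one_mul, mul_one, mul_assoc]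
      _ = b ^ 2 := by rw [hz]; simp only [pow_succ, pow_zero, one_mul, mul_one, mul_assoc]
      _ = z := hb
  exact mul_right_cancel (h1.trans h2.symm)

theorem braid12 : t1 * t2 * t1 = t2 * t1 * t2 := braid_aux z_sq t1_sq t2_sq t12_cube
theorem braid23 : t2 * t3 * t2 = t3 * t2 * t3 := braid_aux z_sq t2_sq t3_sq t23_cube
theorem comm13 : t3 * t1 = z * (t1 * t3) := by
  have h : (t3 * t1) * (t1 * t3) = z * (t1 * t3) * (t1 * t3) := by
    calc (t3 * t1) * (t1 * t3) = t3 * t1 ^ 2 * t3 := by simp only [pow_succ, pow_zero, one_mul, mul_one, mul_assoc]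
      _ = t3 * z * t3 := by rw [t1_sq]
      _ = z * t3 ^ 2 := by rw [z_comm3]; simp only [pow_succ, pow_zero, one_mul, mul_one, mul_assoc]
      _ = z * z := by rw [t3_sq]
      _ = z * (t1 * t3) ^ 2 := by rw [t13_sq]
      _ = _ := by simp only [pow_succ, pow_zero, one_mul, mul_one, mul_assoc]
  exact mul_right_cancel h

/-- Representatives of the cosets of the subgroup generated by `t₁` in the one generated by
`t₁, t₂`, and of the cosets of the latter in the whole group. -/
def coset2 : Fin 3 → BinOct := ![1, t2, t2 * t1]
def coset3 : Fin 4 → BinOct := ![1, t3, t3 * t2, t3 * t2 * t1]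

/-- Normal form of the elements of the binary octahedral group. -/
def normalForm (p : Fin 4 × Fin 3 × Fin 4) : BinOct :=
  t1 ^ (p.1 : ℕ) * coset2 p.2.1 * coset3 p.2.2

theorem t1_pow_four : t1 ^ 4 = 1 := by
  rw [show 4 = 2 * 2 from rfl, pow_mul, t1_sq, z_sq]

/-- The elements of the form `t₁ᵃ · s` with `s` in `coset2`. -/
def low : Set BinOct := {x | ∃ (a : ℕ) (b : Fin 3), x = t1 ^ a * coset2 b}

theorem one_low : (1 : BinOct) ∈ low := ⟨0, 0, by simp [coset2]⟩

theorem low_t1 {x : BinOct} (hx : x ∈ low) : x * t1 ∈ low := by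
  obtain ⟨a, b, rfl⟩ := hx
  fin_cases b
  · exact ⟨a + 1, 0, by simp [coset2, pow_succ]⟩
  · exact ⟨a, 2, by simp [coset2, mul_assoc]⟩
  · refine ⟨a + 2, 1, ?_⟩
    simp only [coset2]
    calc t1 ^ a * (t2 * t1) * t1 = t1 ^ a * (t2 * t1 ^ 2) := by simp only [pow_succ, pow_zero, one_mul, mul_one, mul_assoc]
      _ = t1 ^ a * (t1 ^ 2 * t2) := by rw [t1_sq, z_comm2]
      _ = t1 ^ (a + 2) * t2 := by simp only [pow_succ, pow_zero, one_mul, mul_one, mul_assoc]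

theorem low_t2 {x : BinOct} (hx : x ∈ low) : x * t2 ∈ low := by
  obtain ⟨a, b, rfl⟩ := hx
  fin_cases b
  · exact ⟨a, 1, by simp [coset2]⟩
  · refine ⟨a + 2, 0, ?_⟩
    simp only [coset2]
    calc t1 ^ a * t2 * t2 = t1 ^ a * t2 ^ 2 := by simp only [pow_succ, pow_zero, one_mul, mul_one, mul_assoc]
      _ = t1 ^ a * t1 ^ 2 := by rw [t1_sq, t2_sq]
      _ = t1 ^ (a + 2) * 1 := by simp only [pow_succ, pow_zero, one_mul, mul_one, mul_assoc]
  · refine ⟨a + 1, 2, ?_⟩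
    simp only [coset2]
    calc t1 ^ a * (t2 * t1) * t2 = t1 ^ a * (t2 * t1 * t2) := by simp only [pow_succ, pow_zero, one_mul, mul_one, mul_assoc]
      _ = t1 ^ a * (t1 * t2 * t1) := by rw [braid12]
      _ = t1 ^ (a + 1) * (t2 * t1) := by simp only [pow_succ, pow_zero, one_mul, mul_one, mul_assoc]

theorem low_z {x : BinOct} (hx : x ∈ low) : x * z ∈ low := by
  rw [← t1_sq, pow_two, ← mul_assoc]; exact low_t1 (low_t1 hx)

/-- The elements of the form `x · s` with `x` in `low` and `s` in `coset3`. -/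
def all : Set BinOct := {x | ∃ h ∈ low, ∃ c : Fin 4, x = h * coset3 c}

theorem all_t1 {x : BinOct} (hx : x ∈ all) : x * t1 ∈ all := by
  obtain ⟨h, hh, c, rfl⟩ := hx
  fin_cases c
  · exact ⟨h * t1, low_t1 hh, 0, by simp [coset3]⟩
  · refine ⟨h * z * t1, low_t1 (low_z hh), 1, ?_⟩
    simp only [coset3]
    calc h * t3 * t1 = h * (t3 * t1) := by simp only [pow_succ, pow_zero, one_mul, mul_one, mul_assoc]
      _ = _ := by rw [comm13]; simp [mul_assoc]
  · exact ⟨h, hh, 3, by simp [coset3, mul_assoc]⟩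
  · refine ⟨h * z, low_z hh, 2, ?_⟩
    simp only [coset3]
    calc h * (t3 * t2 * t1) * t1 = h * (t3 * (t2 * t1 ^ 2)) := by simp only [pow_succ, pow_zero, one_mul, mul_one, mul_assoc]
      _ = h * (t3 * z * t2) := by rw [t1_sq, z_comm2]; simp only [pow_succ, pow_zero, one_mul, mul_one, mul_assoc]
      _ = h * z * (t3 * t2) := by rw [z_comm3]; simp only [pow_succ, pow_zero, one_mul, mul_one, mul_assoc]

theorem all_t2 {x : BinOct} (hx : x ∈ all) : x * t2 ∈ all := by
  obtain ⟨h, hh, c, rfl⟩ := hx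
  fin_cases c
  · exact ⟨h * t2, low_t2 hh, 0, by simp [coset3]⟩
  · exact ⟨h, hh, 2, by simp [coset3, mul_assoc]⟩
  · refine ⟨h * z, low_z hh, 1, ?_⟩
    simp only [coset3]
    calc h * (t3 * t2) * t2 = h * (t3 * t2 ^ 2) := by simp only [pow_succ, pow_zero, one_mul, mul_one, mul_assoc]
      _ = h * z * t3 := by rw [t2_sq, z_comm3]; simp only [pow_succ, pow_zero, one_mul, mul_one, mul_assoc]
  · refine ⟨h * z * t1, low_t1 (low_z hh), 3, ?_⟩
    simp only [coset3]
    calc h * (t3 * t2 * t1) * t2 = h * (t3 * (t2 * t1 * t2)) := by simp only [pow_succ, pow_zero, one_mul, mul_one, mul_assoc]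
      _ = h * (t3 * t1 * (t2 * t1)) := by rw [← braid12]; simp only [pow_succ, pow_zero, one_mul, mul_one, mul_assoc]
      _ = h * z * t1 * (t3 * t2 * t1) := by rw [comm13]; simp only [pow_succ, pow_zero, one_mul, mul_one, mul_assoc]

theorem all_t3 {x : BinOct} (hx : x ∈ all) : x * t3 ∈ all := by
  obtain ⟨h, hh, c, rfl⟩ := hx
  fin_cases c
  · exact ⟨h, hh, 1, by simp [coset3]⟩
  · refine ⟨h * z, low_z hh, 0, ?_⟩
    simp only [coset3]
    calc h * t3 * t3 = h * t3 ^ 2 := by simp only [pow_succ, pow_zero, one_mul, mul_one, mul_assoc]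
      _ = h * z * 1 := by rw [t3_sq]; simp only [pow_succ, pow_zero, one_mul, mul_one, mul_assoc]
  · refine ⟨h * t2, low_t2 hh, 2, ?_⟩
    simp only [coset3]
    calc h * (t3 * t2) * t3 = h * (t3 * t2 * t3) := by simp only [pow_succ, pow_zero, one_mul, mul_one, mul_assoc]
      _ = h * t2 * (t3 * t2) := by rw [← braid23]; simp only [pow_succ, pow_zero, one_mul, mul_one, mul_assoc]
  · refine ⟨h * z * t2, low_t2 (low_z hh), 3, ?_⟩
    have h13 : t1 * t3 = z * (t3 * t1) := by
      rw [comm13, ← mul_assoc, ← pow_two, z_sq, one_mul]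
    simp only [coset3]
    calc h * (t3 * t2 * t1) * t3 = h * (t3 * t2 * (t1 * t3)) := by simp only [pow_succ, pow_zero, one_mul, mul_one, mul_assoc]
      _ = h * (t3 * (t2 * z) * t3 * t1) := by rw [h13]; simp only [pow_succ, pow_zero, one_mul, mul_one, mul_assoc]
      _ = h * ((t3 * z) * t2 * t3 * t1) := by rw [z_comm2]; simp only [pow_succ, pow_zero, one_mul, mul_one, mul_assoc]
      _ = h * (z * (t3 * t2 * t3) * t1) := by rw [z_comm3]; simp only [pow_succ, pow_zero, one_mul, mul_one, mul_assoc]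
      _ = h * z * t2 * (t3 * t2 * t1) := by rw [← braid23]; simp only [pow_succ, pow_zero, one_mul, mul_one, mul_assoc]

theorem all_univ (x : BinOct) : x ∈ all := by
  let gens : Set BinOct := Set.range (PresentedGroup.of (rels := boRels))
  have hz' : ∀ y ∈ all, y * z ∈ all := fun y hy => by
    rw [← t1_sq, pow_two, ← mul_assoc]; exact all_t1 (all_t1 hy)
  have step : ∀ s ∈ gens, ∀ y ∈ all, y * s ∈ all := by
    rintro _ ⟨g, rfl⟩ y hy
    cases g
    · exact hz' y hy
    · exact all_t1 hy
    · exact all_t2 hy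
    · exact all_t3 hy
  have stepinv : ∀ s ∈ gens, ∀ y ∈ all, y * s⁻¹ ∈ all := by
    rintro _ ⟨g, rfl⟩ y hy
    have inv : ∀ t : BinOct, t ^ 2 = z → t⁻¹ = z * t := fun t ht => by
      rw [inv_eq_iff_mul_eq_one, ← ht, ← pow_succ, ← pow_succ', show 2 + 1 + 1 = 2 * 2 from rfl,
        pow_mul, ht, z_sq]
    cases g
    · have : z⁻¹ = z := by rw [inv_eq_iff_mul_eq_one, ← pow_two, z_sq]
      change y * z⁻¹ ∈ all
      rw [this]; exact hz' y hy
    · change y * t1⁻¹ ∈ all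
      rw [inv _ t1_sq, ← mul_assoc]; exact all_t1 (hz' y hy)
    · change y * t2⁻¹ ∈ all
      rw [inv _ t2_sq, ← mul_assoc]; exact all_t2 (hz' y hy)
    · change y * t3⁻¹ ∈ all
      rw [inv _ t3_sq, ← mul_assoc]; exact all_t3 (hz' y hy)
  have hx : x ∈ Subgroup.closure gens := by
    rw [PresentedGroup.closure_range_of]; trivial
  induction hx using Subgroup.closure_induction_right with
  | one => exact ⟨1, one_low, 0, by simp [coset3]⟩
  | mul_right y _ s hs ih => exact step s hs y ih
  | mul_inv_cancel y _ s hs ih => exact stepinv s hs y ih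

theorem normalForm_surjective : Function.Surjective normalForm := by
  intro x
  obtain ⟨_, ⟨a, b, rfl⟩, c, rfl⟩ := all_univ x
  refine ⟨(⟨a % 4, Nat.mod_lt _ (by norm_num)⟩, b, c), ?_⟩
  simp only [normalForm]
  rw [← pow_eq_pow_mod a t1_pow_four]
  


instance : Finite BinOct := Finite.of_surjective _ normalForm_surjective
noncomputable instance : Fintype BinOct := Fintype.ofFinite _
noncomputable instance : DecidableEq BinOct := Classical.decEq _

section model
/-- Matrices over the field with seven elements generating a copy of the binary octahedral group;
they are used to decide equalities. -/
def mA : Matrix.SpecialLinearGroup (Fin 2) (ZMod 7) := ⟨!![0, -1; 1, 0], by decide⟩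
def mB : Matrix.SpecialLinearGroup (Fin 2) (ZMod 7) := ⟨!![0, 3; 2, 0], by decide⟩
def mC : Matrix.SpecialLinearGroup (Fin 2) (ZMod 7) := ⟨!![2, 3; 3, 5], by decide⟩

/-- The homomorphism sending the generators to these matrices. -/
def model : BinOct →* Matrix.SpecialLinearGroup (Fin 2) (ZMod 7) :=
  lift (-1) mA mB mC
    (by decide) (by decide) (by decide) (by decide) (by decide) (by decide) (by decide)

/-- Products of two-by-two matrices modulo seven, on quadruples of natural numbers. -/
def cmul (p q : ℕ × ℕ × ℕ × ℕ) : ℕ × ℕ × ℕ × ℕ :=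
  ((p.1 * q.1 + p.2.1 * q.2.2.1) % 7, (p.1 * q.2.1 + p.2.1 * q.2.2.2) % 7,
   (p.2.2.1 * q.1 + p.2.2.2 * q.2.2.1) % 7, (p.2.2.1 * q.2.1 + p.2.2.2 * q.2.2.2) % 7)

def cpow (p : ℕ × ℕ × ℕ × ℕ) : ℕ → ℕ × ℕ × ℕ × ℕ
  | 0 => (1, 0, 0, 1)
  | n + 1 => cmul (cpow p n) p

/-- The quadruple of entries of the matrix attached to an element. -/
def code (x : BinOct) : ℕ × ℕ × ℕ × ℕ :=
  ((model x 0 0).val, (model x 0 1).val, (model x 1 0).val, (model x 1 1).val)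

theorem code_mul (x y : BinOct) : code (x * y) = cmul (code x) (code y) := by
  simp [code, cmul, Matrix.mul_apply, Fin.sum_univ_two, ZMod.val_add, ZMod.val_mul]

theorem code_one : code 1 = (1, 0, 0, 1) := by simp [code]; rfl
theorem code_z : code z = (6, 0, 0, 6) := by simp [code, model]
theorem code_t1 : code t1 = (0, 6, 1, 0) := by simp [code, model]; decide
theorem code_t2 : code t2 = (0, 3, 2, 0) := by simp [code, model]; decide
theorem code_t3 : code t3 = (2, 3, 3, 5) := by simp [code, model]; decide

theorem code_pow (x : BinOct) (n : ℕ) : code (x ^ n) = cpow (code x) n := by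
  induction n with
  | zero => simp [cpow, code_one]
  | succ n ih => rw [pow_succ, code_mul, ih, cpow]

/-- The quadruple attached to a normal form. -/
def codeNF (p : Fin 4 × Fin 3 × Fin 4) : ℕ × ℕ × ℕ × ℕ :=
  cmul (cmul (cpow (0, 6, 1, 0) p.1) (![(1, 0, 0, 1), (0, 3, 2, 0), (3, 0, 0, 5)] p.2.1))
    (![(1, 0, 0, 1), (2, 3, 3, 5), (6, 6, 3, 2), (6, 1, 2, 4)] p.2.2)

theorem code_normalForm (p : Fin 4 × Fin 3 × Fin 4) : code (normalForm p) = codeNF p := by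
  have h2 : ∀ b, code (coset2 b) = ![(1, 0, 0, 1), (0, 3, 2, 0), (3, 0, 0, 5)] b := by
    intro b
    fin_cases b <;> simp [coset2, code_mul, code_one, code_t1, code_t2, cmul]
  have h3 : ∀ b, code (coset3 b) =
      ![(1, 0, 0, 1), (2, 3, 3, 5), (6, 6, 3, 2), (6, 1, 2, 4)] b := by
    intro b
    fin_cases b <;> simp [coset3, code_mul, code_one, code_t1, code_t2, code_t3, cmul]
  simp only [normalForm, codeNF, code_mul, code_pow, code_t1, h2, h3]

theorem code_injective : Function.Injective code := by
  intro x y hxy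
  have h1 : code (x * y⁻¹) = (1, 0, 0, 1) := by
    rw [code_mul, hxy, ← code_mul, mul_inv_cancel, code_one]
  obtain ⟨p, hp⟩ := normalForm_surjective (x * y⁻¹)
  have key : ∀ p, codeNF p = (1, 0, 0, 1) → p = (0, 0, 0) := by decide +kernel
  rw [← hp, code_normalForm] at h1
  rw [key p h1] at hp
  rw [← mul_inv_eq_one, ← hp]
  simp [normalForm, coset2, coset3]

theorem centralizer_aux {g c : BinOct} {n : ℕ} (a b : ℕ × ℕ × ℕ × ℕ) (ha : code g = a)
    (hb : code c = b) (hgc : cmul b a = cmul a b)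
    (h : ∀ p, cmul (codeNF p) a = cmul a (codeNF p) → ∃ k : Fin n, cpow b k = codeNF p) :
    Subgroup.centralizer {g} = Subgroup.zpowers c := by
  subst ha hb
  refine le_antisymm (fun x hx => ?_) ?_
  · obtain ⟨p, rfl⟩ := normalForm_surjective x
    rw [Subgroup.mem_centralizer_singleton_iff] at hx
    obtain ⟨k, hk⟩ := h p (by rw [← code_normalForm, ← code_mul, ← code_mul, hx])
    exact ⟨(k : ℕ), code_injective (by rw [code_normalForm, ← hk]; simp [code_pow])⟩
  · rw [Subgroup.zpowers_le, Subgroup.mem_centralizer_singleton_iff]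
    exact code_injective (by rw [code_mul, code_mul, hgc])

theorem orderOf_aux {c : BinOct} (n : ℕ) (b : ℕ × ℕ × ℕ × ℕ) (hb : code c = b) (hn : 0 < n)
    (h1 : cpow b n = (1, 0, 0, 1))
    (h2 : ∀ k : Fin n, 0 < (k : ℕ) → cpow b k ≠ (1, 0, 0, 1)) : orderOf c = n := by
  subst hb
  rw [orderOf_eq_iff hn]
  refine ⟨code_injective (by rw [code_pow, h1, code_one]), fun m hm hm0 hc => ?_⟩
  exact h2 ⟨m, hm⟩ hm0 (by rw [← code_pow, hc, code_one])

end model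

/-- The element `t₁t₂t₁t₃t₂`, a generator of the centralizer of `t₁t₃`. -/
def h : BinOct := t1 * t2 * t1 * t3 * t2

theorem centralizer_t1 : Subgroup.centralizer {t1} = Subgroup.zpowers (t1) :=
  centralizer_aux (n := 4) (0, 6, 1, 0) (0, 6, 1, 0) (by simp [h, code_mul, code_z, code_t1, code_t2, code_t3, cmul]) (by simp [h, code_mul, code_z, code_t1, code_t2, code_t3, cmul])
    (by decide +kernel) (by decide +kernel)
theorem centralizer_t1t3 : Subgroup.centralizer {t1 * t3} = Subgroup.zpowers (h) :=
  centralizer_aux (n := 8) (4, 2, 2, 3) (6, 4, 4, 4) (by simp [h, code_mul, code_z, code_t1, code_t2, code_t3, cmul]) (by simp [h, code_mul, code_z, code_t1, code_t2, code_t3, cmul])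
    (by decide +kernel) (by decide +kernel)
theorem centralizer_t1t2 : Subgroup.centralizer {t1 * t2} = Subgroup.zpowers (t1 * t2) :=
  centralizer_aux (n := 6) (5, 0, 0, 3) (5, 0, 0, 3) (by simp [h, code_mul, code_z, code_t1, code_t2, code_t3, cmul]) (by simp [h, code_mul, code_z, code_t1, code_t2, code_t3, cmul])
    (by decide +kernel) (by decide +kernel)
theorem centralizer_zt1t2 : Subgroup.centralizer {z * t1 * t2} = Subgroup.zpowers (t1 * t2) :=
  centralizer_aux (n := 6) (2, 0, 0, 4) (5, 0, 0, 3) (by simp [h, code_mul, code_z, code_t1, code_t2, code_t3, cmul]) (by simp [h, code_mul, code_z, code_t1, code_t2, code_t3, cmul])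
    (by decide +kernel) (by decide +kernel)
theorem centralizer_t1t2t3 : Subgroup.centralizer {t1 * t2 * t3} = Subgroup.zpowers (t1 * t2 * t3) :=
  centralizer_aux (n := 8) (3, 1, 2, 1) (3, 1, 2, 1) (by simp [h, code_mul, code_z, code_t1, code_t2, code_t3, cmul]) (by simp [h, code_mul, code_z, code_t1, code_t2, code_t3, cmul])
    (by decide +kernel) (by decide +kernel)
theorem centralizer_zt1t2t3 : Subgroup.centralizer {z * t1 * t2 * t3} = Subgroup.zpowers (t1 * t2 * t3) :=
  centralizer_aux (n := 8) (4, 6, 5, 6) (3, 1, 2, 1) (by simp [h, code_mul, code_z, code_t1, code_t2, code_t3, cmul]) (by simp [h, code_mul, code_z, code_t1, code_t2, code_t3, cmul])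
    (by decide +kernel) (by decide +kernel)
theorem orderOf_t1 : orderOf (t1) = 4 :=
  orderOf_aux 4 (0, 6, 1, 0) (by simp [h, code_mul, code_z, code_t1, code_t2, code_t3, cmul]) (by norm_num) (by decide +kernel) (by decide +kernel)
theorem orderOf_h : orderOf (h) = 8 :=
  orderOf_aux 8 (6, 4, 4, 4) (by simp [h, code_mul, code_z, code_t1, code_t2, code_t3, cmul]) (by norm_num) (by decide +kernel) (by decide +kernel)
theorem orderOf_t1t2 : orderOf (t1 * t2) = 6 :=
  orderOf_aux 6 (5, 0, 0, 3) (by simp [h, code_mul, code_z, code_t1, code_t2, code_t3, cmul]) (by norm_num) (by decide +kernel) (by decide +kernel)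
theorem orderOf_t1t2t3 : orderOf (t1 * t2 * t3) = 8 :=
  orderOf_aux 8 (3, 1, 2, 1) (by simp [h, code_mul, code_z, code_t1, code_t2, code_t3, cmul]) (by norm_num) (by decide +kernel) (by decide +kernel)

end BinOct

open scoped TensorProduct

noncomputable section

/-- The Drinfeld double `D(G)` of a finite group over `ℂ`. An element is given by its coefficients
on the basis `e_g h`, indexed by the pairs `(g, h)`. -/
def DrinfeldDouble (G : Type) : Type := G × G → ℂ

namespace DrinfeldDouble

variable {G : Type} [Group G] [Fintype G] [DecidableEq G]

instance : AddCommGroup (DrinfeldDouble G) := inferInstanceAs (AddCommGroup (G × G → ℂ))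
instance : Module ℂ (DrinfeldDouble G) := inferInstanceAs (Module ℂ (G × G → ℂ))

/-- The basis of the elements `e_g h`. -/
def basis : Module.Basis (G × G) ℂ (DrinfeldDouble G) := Pi.basisFun ℂ (G × G)

/-- The basis element `e_g h`. -/
def e (g h : G) : DrinfeldDouble G := basis (g, h)

theorem e_apply (g h x y : G) : e g h (x, y) = if x = g ∧ y = h then 1 else 0 := by
  have h1 : e g h (x, y) = (Pi.single (g, h) (1 : ℂ) : G × G → ℂ) (x, y) :=
    congrFun (Pi.basisFun_apply ℂ (G × G) (g, h)) (x, y)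
  rw [h1]
  simp [Pi.single_apply]

/-- The bilinear multiplication with `(e_g h)(e_{g'} h') = δ_{g, h g' h⁻¹} e_g (h h')`. -/
instance : Mul (DrinfeldDouble G) :=
  ⟨fun a b p => ∑ h : G, a (p.1, h) * b (h⁻¹ * p.1 * h, h⁻¹ * p.2)⟩

instance : One (DrinfeldDouble G) := ⟨∑ g : G, e g 1⟩

theorem mul_apply (a b : DrinfeldDouble G) (p : G × G) :
    (a * b) p = ∑ h : G, a (p.1, h) * b (h⁻¹ * p.1 * h, h⁻¹ * p.2) := rfl

theorem add_apply (a b : DrinfeldDouble G) (p : G × G) : (a + b) p = a p + b p := rfl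
theorem smul_apply (c : ℂ) (a : DrinfeldDouble G) (p : G × G) : (c • a) p = c * a p := rfl

theorem one_def : (1 : DrinfeldDouble G) = ∑ g : G, e g 1 := rfl

theorem one_apply (p : G × G) : (1 : DrinfeldDouble G) p = if p.2 = 1 then 1 else 0 := by
  obtain ⟨x, y⟩ := p
  have : (1 : DrinfeldDouble G) (x, y) = ∑ g : G, e g 1 (x, y) := by
    change (∑ g : G, (e g 1 : G × G → ℂ)) (x, y) = _
    exact Finset.sum_apply _ _ _
  rw [this]
  simp only [e_apply]
  by_cases h : y = 1 <;> simp [h]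

theorem e_mul_e (g h g' h' : G) :
    e g h * e g' h' = if g = h * g' * h⁻¹ then e g (h * h') else 0 := by
  funext ⟨x, y⟩
  rw [mul_apply]
  simp only [e_apply]
  rw [Finset.sum_eq_single h]
  · by_cases hx : x = g
    · subst hx
      by_cases hg : x = h * g' * h⁻¹
      · have h1 : h⁻¹ * x * h = g' := by rw [hg]; group
        rw [if_pos hg, e_apply]
        simp [h1, inv_mul_eq_iff_eq_mul]
      · have h1 : h⁻¹ * x * h ≠ g' := fun hh => hg (by rw [← hh]; group)
        rw [if_neg hg]
        simp only [h1, false_and, if_false, mul_zero]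
        rfl
    · have h0 : (0 : DrinfeldDouble G) (x, y) = 0 := rfl
      rw [if_neg (fun hh => hx hh.1), zero_mul]
      by_cases hg : g = h * g' * h⁻¹
      · rw [if_pos hg, e_apply, if_neg (fun hh => hx hh.1)]
      · rw [if_neg hg, h0]
  · intro b _ hb
    simp [hb]
  · simp

instance : Ring (DrinfeldDouble G) where
  __ := (inferInstance : AddCommGroup (DrinfeldDouble G))
  __ := (inferInstance : Mul (DrinfeldDouble G))
  __ := (inferInstance : One (DrinfeldDouble G))
  left_distrib a b c := by
    funext p; simp only [mul_apply, add_apply, mul_add, Finset.sum_add_distrib]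
  right_distrib a b c := by
    funext p; simp only [mul_apply, add_apply, add_mul, Finset.sum_add_distrib]
  zero_mul a := by
    funext p; rw [mul_apply]; exact Finset.sum_eq_zero fun h _ => zero_mul _
  mul_zero a := by
    funext p; rw [mul_apply]; exact Finset.sum_eq_zero fun h _ => mul_zero _
  mul_assoc a b c := by
    funext ⟨x, y⟩
    simp only [mul_apply, Finset.sum_mul, Finset.mul_sum]
    rw [Finset.sum_comm]
    refine Finset.sum_congr rfl fun h _ => ?_
    rw [← Equiv.sum_comp (Equiv.mulLeft h)]
    refine Finset.sum_congr rfl fun k _ => ?_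
    simp [mul_assoc]
  one_mul a := by
    funext ⟨x, y⟩
    simp only [mul_apply, one_apply]
    simp
  mul_one a := by
    funext ⟨x, y⟩
    simp only [mul_apply, one_apply, inv_mul_eq_one]
    simp

instance : Algebra ℂ (DrinfeldDouble G) :=
  Algebra.ofModule
    (fun c a b => by
      funext p; simp only [mul_apply, smul_apply, Finset.mul_sum, mul_assoc])
    (fun c a b => by
      funext p; simp only [mul_apply, smul_apply, Finset.mul_sum, mul_left_comm])

/-- The linear map underlying the coproduct `Δ(e_g h) = ∑_{g₁ g₂ = g} e_{g₁} h ⊗ e_{g₂} h`. -/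
def comulLinear : DrinfeldDouble G →ₗ[ℂ] DrinfeldDouble G ⊗[ℂ] DrinfeldDouble G :=
  basis.constr ℂ fun p => ∑ x : G, e x p.2 ⊗ₜ[ℂ] e (x⁻¹ * p.1) p.2

theorem comulLinear_e (g h : G) :
    comulLinear (e g h) = ∑ x : G, e x h ⊗ₜ[ℂ] e (x⁻¹ * g) h := by
  rw [comulLinear, e, Module.Basis.constr_basis]

theorem linear_ext {M : Type*} [AddCommGroup M] [Module ℂ M] {f f' : DrinfeldDouble G →ₗ[ℂ] M}
    (h : ∀ g k, f (e g k) = f' (e g k)) : f = f' :=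
  basis.ext fun p => h p.1 p.2

/-- The coproduct of the Drinfeld double. -/
def comul : DrinfeldDouble G →ₐ[ℂ] DrinfeldDouble G ⊗[ℂ] DrinfeldDouble G :=
  AlgHom.ofLinearMap comulLinear
    (by
      rw [one_def, map_sum]
      simp only [comulLinear_e]
      rw [Finset.sum_comm, Algebra.TensorProduct.one_def, one_def, TensorProduct.sum_tmul]
      refine Finset.sum_congr rfl fun x _ => ?_
      rw [← TensorProduct.tmul_sum]
      congr 1
      exact Equiv.sum_comp (Equiv.mulLeft x⁻¹) (fun g => e g (1 : G)))
    (by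
      have key : (LinearMap.mul ℂ (DrinfeldDouble G)).compr₂ comulLinear =
          ((LinearMap.mul ℂ (DrinfeldDouble G ⊗[ℂ] DrinfeldDouble G)).compl₁₂
            comulLinear comulLinear) := by
        refine linear_ext fun g h => linear_ext fun g' h' => ?_
        simp only [LinearMap.compr₂_apply, LinearMap.mul_apply', LinearMap.compl₁₂_apply,
          comulLinear_e, e_mul_e]
        rw [Finset.sum_mul_sum]
        simp only [Algebra.TensorProduct.tmul_mul_tmul, e_mul_e]
        have inner : ∀ x : G, ∑ y : G,
            ((if x = h * y * h⁻¹ then e x (h * h') else 0) ⊗ₜ[ℂ]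
              (if x⁻¹ * g = h * (y⁻¹ * g') * h⁻¹ then e (x⁻¹ * g) (h * h') else 0) :
                DrinfeldDouble G ⊗[ℂ] DrinfeldDouble G) =
            if g = h * g' * h⁻¹ then e x (h * h') ⊗ₜ[ℂ] e (x⁻¹ * g) (h * h') else 0 := by
          intro x
          rw [Finset.sum_eq_single (h⁻¹ * x * h)]
          · have h1 : x = h * (h⁻¹ * x * h) * h⁻¹ := by group
            have h2 : (x⁻¹ * g = h * ((h⁻¹ * x * h)⁻¹ * g') * h⁻¹) ↔ g = h * g' * h⁻¹ := by
              have : h * ((h⁻¹ * x * h)⁻¹ * g') * h⁻¹ = x⁻¹ * (h * g' * h⁻¹) := by group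
              rw [this, mul_right_inj]
            rw [if_pos h1]
            simp only [h2]
            split_ifs <;> simp
          · intro y _ hy
            have : ¬ x = h * y * h⁻¹ := fun hh => hy (by rw [hh]; group)
            rw [if_neg this, TensorProduct.zero_tmul]
          · simp
        simp only [inner]
        split_ifs with hg
        · rw [comulLinear_e]
        · simp
      intro a b
      exact LinearMap.congr_fun (LinearMap.congr_fun key a) b)

/-- The antipode `S(e_g h) = e_{h⁻¹ g⁻¹ h} h⁻¹`. -/
def antipode : DrinfeldDouble G →ₗ[ℂ] DrinfeldDouble G :=
  basis.constr ℂ fun p => e (p.2⁻¹ * p.1⁻¹ * p.2) p.2⁻¹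

theorem antipode_e (g h : G) : antipode (e g h) = e (h⁻¹ * g⁻¹ * h) h⁻¹ := by
  rw [antipode, e, Module.Basis.constr_basis]

theorem antipode_one : antipode (1 : DrinfeldDouble G) = 1 := by
  rw [one_def, map_sum]
  simp only [antipode_e, inv_one, one_mul, mul_one]
  exact Equiv.sum_comp (Equiv.inv G) (fun g => e g (1 : G))

theorem antipode_mul (a b : DrinfeldDouble G) : antipode (a * b) = antipode b * antipode a := by
  have key : (LinearMap.mul ℂ (DrinfeldDouble G)).compr₂ antipode =
      ((LinearMap.mul ℂ (DrinfeldDouble G)).flip.compl₁₂ antipode antipode) := by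
    refine linear_ext fun g h => linear_ext fun g' h' => ?_
    simp only [LinearMap.compr₂_apply, LinearMap.mul_apply', LinearMap.compl₁₂_apply,
      LinearMap.flip_apply, antipode_e, e_mul_e]
    have h2 : (h'⁻¹ * g'⁻¹ * h' = h'⁻¹ * (h⁻¹ * g⁻¹ * h) * h'⁻¹⁻¹) ↔ g = h * g' * h⁻¹ := by
      constructor
      · intro hh
        have h3 : g'⁻¹ = h⁻¹ * g⁻¹ * h := by
          calc g'⁻¹ = h' * (h'⁻¹ * g'⁻¹ * h') * h'⁻¹ := by group
            _ = _ := by rw [hh]; group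
        rw [← inv_inv g', h3]; group
      · rintro rfl; group
    simp only [h2]
    split_ifs with hg
    · rw [antipode_e]
      subst hg
      congr 1 <;> group
    · simp
  exact LinearMap.congr_fun (LinearMap.congr_fun key a) b

/-- The element `h = ∑_g e_g h` of the Drinfeld double attached to a group element `h`. -/
def ofGroup (h : G) : DrinfeldDouble G := ∑ g : G, e g h

/-- The element `e_g` of the Drinfeld double. -/
def delta (g : G) : DrinfeldDouble G := e g 1

/-- The universal `R`-matrix `∑_g g ⊗ e_g`. -/
def rMatrix : DrinfeldDouble G ⊗[ℂ] DrinfeldDouble G := ∑ g : G, ofGroup g ⊗ₜ[ℂ] delta g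

end DrinfeldDouble

/-- A finite-dimensional module over the Drinfeld double `D(G)`. -/
structure DMod (G : Type) [Group G] [Fintype G] [DecidableEq G] where
  carrier : Type
  [addCommGroup : AddCommGroup carrier]
  [module : Module ℂ carrier]
  [finiteDimensional : FiniteDimensional ℂ carrier]
  act : DrinfeldDouble G →ₐ[ℂ] Module.End ℂ carrier

namespace DMod

attribute [instance] DMod.addCommGroup DMod.module DMod.finiteDimensional

variable {G : Type} [Group G] [Fintype G] [DecidableEq G]

/-- Isomorphism of `D(G)`-modules. -/
def Iso (X Y : DMod G) : Prop :=
  ∃ φ : X.carrier ≃ₗ[ℂ] Y.carrier, ∀ a v, φ (X.act a v) = Y.act a (φ v)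

/-- Simple `D(G)`-modules: the nonzero ones whose only submodules are `0` and everything. -/
def IsSimple (X : DMod G) : Prop :=
  Nontrivial X.carrier ∧
    ∀ W : Submodule ℂ X.carrier, (∀ a, ∀ v ∈ W, X.act a v ∈ W) → W = ⊥ ∨ W = ⊤

/-- The action of `D(G) ⊗ D(G)` on `X ⊗ Y`. -/
def actTensor (X Y : DMod G) :
    DrinfeldDouble G ⊗[ℂ] DrinfeldDouble G →ₐ[ℂ] Module.End ℂ (X.carrier ⊗[ℂ] Y.carrier) :=
  (Module.endTensorEndAlgHom (R := ℂ) (S := ℂ) (A := ℂ)).comp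
    (Algebra.TensorProduct.map X.act Y.act)

/-- The tensor product of two modules, with the action given by the coproduct. -/
def tensor (X Y : DMod G) : DMod G where
  carrier := X.carrier ⊗[ℂ] Y.carrier
  act := (actTensor X Y).comp DrinfeldDouble.comul

/-- The left dual `X*`, with the action `(a f)(v) = f(S(a) v)`. -/
def leftDual (X : DMod G) : DMod G where
  carrier := Module.Dual ℂ X.carrier
  act := AlgHom.ofLinearMap
    (Module.Dual.transpose ∘ₗ X.act.toLinearMap ∘ₗ DrinfeldDouble.antipode)
    (by ext f v; simp [DrinfeldDouble.antipode_one]; rfl)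
    (by intro a b; ext f v; simp [DrinfeldDouble.antipode_mul]; rfl)

/-- The braiding `c_{X,Y} : X ⊗ Y → Y ⊗ X`, the action of the universal `R`-matrix followed by the
flip. -/
def braiding (X Y : DMod G) : X.carrier ⊗[ℂ] Y.carrier →ₗ[ℂ] Y.carrier ⊗[ℂ] X.carrier :=
  (TensorProduct.comm ℂ X.carrier Y.carrier).toLinearMap ∘ₗ
    actTensor X Y DrinfeldDouble.rMatrix

/-- The double braiding `c_{Y,X} ∘ c_{X,Y}`. -/
def doubleBraiding (X Y : DMod G) : Module.End ℂ (X.carrier ⊗[ℂ] Y.carrier) :=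
  braiding Y X ∘ₗ braiding X Y

/-- The right quantum trace `𝟏 → X ⊗ X* → X** ⊗ X* → 𝟏`, for the pivotal structure given by the
canonical isomorphism of a vector space with its bidual. -/
def traceR (X : DMod G) (f : Module.End ℂ X.carrier) : ℂ :=
  contractLeft ℂ (Module.Dual ℂ X.carrier)
    (TensorProduct.map (Module.Dual.eval ℂ X.carrier ∘ₗ f) LinearMap.id
      (coevaluation ℂ X.carrier 1))

/-- The left quantum trace `𝟏 → X* ⊗ X** → X* ⊗ X → 𝟏`. -/
def traceL (X : DMod G) (f : Module.End ℂ X.carrier) : ℂ :=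
  contractLeft ℂ X.carrier
    (TensorProduct.map LinearMap.id (f ∘ₗ (Module.evalEquiv ℂ X.carrier).symm.toLinearMap)
      (coevaluation ℂ (Module.Dual ℂ X.carrier) 1))

/-- The right and left quantum dimensions. -/
def dimR (X : DMod G) : ℂ := traceR X LinearMap.id
def dimL (X : DMod G) : ℂ := traceL X LinearMap.id

/-- The entry `S_{X,Y}` of the `S`-matrix, the right quantum trace of the double braiding. -/
def sEntry (X Y : DMod G) : ℂ := traceR (tensor X Y) (doubleBraiding X Y)

/-- The Drinfeld morphism `u_X : X → X ⊗ X* ⊗ X** → X* ⊗ X ⊗ X** → X**`. -/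
def drinfeldMorphism (X : DMod G) :
    X.carrier →ₗ[ℂ] Module.Dual ℂ (Module.Dual ℂ X.carrier) :=
  (TensorProduct.lid ℂ (Module.Dual ℂ (Module.Dual ℂ X.carrier))).toLinearMap ∘ₗ
    TensorProduct.map (contractLeft ℂ X.carrier) LinearMap.id ∘ₗ
    TensorProduct.map (braiding X (leftDual X)) LinearMap.id ∘ₗ
    (TensorProduct.assoc ℂ X.carrier (Module.Dual ℂ X.carrier)
      (Module.Dual ℂ (Module.Dual ℂ X.carrier))).symm.toLinearMap ∘ₗ
    TensorProduct.map LinearMap.id (coevaluation ℂ (Module.Dual ℂ X.carrier)) ∘ₗ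
    (TensorProduct.rid ℂ X.carrier).symm.toLinearMap

/-- The endomorphism `θ` is the twist of `X`: it is related to the pivotal structure `a` and the
Drinfeld morphism `u` by `a = u θ`. -/
def IsTwist (X : DMod G) (θ : Module.End ℂ X.carrier) : Prop :=
  Module.Dual.eval ℂ X.carrier = drinfeldMorphism X ∘ₗ θ

section simple

variable {W : Type} [AddCommGroup W] [Module ℂ W]

/-- The functions `f : G → W` with `f(x k) = ρ(k)⁻¹ f(x)` for `k` in the centralizer of `g`. -/
def inducedSpace (g : G) (ρ : Representation ℂ (Subgroup.centralizer {g}) W) :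
    Submodule ℂ (G → W) where
  carrier := {f | ∀ (x : G) (k : Subgroup.centralizer {g}), f (x * k) = ρ k⁻¹ (f x)}
  add_mem' ha hb x k := by simp [ha x k, hb x k]
  zero_mem' x k := by simp
  smul_mem' c f hf x k := by simp [hf x k]

/-- The action of `D(G)` on the induced space: the group acts by left translations, and `e_k`
restricts functions to the set of the `x` with `x g x⁻¹ = k`. -/
def inducedAct (g : G) (ρ : Representation ℂ (Subgroup.centralizer {g}) W)
    (a : DrinfeldDouble G) : Module.End ℂ (inducedSpace g ρ) where
  toFun f := ⟨fun x => ∑ h : G, a (x * g * x⁻¹, h) • f.1 (h⁻¹ * x), fun x k => by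
    have hk : x * k * g * (x * k)⁻¹ = x * g * x⁻¹ := by
      have := Subgroup.mem_centralizer_singleton_iff.mp k.2
      calc x * k * g * (x * k)⁻¹ = x * (k * g) * (k : G)⁻¹ * x⁻¹ := by group
        _ = _ := by rw [this]; group
    simp only [hk, map_sum, map_smul]
    refine Finset.sum_congr rfl fun h _ => ?_
    rw [← mul_assoc, f.2]⟩
  map_add' f f' := by
    ext x; simp [Finset.sum_add_distrib]
  map_smul' c f := by
    ext x; simp [Finset.smul_sum, smul_comm c]

theorem inducedAct_apply (g : G) (ρ : Representation ℂ (Subgroup.centralizer {g}) W)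
    (a : DrinfeldDouble G) (f : inducedSpace g ρ) (x : G) :
    (inducedAct g ρ a f).1 x = ∑ h : G, a (x * g * x⁻¹, h) • f.1 (h⁻¹ * x) := rfl

variable [FiniteDimensional ℂ W]

/-- The `D(G)`-module `V_{g,ρ}` attached to an element `g` and to a representation `ρ` of its
centralizer. -/
def V (g : G) (ρ : Representation ℂ (Subgroup.centralizer {g}) W) : DMod G where
  carrier := inducedSpace g ρ
  act := AlgHom.ofLinearMap
    { toFun := inducedAct g ρ
      map_add' := fun a b => by
        ext f x
        simp [inducedAct_apply, DrinfeldDouble.add_apply, add_smul, Finset.sum_add_distrib]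
      map_smul' := fun c a => by
        ext f x
        simp [inducedAct_apply, DrinfeldDouble.smul_apply, mul_smul, Finset.smul_sum] }
    (by
      ext f x
      simp [inducedAct_apply, DrinfeldDouble.one_apply])
    (by
      intro a b
      ext f x
      simp only [LinearMap.coe_mk, AddHom.coe_mk, Module.End.mul_apply, inducedAct_apply,
        DrinfeldDouble.mul_apply, Finset.sum_smul, Finset.smul_sum]
      rw [Finset.sum_comm]
      refine Finset.sum_congr rfl fun h _ => ?_
      rw [← Equiv.sum_comp (Equiv.mulLeft h)]
      refine Finset.sum_congr rfl fun k _ => ?_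
      simp [mul_assoc, mul_smul])

end simple

end DMod

namespace BinOct

/-- The homomorphism to a monoid defined by elements satisfying the defining relations. -/
def liftMonoid {M : Type*} [Monoid M] (Z A B C : M) (hz : Z ^ 2 = 1) (hA : A ^ 2 = Z)
    (hB : B ^ 2 = Z) (hC : C ^ 2 = Z) (hAB : (A * B) ^ 3 = Z) (hBC : (B * C) ^ 3 = Z)
    (hAC : (A * C) ^ 2 = Z) : BinOct →* M :=
  have four : ∀ D : M, D ^ 2 = Z → D * D ^ 3 = 1 ∧ D ^ 3 * D = 1 := fun D hD => by
    rw [← pow_succ', ← pow_succ, show 3 + 1 = 2 * 2 from rfl, pow_mul, hD, hz]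
    exact ⟨rfl, rfl⟩
  (Units.coeHom M).comp
    (lift (⟨Z, Z, by rw [← pow_two, hz], by rw [← pow_two, hz]⟩ : Mˣ)
      ⟨A, A ^ 3, (four A hA).1, (four A hA).2⟩ ⟨B, B ^ 3, (four B hB).1, (four B hB).2⟩
      ⟨C, C ^ 3, (four C hC).1, (four C hC).2⟩
      (Units.ext hz) (Units.ext hA) (Units.ext hB) (Units.ext hC) (Units.ext hAB) (Units.ext hBC)
      (Units.ext hAC))

/-- The representation on `ℂⁿ` given by complex matrices. -/
def matRep {n : ℕ} (φ : BinOct →* Matrix (Fin n) (Fin n) ℂ) :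
    Representation ℂ BinOct (Fin n → ℂ) :=
  ((Matrix.toLinAlgEquiv' : Matrix (Fin n) (Fin n) ℂ ≃ₐ[ℂ] _) : _ →* _).comp φ

/-- The representation on `ℂⁿ` given by integral matrices. -/
def intRep {n : ℕ} (φ : BinOct →* Matrix (Fin n) (Fin n) ℤ) :
    Representation ℂ BinOct (Fin n → ℂ) :=
  matRep (((Int.castRingHom ℂ).mapMatrix (m := Fin n) : Matrix (Fin n) (Fin n) ℤ →+* Matrix (Fin n) (Fin n) ℂ).toMonoidHom.comp φ)

/-- The trivial representation. -/
def chi1 : Representation ℂ BinOct (Fin 1 → ℂ) :=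
  intRep (liftMonoid 1 1 1 1 (by decide) (by decide) (by decide) (by decide) (by decide)
    (by decide) (by decide))

/-- The sign representation. -/
def chiEps : Representation ℂ BinOct (Fin 1 → ℂ) :=
  intRep (liftMonoid 1 (-1) (-1) (-1) (by decide) (by decide) (by decide) (by decide) (by decide)
    (by decide) (by decide))

/-- The irreducible representation of degree two on which `z` acts trivially. -/
def chi2 : Representation ℂ BinOct (Fin 2 → ℂ) :=
  intRep (liftMonoid 1 !![-1, 1; 0, 1] !![1, 0; 1, -1] !![-1, 1; 0, 1]
    (by decide) (by decide) (by decide) (by decide) (by decide) (by decide) (by decide))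

/-- The reflection representation of the symmetric group `S₄`. -/
def chi3 : Representation ℂ BinOct (Fin 3 → ℂ) :=
  intRep (liftMonoid 1 !![-1, 1, 0; 0, 1, 0; 0, 0, 1] !![1, 0, 0; 1, -1, 1; 0, 0, 1]
    !![1, 0, 0; 0, 1, 0; 0, 1, -1]
    (by decide) (by decide) (by decide) (by decide) (by decide) (by decide) (by decide))

/-- The product of the reflection representation with the sign representation. -/
def chi3p : Representation ℂ BinOct (Fin 3 → ℂ) :=
  intRep (liftMonoid 1 (-!![-1, 1, 0; 0, 1, 0; 0, 0, 1]) (-!![1, 0, 0; 1, -1, 1; 0, 0, 1])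
    (-!![1, 0, 0; 0, 1, 0; 0, 1, -1])
    (by decide) (by decide) (by decide) (by decide) (by decide) (by decide) (by decide))

/-- Matrices of the action of `t₁, t₂, t₃` in the spin representation `ψ₂`. -/
def spinA : Matrix (Fin 2) (Fin 2) ℂ := !![0, -1; 1, 0]
def spinB : Matrix (Fin 2) (Fin 2) ℂ :=
  !![-Complex.I / 2, (1 + Complex.I * (√2 : ℝ)) / 2; (-1 + Complex.I * (√2 : ℝ)) / 2, Complex.I / 2]
def spinC : Matrix (Fin 2) (Fin 2) ℂ := !![Complex.I, 0; 0, -Complex.I]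

theorem sqrt_two_sq : ((√2 : ℝ) : ℂ) ^ 2 = 2 := by
  rw [← Complex.ofReal_pow, Real.sq_sqrt (by norm_num)]; norm_num

theorem spin_one : (-1 : Matrix (Fin 2) (Fin 2) ℂ) = !![-1, 0; 0, -1] := by
  ext i j; fin_cases i <;> fin_cases j <;> simp

theorem spin_z : (-1 : Matrix (Fin 2) (Fin 2) ℂ) ^ 2 = 1 := by simp
theorem spin_A : spinA ^ 2 = -1 := by
  rw [pow_two, spinA, spin_one, Matrix.mul_fin_two]; simp
theorem spin_B : spinB ^ 2 = -1 := by
  rw [pow_two, spinB, spin_one, Matrix.mul_fin_two]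
  have h1 := Complex.I_sq
  have h2 := sqrt_two_sq
  congr! 3 <;> grind
theorem spin_C : spinC ^ 2 = -1 := by
  rw [pow_two, spinC, spin_one, Matrix.mul_fin_two]; simp
theorem spin_AB : (spinA * spinB) ^ 3 = -1 := by
  rw [pow_succ, pow_two, spinA, spinB, spin_one]
  simp only [Matrix.mul_fin_two]
  have h1 := Complex.I_sq
  have h2 := sqrt_two_sq
  congr! 3 <;> grind
theorem spin_BC : (spinB * spinC) ^ 3 = -1 := by
  rw [pow_succ, pow_two, spinC, spinB, spin_one]
  simp only [Matrix.mul_fin_two]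
  have h1 := Complex.I_sq
  have h2 := sqrt_two_sq
  congr! 3 <;> grind
theorem spin_AC : (spinA * spinC) ^ 2 = -1 := by
  rw [pow_two, spinA, spinC, spin_one]
  simp [Matrix.mul_fin_two]

/-- The two spin representations of degree two; the second one is the product of the first one
with the sign representation. -/
def psi2 : Representation ℂ BinOct (Fin 2 → ℂ) :=
  matRep (liftMonoid (-1) spinA spinB spinC spin_z spin_A spin_B spin_C spin_AB spin_BC spin_AC)
def psi2p : Representation ℂ BinOct (Fin 2 → ℂ) :=
  matRep (liftMonoid (-1) (-spinA) (-spinB) (-spinC) spin_z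
    (by rw [neg_sq, spin_A]) (by rw [neg_sq, spin_B]) (by rw [neg_sq, spin_C])
    (by rw [neg_mul_neg, spin_AB]) (by rw [neg_mul_neg, spin_BC]) (by rw [neg_mul_neg, spin_AC]))

/-- The irreducible representation of degree four. -/
def psi4 : Representation ℂ BinOct ((Fin 2 → ℂ) ⊗[ℂ] (Fin 2 → ℂ)) := chi2.tprod psi2

/-- Representatives of the conjugacy classes. -/
def classRep : Fin 8 → BinOct :=
  ![1, z, t1, t1 * t3, t1 * t2, z * t1 * t2, t1 * t2 * t3, z * t1 * t2 * t3]

/-- The values of the characters of the representations `1, ε, χ₂, χ₃, χ₃', ψ₂, ψ₂', ψ₄` at the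
representatives of the conjugacy classes. -/
def characterTable : Matrix (Fin 8) (Fin 8) ℂ :=
  Matrix.of ![fun j => chi1.character (classRep j), fun j => chiEps.character (classRep j),
    fun j => chi2.character (classRep j), fun j => chi3.character (classRep j),
    fun j => chi3p.character (classRep j), fun j => psi2.character (classRep j),
    fun j => psi2p.character (classRep j), fun j => psi4.character (classRep j)]

/-- The one-dimensional representation of the centralizer of `g`, supposed to be generated by `c`,
on which `c` acts by `ω`. -/
def cyclicRep {g c : BinOct} (hc : Subgroup.centralizer {g} = Subgroup.zpowers c) (ω : ℂ)
    (hω : ω ^ orderOf c = 1) : Representation ℂ (Subgroup.centralizer {g}) ℂ :=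
  let c' : Subgroup.centralizer {g} := ⟨c, by rw [hc]; exact Subgroup.mem_zpowers c⟩
  let ω' : ℂˣ := Units.ofPowEqOne ω (orderOf c) hω (orderOf_pos c).ne'
  have gen : ∀ x, x ∈ Subgroup.zpowers c' := fun x => by
    obtain ⟨k, hk⟩ := Subgroup.mem_zpowers_iff.mp (hc ▸ x.2 : (x : BinOct) ∈ Subgroup.zpowers c)
    exact Subgroup.mem_zpowers_iff.mpr ⟨k, Subtype.ext (by simpa [c'] using hk)⟩
  have ord : orderOf ω' ∣ orderOf c' := by
    rw [← Subgroup.orderOf_coe]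
    exact orderOf_dvd_of_pow_eq_one (Units.pow_ofPowEqOne hω (orderOf_pos c).ne')
  (Algebra.lmul ℂ ℂ : ℂ →* Module.End ℂ ℂ).comp
    ((Units.coeHom ℂ).comp (monoidHomOfForallMemZpowers gen ord))

/-- The module `V_{g,ρ}` for the restriction of a representation `ρ` of the whole group to the
centralizer of `g`; it is used for the central elements `g = 1, z`. -/
def VC {W : Type} [AddCommGroup W] [Module ℂ W] [FiniteDimensional ℂ W] (g : BinOct)
    (ρ : Representation ℂ BinOct W) : DMod BinOct :=
  DMod.V g (ρ.comp (Subgroup.centralizer {g}).subtype)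

section labels
variable (ω : ℂ)

/-- The modules `V_{g,ω}` for `g` with cyclic centralizer, labelled by the action `ω` of the chosen
generator of the centralizer. The generators are `t₁` for `t₁`, the element `h` for `t₁t₃`, the
element `t₁t₂` for `t₁t₂` and `zt₁t₂`, and the element `t₁t₂t₃` for `t₁t₂t₃` and `zt₁t₂t₃`. -/
def V1 (hω : ω ^ 4 = 1) : DMod BinOct :=
  DMod.V t1 (cyclicRep centralizer_t1 ω (by rw [orderOf_t1, hω]))
def V13 (hω : ω ^ 8 = 1) : DMod BinOct :=
  DMod.V (t1 * t3) (cyclicRep centralizer_t1t3 ω (by rw [orderOf_h, hω]))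
def V12 (hω : ω ^ 6 = 1) : DMod BinOct :=
  DMod.V (t1 * t2) (cyclicRep centralizer_t1t2 ω (by rw [orderOf_t1t2, hω]))
def Vz12 (hω : ω ^ 6 = 1) : DMod BinOct :=
  DMod.V (z * t1 * t2) (cyclicRep centralizer_zt1t2 ω (by rw [orderOf_t1t2, hω]))
def V123 (hω : ω ^ 8 = 1) : DMod BinOct :=
  DMod.V (t1 * t2 * t3) (cyclicRep centralizer_t1t2t3 ω (by rw [orderOf_t1t2t3, hω]))
def Vz123 (hω : ω ^ 8 = 1) : DMod BinOct :=
  DMod.V (z * t1 * t2 * t3) (cyclicRep centralizer_zt1t2t3 ω (by rw [orderOf_t1t2t3, hω]))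

end labels

theorem root_pow {ζ : ℂ} {n : ℕ} (hζ : ζ ^ n = 1) (k : ℕ) : (ζ ^ k) ^ n = 1 := by
  rw [← pow_mul, mul_comm, pow_mul, hζ, one_pow]

theorem root_sq_pow {ζ : ℂ} (hζ : ζ ^ 8 = 1) : (ζ ^ 2) ^ 4 = 1 := by rw [← pow_mul, hζ]

/-- The chosen simple modules of degree `0`. -/
def rowReps (ζ6 ζ8 : ℂ) (h6 : ζ6 ^ 6 = 1) (h8 : ζ8 ^ 8 = 1) : Fin 13 → DMod BinOct :=
  ![VC z chi3p,
    V12 1 (one_pow 6),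
    VC z chi2,
    VC 1 chi1,
    Vz123 1 (one_pow 8),
    V123 (ζ8 ^ 6) (root_pow h8 6),
    V123 (ζ8 ^ 2) (root_pow h8 2),
    V13 (ζ8 ^ 2) (root_pow h8 2),
    VC z chi3,
    VC z chiEps,
    V12 (ζ6 ^ 4) (root_pow h6 4),
    V12 (ζ6 ^ 2) (root_pow h6 2),
    Vz123 (ζ8 ^ 4) (root_pow h8 4)]

/-- The chosen simple modules of degree `1`. -/
def colReps (ζ6 ζ8 : ℂ) (h6 : ζ6 ^ 6 = 1) (h8 : ζ8 ^ 8 = 1) : Fin 13 → DMod BinOct :=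
  ![V13 ζ8 h8,
    V13 (ζ8 ^ 3) (root_pow h8 3),
    V1 (ζ8 ^ 2) (root_sq_pow h8),
    VC 1 psi4,
    VC 1 psi2,
    VC 1 psi2p,
    V123 (ζ8 ^ 5) (root_pow h8 5),
    V123 (ζ8 ^ 3) (root_pow h8 3),
    V123 (ζ8 ^ 7) (root_pow h8 7),
    V123 ζ8 h8,
    Vz12 ζ6 h6,
    Vz12 (ζ6 ^ 5) (root_pow h6 5),
    Vz12 (ζ6 ^ 3) (root_pow h6 3)]

/-- The invertible module `ε = V_{z,1}`. -/
def epsObj : DMod BinOct := VC z chi1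

/-- The module `X` lies in the component of degree `d`: its double braiding with `ε` is the
multiplication by `(-1)^d`. -/
def HasDegree (d : ZMod 2) (X : DMod BinOct) : Prop :=
  DMod.doubleBraiding epsObj X = ((-1 : ℂ) ^ d.val) • LinearMap.id

/-- Among the modules satisfying `P`, the family `F` contains exactly one module, up to
isomorphism, in each orbit under tensoring by `ε`. -/
def IsOrbitTransversal {ι : Type} (P : DMod BinOct → Prop) (F : ι → DMod BinOct) : Prop :=
  (∀ i, P (F i)) ∧
    ∀ X, P X → ∃! i, DMod.Iso X (F i) ∨ DMod.Iso X (DMod.tensor epsObj (F i))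

/-- Simple modules of degree `0` with trivial stabilizer under tensoring by `ε`. -/
def IsRowObject (X : DMod BinOct) : Prop :=
  X.IsSimple ∧ HasDegree 0 X ∧ ¬ DMod.Iso (DMod.tensor epsObj X) X

/-- Simple modules of degree `1`. -/
def IsColObject (X : DMod BinOct) : Prop := X.IsSimple ∧ HasDegree 1 X

/-- Isomorphism classes of simple modules of degree `d`. -/
def simpleSetoid (d : ZMod 2) : Setoid {X : DMod BinOct // X.IsSimple ∧ HasDegree d X} where
  r X Y := DMod.Iso X.1 Y.1
  iseqv :=
    { refl := fun X => ⟨LinearEquiv.refl ℂ _, fun _ _ => rfl⟩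
      symm := fun ⟨φ, h⟩ => ⟨φ.symm, fun a v => by
        apply φ.injective; rw [h]; simp⟩
      trans := fun ⟨φ, h⟩ ⟨ψ, h'⟩ => ⟨φ.trans ψ, fun a v => by simp [h, h']⟩ }

/-- The dimension `∑ dimᴸ(X) dimᴿ(X)` of the component of degree `d`, the sum being over the
isomorphism classes of simple modules. -/
def componentDim (d : ZMod 2) : ℂ :=
  ∑ᶠ c : Quotient (simpleSetoid d), DMod.dimL c.out.1 * DMod.dimR c.out.1

/-- The crossed `S`-matrix with respect to chosen families of rows and columns. -/
def crossedS {ι κ : Type} (X : ι → DMod BinOct) (Y : κ → DMod BinOct) : Matrix ι κ ℂ :=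
  Matrix.of fun i j => DMod.sEntry (X i) (Y j)

end BinOct

/-- The Fourier matrix of the family of thirteen unipotent characters of the Ree group of type
`²F₄`. -/
def geckMalle : Matrix (Fin 13) (Fin 13) ℂ :=
  let s : ℂ := 3 * (√2 : ℝ)
  (1 / 12 : ℂ) • !![
    3, 3, 6, -6, -3, -3, -3, -3, -3, -3, 0, 0, 0;
    0, 0, 0, -4, 4, 4, 0, 0, 0, 0, 4, 4, -8;
    -6, -6, 0, -4, -2, -2, 0, 0, 0, 0, 4, 4, 4;
    3, 3, 6, 2, 1, 1, 3, 3, 3, 3, 4, 4, 4;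
    s, -s, 0, 0, -s, s, s, s, -s, -s, 0, 0, 0;
    s, -s, 0, 0, s, -s, -s, s, -s, s, 0, 0, 0;
    s, -s, 0, 0, s, -s, s, -s, s, -s, 0, 0, 0;
    0, 0, 0, 0, 0, 0, 6, -6, -6, 6, 0, 0, 0;
    3, 3, -6, -6, -3, -3, 3, 3, 3, 3, 0, 0, 0;
    -3, -3, 6, -2, -1, -1, 3, 3, 3, 3, -4, -4, -4;
    0, 0, 0, -4, 4, 4, 0, 0, 0, 0, 4, -8, 4;
    0, 0, 0, -4, 4, 4, 0, 0, 0, 0, -8, 4, 4;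
    s, -s, 0, 0, -s, s, -s, -s, s, s, 0, 0, 0]

/-- The matrix `F₁`. -/
def frobenius1 (ζ3 ζ4 : ℂ) : Matrix (Fin 13) (Fin 13) ℂ :=
  Matrix.diagonal ![1, 1, 1, 1, 1, ζ4, -ζ4, -1, 1, 1, ζ3, ζ3 ^ 2, -1]

/-- The diagonal matrix `F₂` of the eigenvalues of the Frobenius. -/
def frobenius2 (ζ3 ζ4 : ℂ) : Matrix (Fin 13) (Fin 13) ℂ :=
  Matrix.diagonal ![1, 1, 1, -1, -1, -1, -ζ4, ζ4, ζ4, -ζ4, -ζ3, -ζ3 ^ 2, -1]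

end

/-! ### Calculus in the double, characters, and the traces, double braidings and twists they
compute. -/

noncomputable section

namespace DrinfeldDouble

variable {G : Type} [Group G] [Fintype G] [DecidableEq G]

/-! Everything is read off from characters. The character of a `D(G)`-module is the function sending
`(g, k)` to the trace of `e_g k`. It is invariant under simultaneous conjugation and vanishes unless
`g` and `k` commute. Quantum traces are ordinary traces, so expanding the double braiding gives
`S_{X,Y} = ∑ χ_X(g, k) χ_Y(k, g)` (`sEntry_eq`). The Drinfeld morphism is the action of `∑ e_g g⁻¹`,
so the twist is the action of `∑ e_g g`, which on `V_{g,ρ}` is `ρ(g)` (`isTwist_V`).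

The double is separable: averaging over it projects the linear maps onto the module maps, and the
trace of this projection gives `dim Hom(X, Y)` as a scalar product of characters (`finrank_hom`).
Hence a module of norm one is simple, and a nonzero product of two simple modules forces an
isomorphism. A Frobenius reciprocity formula for `V_{g,ρ}` (`sum_char_V`) reduces scalar products
and `S`-entries to sums over the centralizer of `g`.

For the binary octahedral group there are 56 labels: eight characters at each of the two central
elements, and 4, 8, 6, 6, 8, 8 roots of unity at the six noncentral classes. The same labels index
the commuting pairs up to conjugation, so the character table is an explicit matrix, block diagonal
along the classes of `g` (`simpleModule_char`). Orthogonality makes the labelled modules simple and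
pairwise nonisomorphic. The decomposition of the regular character makes the list complete
(`exists_iso`).

Tensoring with `ε` multiplies `g` by `z`, and the degree records the action of `z`; both become
explicit on labels, and orbits and dimensions become finite checks. The `S`-matrix also needs the
class of the exchanged pair `(k, g)`, which is the table `swapLabel`. All statements about group
elements are decided in the faithful image in `SL₂(𝔽₇)`, through codes of the 48 normal forms. The
remaining identities of entries follow from `ζ6² = ζ6 - 1`, `ζ8⁴ = -1` and `√2 = ζ8 - ζ8³`. -/

theorem ofGroup_mul_e (x g k : G) : ofGroup x * e g k = e (x * g * x⁻¹) (x * k) := by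
  rw [ofGroup, Finset.sum_mul]
  simp [e_mul_e]

theorem delta_mul_e (x g k : G) : delta x * e g k = if x = g then e x k else 0 := by
  rw [delta, e_mul_e]; simp

theorem e_mul_delta (x g k : G) : e g k * delta x = if g = k * x * k⁻¹ then e g k else 0 := by
  rw [delta, e_mul_e]; simp

/-- Splits a basis element into a projector and a group element. The double is generated by these
two kinds of elements, and later commutation arguments treat them separately. -/
theorem delta_mul_ofGroup (g k : G) : delta g * ofGroup k = e g k := by
  rw [ofGroup, Finset.mul_sum]
  simp [delta_mul_e]

theorem ofGroup_mul (x y : G) : ofGroup x * ofGroup y = ofGroup (x * y) := by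
  rw [ofGroup.eq_def y, Finset.mul_sum]
  simp only [ofGroup_mul_e]
  exact Equiv.sum_comp (MulAut.conj x).toEquiv (fun g => e g (x * y))

theorem ofGroup_one : ofGroup (1 : G) = 1 := rfl

theorem ofGroup_mul_delta (x g : G) : ofGroup x * delta g = e (x * g * x⁻¹) x := by
  rw [delta, ofGroup_mul_e, mul_one]

theorem sum_delta : ∑ g : G, delta g = 1 := rfl

theorem eq_sum (a : DrinfeldDouble G) : a = ∑ p : G × G, a p • e p.1 p.2 := by
  conv_lhs => rw [← basis.sum_repr a]
  rfl

end DrinfeldDouble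

namespace DMod

open DrinfeldDouble

variable {G : Type} [Group G] [Fintype G] [DecidableEq G]

/-- The character of a module, as a function on pairs: the trace of `e_g k`. -/
def char (X : DMod G) (g k : G) : ℂ := LinearMap.trace ℂ X.carrier (X.act (e g k))

theorem act_comp (X : DMod G) (a b : DrinfeldDouble G) : X.act a ∘ₗ X.act b = X.act (a * b) := by
  rw [map_mul]; rfl

theorem act_mul_apply (X : DMod G) (a b : DrinfeldDouble G) (v : X.carrier) :
    X.act (a * b) v = X.act a (X.act b v) := by
  rw [map_mul]; rfl

theorem trace_act_mul_comm (X : DMod G) (a b : DrinfeldDouble G) :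
    LinearMap.trace ℂ X.carrier (X.act (a * b)) = LinearMap.trace ℂ X.carrier (X.act (b * a)) := by
  rw [← act_comp, ← act_comp, LinearMap.trace_comp_comm']

/-- Conjugation by the invertible element `ofGroup x` conjugates both indices of a basis element,
and the trace does not see it. -/
theorem char_conj (X : DMod G) (x g k : G) :
    X.char (x * g * x⁻¹) (x * k * x⁻¹) = X.char g k := by
  have h : e (x * g * x⁻¹) (x * k * x⁻¹) = ofGroup x * (e g k * ofGroup x⁻¹) := by
    rw [← delta_mul_ofGroup g k, mul_assoc (delta g), ofGroup_mul, delta_mul_ofGroup,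
      ofGroup_mul_e, mul_assoc x k]
  rw [char, h, trace_act_mul_comm, mul_assoc, ofGroup_mul, inv_mul_cancel, ofGroup_one, mul_one, char]

/-- The idempotent `delta g` absorbed on the left of `e g k` can be moved to the right under the
trace, where it survives only if `k` fixes `g`. -/
theorem char_eq_zero (X : DMod G) {g k : G} (h : g * k ≠ k * g) : X.char g k = 0 := by
  have h1 : e g k = delta g * e g k := by rw [delta_mul_e, if_pos rfl]
  rw [char, h1, trace_act_mul_comm, e_mul_delta, if_neg, map_zero, map_zero]
  intro hh
  exact h (by conv_lhs => rw [hh]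
              group)

theorem trace_ofGroup_mul_delta (X : DMod G) (g k : G) :
    LinearMap.trace ℂ X.carrier (X.act (ofGroup k * delta g)) = X.char g k := by
  rw [trace_act_mul_comm, delta_mul_ofGroup, char]

theorem finrank_eq_sum_char (X : DMod G) :
    (Module.finrank ℂ X.carrier : ℂ) = ∑ g, X.char g 1 := by
  simp only [char]
  rw [← map_sum, ← map_sum]
  change _ = LinearMap.trace ℂ X.carrier (X.act 1)
  rw [map_one, LinearMap.trace_one]

theorem Iso.symm {X Y : DMod G} : Iso X Y → Iso Y X := fun ⟨φ, h⟩ => ⟨φ.symm, fun a v => by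
  apply φ.injective; rw [h]; simp⟩

theorem Iso.trans {X Y Z : DMod G} : Iso X Y → Iso Y Z → Iso X Z := fun ⟨φ, h⟩ ⟨ψ, h'⟩ =>
  ⟨φ.trans ψ, fun a v => by simp [h, h']⟩

theorem Iso.char_eq {X Y : DMod G} (h : Iso X Y) : X.char = Y.char := by
  obtain ⟨φ, h⟩ := h
  funext g k
  rw [char, char, ← LinearMap.trace_conj' _ φ]
  congr 1
  ext v
  simp [LinearEquiv.conj_apply, h]

theorem tensor_act_e (X Y : DMod G) (g k : G) :
    (tensor X Y).act (e g k) = ∑ x : G, TensorProduct.map (X.act (e x k)) (Y.act (e (x⁻¹ * g) k)) := by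
  change actTensor X Y (comulLinear (e g k)) = _
  rw [comulLinear_e, map_sum]
  rfl

theorem char_tensor (X Y : DMod G) (g k : G) :
    (tensor X Y).char g k = ∑ x, X.char x k * Y.char (x⁻¹ * g) k := by
  rw [char, tensor_act_e]
  change LinearMap.trace ℂ (X.carrier ⊗[ℂ] Y.carrier) _ = _
  rw [map_sum]
  exact Finset.sum_congr rfl fun x _ => LinearMap.trace_tensorProduct' _ _

theorem trace_eq_sum_coord {V ι : Type} [AddCommGroup V] [Module ℂ V] [Fintype ι]
    (b : Module.Basis ι ℂ V) (f : Module.End ℂ V) :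
    LinearMap.trace ℂ V f = ∑ i, b.coord i (f (b i)) := by
  classical
  rw [LinearMap.trace_eq_matrix_trace ℂ b]
  simp [Matrix.trace, LinearMap.toMatrix_apply]

/-- The coevaluation of `1` is the sum of `b_i ⊗ b_i*`, so closing the strand produces the sum of
the diagonal coefficients. -/
theorem contractLeft_coevaluation {V : Type} [AddCommGroup V] [Module ℂ V] [FiniteDimensional ℂ V]
    (f : Module.End ℂ V) :
    contractLeft ℂ V (TensorProduct.comm ℂ V (Module.Dual ℂ V)
      (TensorProduct.map f LinearMap.id (coevaluation ℂ V 1))) = LinearMap.trace ℂ V f := by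
  rw [coevaluation_apply_one]
  simp only [map_sum, TensorProduct.map_tmul, TensorProduct.comm_tmul, contractLeft_apply,
    LinearMap.id_apply]
  exact (trace_eq_sum_coord (Module.Basis.ofVectorSpace ℂ V) f).symm

theorem traceR_eq (X : DMod G) (f : Module.End ℂ X.carrier) :
    traceR X f = LinearMap.trace ℂ X.carrier f := by
  rw [traceR, ← contractLeft_coevaluation, coevaluation_apply_one]
  simp [map_sum, TensorProduct.map_tmul]

theorem traceL_eq (X : DMod G) (f : Module.End ℂ X.carrier) :
    traceL X f = LinearMap.trace ℂ X.carrier f := by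
  rw [traceL, ← LinearMap.trace_transpose', coevaluation_apply_one,
    trace_eq_sum_coord (Module.Basis.ofVectorSpace ℂ (Module.Dual ℂ X.carrier))]
  simp only [map_sum, TensorProduct.map_tmul, contractLeft_apply, LinearMap.id_apply,
    LinearMap.comp_apply, LinearEquiv.coe_coe]
  refine Finset.sum_congr rfl fun i _ => ?_
  -- In finite dimension a coordinate functional on the dual space is evaluation at a vector of the
  -- space itself.
  obtain ⟨v, hv⟩ := (Module.evalEquiv ℂ X.carrier).surjective
    ((Module.Basis.ofVectorSpace ℂ (Module.Dual ℂ X.carrier)).coord i)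
  rw [← hv, LinearEquiv.symm_apply_apply]
  rfl

theorem dimR_eq (X : DMod G) : dimR X = Module.finrank ℂ X.carrier := by
  rw [dimR, traceR_eq, LinearMap.trace_id]

theorem dimL_eq (X : DMod G) : dimL X = Module.finrank ℂ X.carrier := by
  rw [dimL, traceL_eq, LinearMap.trace_id]

theorem actTensor_rMatrix_tmul (X Y : DMod G) (v : X.carrier) (w : Y.carrier) :
    actTensor X Y rMatrix (v ⊗ₜ w) = ∑ g : G, X.act (ofGroup g) v ⊗ₜ Y.act (delta g) w := by
  rw [rMatrix, map_sum, LinearMap.sum_apply]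
  rfl

theorem braiding_tmul (X Y : DMod G) (v : X.carrier) (w : Y.carrier) :
    braiding X Y (v ⊗ₜ w) = ∑ g : G, Y.act (delta g) w ⊗ₜ X.act (ofGroup g) v := by
  rw [braiding, LinearMap.comp_apply, actTensor_rMatrix_tmul, map_sum]
  rfl

/-- This is the action of `R₂₁R`: the first crossing applies `k` to `X` and `delta k` to `Y`, the
second one then applies `delta g` to `X` and `g` to `Y`. -/
theorem doubleBraiding_eq (X Y : DMod G) :
    doubleBraiding X Y = ∑ g : G, ∑ k : G,
      TensorProduct.map (X.act (e g k)) (Y.act (ofGroup g * delta k)) := by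
  ext v w
  simp only [TensorProduct.AlgebraTensorModule.curry_apply, LinearMap.restrictScalars_self,
    TensorProduct.curry_apply, doubleBraiding, LinearMap.comp_apply, braiding_tmul, map_sum,
    LinearMap.sum_apply, TensorProduct.map_tmul, act_mul_apply, ← delta_mul_ofGroup]
  rw [Finset.sum_comm]

theorem sEntry_eq (X Y : DMod G) : sEntry X Y = ∑ g, ∑ k, X.char g k * Y.char k g := by
  refine (traceR_eq (tensor X Y) (doubleBraiding X Y)).trans ?_
  change LinearMap.trace ℂ (X.carrier ⊗[ℂ] Y.carrier) (doubleBraiding X Y) = _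
  simp only [doubleBraiding_eq, map_sum]
  refine Finset.sum_congr rfl fun g _ => Finset.sum_congr rfl fun k _ => ?_
  rw [← trace_ofGroup_mul_delta Y]
  exact LinearMap.trace_tensorProduct' _ _

/-- The Drinfeld element is obtained by contracting `S(R'')R'`, which here is the sum of `S(δ_g) g =
δ_{g⁻¹} g`; replacing `g` by its inverse gives `∑ e_g g⁻¹`. -/
theorem drinfeldMorphism_apply (X : DMod G) (v : X.carrier) :
    drinfeldMorphism X v = Module.Dual.eval ℂ X.carrier (X.act (∑ g, e g g⁻¹) v) := by
  have h1 : ∀ (f : Module.Dual ℂ X.carrier), contractLeft ℂ X.carrier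
      (braiding X (leftDual X) (v ⊗ₜ f)) = f (X.act (∑ g, e g g⁻¹) v) := by
    intro f
    have h2 : ∀ g : G, contractLeft ℂ X.carrier
        (((leftDual X).act (delta g) f : Module.Dual ℂ X.carrier) ⊗ₜ[ℂ] X.act (ofGroup g) v) =
        f (X.act (e g⁻¹ g) v) := by
      intro g
      refine (contractLeft_apply _ _).trans ?_
      change f (X.act (antipode (delta g)) _) = _
      rw [← act_mul_apply, delta, antipode_e, inv_one, one_mul, mul_one]
      change f (X.act (delta g⁻¹ * ofGroup g) v) = _
      rw [delta_mul_ofGroup]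
    refine (congrArg (contractLeft ℂ X.carrier) (braiding_tmul X (leftDual X) v f)).trans ?_
    refine (map_sum (contractLeft ℂ X.carrier) _ _).trans ?_
    rw [map_sum, LinearMap.sum_apply, map_sum, ← Equiv.sum_comp (Equiv.inv G)]
    refine Finset.sum_congr rfl fun g _ => (h2 g⁻¹).trans ?_
    rw [inv_inv]
  -- All the maps following the insertion of the coevaluation, with `v` held fixed; it then suffices
  -- to know `Φ` on pure tensors.
  let Φ : Module.Dual ℂ X.carrier ⊗[ℂ] Module.Dual ℂ (Module.Dual ℂ X.carrier) →ₗ[ℂ]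
      Module.Dual ℂ (Module.Dual ℂ X.carrier) :=
    (TensorProduct.lid ℂ (Module.Dual ℂ (Module.Dual ℂ X.carrier))).toLinearMap ∘ₗ
      TensorProduct.map (contractLeft ℂ X.carrier) LinearMap.id ∘ₗ
      TensorProduct.map (braiding X (leftDual X)) LinearMap.id ∘ₗ
      (TensorProduct.assoc ℂ X.carrier (Module.Dual ℂ X.carrier)
        (Module.Dual ℂ (Module.Dual ℂ X.carrier))).symm.toLinearMap ∘ₗ
      TensorProduct.mk ℂ X.carrier _ v
  have h3 : ∀ (f : Module.Dual ℂ X.carrier) (F : Module.Dual ℂ (Module.Dual ℂ X.carrier)),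
      Φ (f ⊗ₜ F) = f (X.act (∑ g, e g g⁻¹) v) • F := fun f F => by
    rw [← h1 f]
    rfl
  have h4 : drinfeldMorphism X v = Φ (coevaluation ℂ (Module.Dual ℂ X.carrier) 1) := rfl
  set b := Module.Basis.ofVectorSpace ℂ (Module.Dual ℂ X.carrier)
  have h5 : drinfeldMorphism X v = ∑ i, (b i) (X.act (∑ g, e g g⁻¹) v) • b.coord i := by
    rw [h4, coevaluation_apply_one]
    exact (map_sum Φ _ _).trans (Finset.sum_congr rfl fun i _ => h3 _ _)
  rw [h5]
  ext f
  simp only [LinearMap.sum_apply, LinearMap.smul_apply, smul_eq_mul, Module.Dual.eval_apply]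
  conv_rhs => rw [← b.sum_repr f]
  simp only [LinearMap.sum_apply, LinearMap.smul_apply, smul_eq_mul, Module.Basis.coord_apply]
  exact Finset.sum_congr rfl fun i _ => mul_comm _ _

/-- The element `∑ e_g g` inverts the Drinfeld element, so its action solves `a = u θ` when `a` is
the bidual isomorphism. -/
theorem isTwist_smul_id (X : DMod G) (c : ℂ) (h : ∀ v, X.act (∑ g, e g g) v = c • v) :
    IsTwist X (c • LinearMap.id) := by
  have h1 : (∑ g : G, e g g⁻¹) * (∑ g : G, e g g) = 1 := by
    rw [Finset.sum_mul_sum, one_def]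
    simp only [e_mul_e]
    refine Finset.sum_congr rfl fun g _ => ?_
    have : ∀ x : G, (g = g⁻¹ * x * g⁻¹⁻¹) ↔ x = g := fun x => by
      constructor
      · intro hh
        have : x = g * (g⁻¹ * x * g⁻¹⁻¹) * g⁻¹ := by group
        rw [this, ← hh]; group
      · rintro rfl; group
    simp only [this, Finset.sum_ite_eq', Finset.mem_univ, if_true, inv_mul_cancel]
  ext1 v
  rw [LinearMap.comp_apply, LinearMap.smul_apply, LinearMap.id_apply, ← h, drinfeldMorphism_apply,
    ← act_mul_apply, h1, map_one]
  rfl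

end DMod
end

/-! ### Averaging over the double: dimensions of spaces of morphisms, complements and Schur's lemma.
-/

noncomputable section

section sandwich

variable {V W : Type} [AddCommGroup V] [Module ℂ V] [AddCommGroup W] [Module ℂ W]

theorem linearMap_comp_sum {U ι : Type} [AddCommGroup U] [Module ℂ U] (s : Finset ι)
    (f : W →ₗ[ℂ] U) (g : ι → V →ₗ[ℂ] W) : f ∘ₗ (∑ i ∈ s, g i) = ∑ i ∈ s, f ∘ₗ g i := by
  ext v; simp

theorem linearMap_sum_comp {U ι : Type} [AddCommGroup U] [Module ℂ U] (s : Finset ι)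
    (f : ι → W →ₗ[ℂ] U) (g : V →ₗ[ℂ] W) : (∑ i ∈ s, f i) ∘ₗ g = ∑ i ∈ s, f i ∘ₗ g := by
  ext v; simp

/-- The endomorphism `φ ↦ B ∘ φ ∘ A` of the space of linear maps. -/
def sandwich (A : Module.End ℂ V) (B : Module.End ℂ W) : Module.End ℂ (V →ₗ[ℂ] W) :=
  LinearMap.compRight ℂ B ∘ₗ LinearMap.lcomp ℂ W A

theorem sandwich_apply (A : Module.End ℂ V) (B : Module.End ℂ W) (φ : V →ₗ[ℂ] W) :
    sandwich A B φ = B ∘ₗ φ ∘ₗ A := rfl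

/-- Under the identification of the linear maps with `V* ⊗ W`, the operator becomes the tensor
product of the transpose of `A` with `B`. -/
theorem trace_sandwich [FiniteDimensional ℂ V] [FiniteDimensional ℂ W] (A : Module.End ℂ V)
    (B : Module.End ℂ W) :
    LinearMap.trace ℂ _ (sandwich A B) = LinearMap.trace ℂ V A * LinearMap.trace ℂ W B := by
  have h : sandwich A B =
      (dualTensorHomEquiv ℂ V W).conj (TensorProduct.map (Module.Dual.transpose A) B) := by
    ext φ v
    obtain ⟨t, rfl⟩ := (dualTensorHomEquiv ℂ V W).surjective φ
    rw [LinearEquiv.conj_apply_apply, LinearEquiv.symm_apply_apply, sandwich_apply]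
    induction t with
    | zero => simp
    | tmul f w => simp [Module.Dual.transpose_apply]
    | add x y hx hy => simp only [map_add, LinearMap.add_apply, LinearMap.comp_add,
        LinearMap.add_comp, hx, hy]
  rw [h, LinearMap.trace_conj', LinearMap.trace_tensorProduct', LinearMap.trace_transpose']

end sandwich

namespace DMod

open DrinfeldDouble

variable {G : Type} [Group G] [Fintype G] [DecidableEq G]

/-- The space of morphisms of `D(G)`-modules. -/
def hom (X Y : DMod G) : Submodule ℂ (X.carrier →ₗ[ℂ] Y.carrier) where
  carrier := {φ | ∀ a, φ ∘ₗ X.act a = Y.act a ∘ₗ φ}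
  add_mem' h h' a := by rw [LinearMap.add_comp, LinearMap.comp_add, h a, h' a]
  zero_mem' a := by simp
  smul_mem' c φ h a := by rw [LinearMap.smul_comp, LinearMap.comp_smul, h a]

/-- The average of linear maps over the Drinfeld double. -/
def average (X Y : DMod G) : Module.End ℂ (X.carrier →ₗ[ℂ] Y.carrier) :=
  (Fintype.card G : ℂ)⁻¹ • ∑ g : G, ∑ k : G,
    sandwich (X.act (ofGroup k⁻¹ * delta g)) (Y.act (e g k))

theorem average_apply (X Y : DMod G) (φ : X.carrier →ₗ[ℂ] Y.carrier) :
    average X Y φ = (Fintype.card G : ℂ)⁻¹ • ∑ g : G, ∑ k : G,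
      Y.act (e g k) ∘ₗ φ ∘ₗ X.act (ofGroup k⁻¹ * delta g) := by
  simp only [average, LinearMap.smul_apply, LinearMap.sum_apply, sandwich_apply]

theorem mem_hom_of_basis {X Y : DMod G} {φ : X.carrier →ₗ[ℂ] Y.carrier}
    (h1 : ∀ x, φ ∘ₗ X.act (delta x) = Y.act (delta x) ∘ₗ φ)
    (h2 : ∀ y, φ ∘ₗ X.act (ofGroup y) = Y.act (ofGroup y) ∘ₗ φ) : φ ∈ hom X Y := by
  intro a
  rw [eq_sum a]
  simp only [map_sum, map_smul, linearMap_comp_sum, linearMap_sum_comp, LinearMap.comp_smul,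
    LinearMap.smul_comp]
  refine Finset.sum_congr rfl fun p _ => ?_
  rw [← delta_mul_ofGroup, ← act_comp, ← act_comp, ← LinearMap.comp_assoc, h1,
    LinearMap.comp_assoc, h2, LinearMap.comp_assoc]

/-- The tensor `|G|⁻¹ ∑ e_g k ⊗ k⁻¹ δ_g` is a Casimir element: multiplying its first factor on the
left by any `a` has the same effect as multiplying its second factor on the right by `a`. -/
theorem average_mem (X Y : DMod G) (φ : X.carrier →ₗ[ℂ] Y.carrier) : average X Y φ ∈ hom X Y := by
  rw [average_apply]
  refine Submodule.smul_mem _ _ (mem_hom_of_basis (fun x => ?_) fun y => ?_)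
  · simp only [linearMap_comp_sum, linearMap_sum_comp]
    refine Finset.sum_congr rfl fun g _ => Finset.sum_congr rfl fun k _ => ?_
    rw [LinearMap.comp_assoc, LinearMap.comp_assoc, act_comp, ← LinearMap.comp_assoc _ _ (Y.act (delta x)),
      act_comp, delta_mul_e, mul_assoc, delta.eq_def x, delta_mul_e]
    by_cases hx : x = g
    · subst hx
      rw [if_pos rfl, if_pos rfl]
      rfl
    · rw [if_neg hx, if_neg (Ne.symm hx)]
      simp
  · simp only [linearMap_comp_sum, linearMap_sum_comp]
    -- Replacing `g` by `y g y⁻¹` and `k` by `y k` turns `e_g k` into `y e_g k`, and `k⁻¹ δ_g y`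
    -- into `k⁻¹ δ_g`.
    rw [← Equiv.sum_comp (MulAut.conj y).toEquiv]
    refine Finset.sum_congr rfl fun g _ => ?_
    rw [← Equiv.sum_comp (Equiv.mulLeft y)]
    refine Finset.sum_congr rfl fun k _ => ?_
    rw [LinearMap.comp_assoc, LinearMap.comp_assoc, act_comp,
      ← LinearMap.comp_assoc _ _ (Y.act (ofGroup y)), act_comp, ofGroup_mul_e]
    congr 3
    simp only [Equiv.coe_mulLeft, MulEquiv.toEquiv_eq_coe, MulEquiv.coe_toEquiv, MulAut.conj_apply,
      ofGroup_mul_delta, mul_inv_rev]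
    rw [← delta_mul_ofGroup, mul_assoc, ofGroup_mul, delta_mul_ofGroup]
    congr 1 <;> group

/-- A module map can be pulled out of each term, and `(e_g k)(k⁻¹ δ_g) = δ_g` does not depend on
`k`; the sum over `k` cancels the factor `|G|⁻¹`, and the `δ_g` add up to one. -/
theorem average_of_mem {X Y : DMod G} {φ : X.carrier →ₗ[ℂ] Y.carrier} (h : φ ∈ hom X Y) :
    average X Y φ = φ := by
  rw [average_apply]
  have h1 : ∀ g k : G, Y.act (e g k) ∘ₗ φ ∘ₗ X.act (ofGroup k⁻¹ * delta g) =
      φ ∘ₗ X.act (delta g) := fun g k => by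
    rw [← LinearMap.comp_assoc, ← h, LinearMap.comp_assoc, act_comp, ← mul_assoc,
      ← delta_mul_ofGroup, mul_assoc (delta g), ofGroup_mul, mul_inv_cancel, ofGroup_one, mul_one]
    congr 2
    exact (delta_mul_e g g 1).trans (if_pos rfl)
  simp only [h1, Finset.sum_const, Finset.card_univ]
  rw [← Finset.smul_sum, ← linearMap_comp_sum, ← map_sum, sum_delta, map_one,
    ← Nat.cast_smul_eq_nsmul ℂ, smul_smul, inv_mul_cancel₀ (by simp), one_smul]
  rfl

/-- The scalar product of the characters of two modules. -/
def pairing (X Y : DMod G) : ℂ :=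
  (Fintype.card G : ℂ)⁻¹ * ∑ g, ∑ k, X.char g k⁻¹ * Y.char g k

/-- The averaging operator is a projection onto the module maps, so its trace is the dimension of
its image; this trace splits into products of characters by `trace_sandwich`. -/
theorem finrank_hom (X Y : DMod G) : (Module.finrank ℂ (hom X Y) : ℂ) = pairing X Y := by
  have h : LinearMap.IsProj (hom X Y) (average X Y) :=
    ⟨average_mem X Y, fun φ h => average_of_mem h⟩
  rw [← LinearMap.IsProj.trace h, average, pairing]
  simp only [map_smul, map_sum, trace_sandwich, trace_ofGroup_mul_delta, smul_eq_mul]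
  rfl

theorem exists_hom_ne_zero {X Y : DMod G} (h : pairing X Y ≠ 0) : ∃ φ ∈ hom X Y, φ ≠ 0 := by
  by_contra! hc
  have h0 : hom X Y = ⊥ := (Submodule.eq_bot_iff _).2 hc
  apply h
  rw [← finrank_hom, h0, finrank_bot, Nat.cast_zero]

/-- Schur's lemma: the kernel and the image of a nonzero morphism between simple modules are
submodules. -/
theorem iso_of_pairing_ne_zero {X Y : DMod G} (hX : X.IsSimple) (hY : Y.IsSimple)
    (h : pairing X Y ≠ 0) : Iso X Y := by
  obtain ⟨φ, hφ, h0⟩ := exists_hom_ne_zero h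
  have happ : ∀ a v, φ (X.act a v) = Y.act a (φ v) := fun a v => LinearMap.congr_fun (hφ a) v
  have hk : LinearMap.ker φ = ⊥ := by
    refine (hX.2 (LinearMap.ker φ) fun a v hv => ?_).resolve_right
      fun ht => h0 (LinearMap.ker_eq_top.1 ht)
    rw [LinearMap.mem_ker] at hv ⊢
    rw [happ, hv, map_zero]
  have hr : LinearMap.range φ = ⊤ := by
    refine (hY.2 (LinearMap.range φ) ?_).resolve_left fun ht => h0 (LinearMap.range_eq_bot.1 ht)
    rintro a _ ⟨v, rfl⟩
    exact ⟨X.act a v, happ a v⟩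
  exact ⟨LinearEquiv.ofBijective φ ⟨LinearMap.ker_eq_bot.1 hk, LinearMap.range_eq_top.1 hr⟩, happ⟩

/-- Maschke's argument. The average of a linear projector onto a submodule `W` is an endomorphism
with values in `W` and fixing `W`. Since the endomorphisms form a line, it is a scalar: if zero, `W`
vanishes, and otherwise `W` is everything. -/
theorem isSimple_of_pairing_eq_one {X : DMod G} (h : pairing X X = 1) : X.IsSimple := by
  rw [← finrank_hom, Nat.cast_eq_one] at h
  have hid : LinearMap.id ∈ hom X X := fun a => rfl
  have hne : (⟨LinearMap.id, hid⟩ : hom X X) ≠ 0 := by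
    intro h0
    have h1 : (LinearMap.id : X.carrier →ₗ[ℂ] X.carrier) = 0 := congrArg Subtype.val h0
    have : hom X X = ⊥ := (Submodule.eq_bot_iff _).2 fun φ _ => by
      rw [← LinearMap.comp_id φ, h1, LinearMap.comp_zero]
    rw [this, finrank_bot] at h
    exact zero_ne_one h
  refine ⟨?_, fun W hW => ?_⟩
  · by_contra hc
    rw [not_nontrivial_iff_subsingleton] at hc
    exact hne (Subtype.ext (LinearMap.ext fun v => Subsingleton.elim _ _))
  · obtain ⟨p, hp⟩ := LinearMap.exists_leftInverse_of_injective W.subtype W.ker_subtype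
    set P : X.carrier →ₗ[ℂ] X.carrier := W.subtype ∘ₗ p with hP
    have hPW : ∀ v ∈ W, P v = v := fun v hv =>
      congrArg Subtype.val (LinearMap.congr_fun hp ⟨v, hv⟩)
    have hmem : ∀ v, average X X P v ∈ W := fun v => by
      rw [average_apply]
      simp only [LinearMap.smul_apply, LinearMap.sum_apply, LinearMap.comp_apply]
      exact W.smul_mem _ (W.sum_mem fun g _ => W.sum_mem fun k _ => hW _ _ (p _).2)
    have hfix : ∀ v ∈ W, average X X P v = v := fun v hv => by
      -- The identity is its own average. On a vector of `W` the averages of the projector and of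
      -- the identity agree term by term, because `W` is stable under the action.
      conv_rhs => rw [← LinearMap.id_apply (R := ℂ) v, ← average_of_mem hid]
      rw [average_apply, average_apply]
      simp only [LinearMap.smul_apply, LinearMap.sum_apply, LinearMap.comp_apply]
      congr 1
      refine Finset.sum_congr rfl fun g _ => Finset.sum_congr rfl fun k _ => ?_
      rw [hPW _ (hW _ _ hv)]
      rfl
    obtain ⟨c, hc⟩ := (finrank_eq_one_iff_of_nonzero' _ hne).1 h ⟨_, average_mem X X P⟩
    have hc' : ∀ v, average X X P v = c • v := fun v =>
      (LinearMap.congr_fun (congrArg Subtype.val hc) v).symm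
    by_cases h0 : c = 0
    · left
      rw [Submodule.eq_bot_iff]
      intro v hv
      rw [← hfix v hv, hc', h0, zero_smul]
    · right
      rw [Submodule.eq_top_iff']
      intro v
      have := W.smul_mem c⁻¹ (hmem v)
      rwa [hc', smul_smul, inv_mul_cancel₀ h0, one_smul] at this

theorem pairing_congr {X X' Y Y' : DMod G} (h : X.char = X'.char) (h' : Y.char = Y'.char) :
    pairing X Y = pairing X' Y' := by
  rw [pairing, pairing, h, h']

theorem sEntry_congr {X X' Y Y' : DMod G} (h : X.char = X'.char) (h' : Y.char = Y'.char) :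
    sEntry X Y = sEntry X' Y' := by
  rw [sEntry_eq, sEntry_eq, h, h']

/-! ### Characters, scalar products, `S`-entries and twists of the induced modules `V_{g,ρ}`. -/

section simple

variable {W : Type} [AddCommGroup W] [Module ℂ W]

theorem trace_pi {ι : Type} [Fintype ι] [DecidableEq ι] [FiniteDimensional ℂ W]
    (T : Module.End ℂ (ι → W)) :
    LinearMap.trace ℂ _ T = ∑ i, LinearMap.trace ℂ W
      (LinearMap.proj i ∘ₗ T ∘ₗ LinearMap.single ℂ (fun _ => W) i) := by
  let S : ι → W →ₗ[ℂ] (ι → W) := LinearMap.single ℂ (fun _ => W)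
  let π : ι → (ι → W) →ₗ[ℂ] W := fun i => LinearMap.proj i
  have h : T = ∑ i, (T ∘ₗ S i) ∘ₗ π i := by
    refine LinearMap.ext fun f => ?_
    rw [LinearMap.sum_apply]
    conv_lhs => rw [← Finset.univ_sum_single f, map_sum]
    rfl
  conv_lhs => rw [h, map_sum]
  exact Finset.sum_congr rfl fun i _ => (LinearMap.trace_comp_comm' (T ∘ₗ S i) (π i)).symm

variable (g : G) (ρ : Representation ℂ (Subgroup.centralizer {g}) W)

instance : Fintype (Subgroup.centralizer {g}) := Fintype.ofFinite _

/-- The projection of the space of all functions onto the induced space. -/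
def inducedProj : (G → W) →ₗ[ℂ] inducedSpace g ρ where
  toFun f := ⟨fun x => (Fintype.card (Subgroup.centralizer {g}) : ℂ)⁻¹ •
      ∑ c : Subgroup.centralizer {g}, ρ c (f (x * c)), fun x k => by
    beta_reduce
    rw [map_smul, map_sum, ← Equiv.sum_comp (Equiv.mulLeft k⁻¹)
      (fun c : Subgroup.centralizer {g} => ρ c (f (x * k * c)))]
    congr 1
    refine Finset.sum_congr rfl fun c _ => ?_
    simp [mul_assoc]⟩
  map_add' f f' := by
    ext x; simp [Finset.sum_add_distrib]
  map_smul' a f := by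
    ext x; simp [← Finset.smul_sum, smul_comm a]

theorem inducedProj_apply (f : G → W) (x : G) :
    (inducedProj g ρ f).1 x = (Fintype.card (Subgroup.centralizer {g}) : ℂ)⁻¹ •
      ∑ c : Subgroup.centralizer {g}, ρ c (f (x * c)) := rfl

theorem inducedProj_of_mem (f : inducedSpace g ρ) : inducedProj g ρ f.1 = f := by
  ext x
  rw [inducedProj_apply]
  have : ∀ c : Subgroup.centralizer {g}, ρ c (f.1 (x * c)) = f.1 x := fun c => by
    rw [f.2]; simp
  simp only [this, Finset.sum_const, Finset.card_univ]
  rw [← Nat.cast_smul_eq_nsmul ℂ, smul_smul, inv_mul_cancel₀ (by simp), one_smul]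

variable [FiniteDimensional ℂ W]

theorem V_act_e_apply (x k : G) (f : inducedSpace g ρ) (y : G) :
    ((V g ρ).act (e x k) f : inducedSpace g ρ).1 y =
      if y * g * y⁻¹ = x then f.1 (k⁻¹ * y) else 0 := by
  change (inducedAct g ρ (e x k) f).1 y = _
  rw [inducedAct_apply]
  simp only [e_apply]
  by_cases h : y * g * y⁻¹ = x <;> simp [h]

/-- The induced space is the image of a projection of the space of all functions, so the trace may
be computed on the latter, where the diagonal block at `y` is explicit. -/
theorem char_V (x k : G) : (V g ρ).char x k =
    (Fintype.card (Subgroup.centralizer {g}) : ℂ)⁻¹ * ∑ y : G,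
      ∑ c : Subgroup.centralizer {g}, if y * g * y⁻¹ = x ∧ k * y = y * c then
        LinearMap.trace ℂ W (ρ c) else 0 := by
  have h1 : LinearMap.trace ℂ (G → W)
      ((inducedSpace g ρ).subtype ∘ₗ inducedAct g ρ (e x k) ∘ₗ inducedProj g ρ) =
      (V g ρ).char x k := by
    rw [LinearMap.trace_comp_comm', LinearMap.comp_assoc]
    have : inducedProj g ρ ∘ₗ (inducedSpace g ρ).subtype = LinearMap.id :=
      LinearMap.ext fun f => inducedProj_of_mem g ρ f
    rw [this, LinearMap.comp_id]
    rfl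
  rw [← h1, trace_pi, Finset.mul_sum]
  refine Finset.sum_congr rfl fun y _ => ?_
  have h2 : LinearMap.proj y ∘ₗ ((inducedSpace g ρ).subtype ∘ₗ inducedAct g ρ (e x k) ∘ₗ
      inducedProj g ρ) ∘ₗ LinearMap.single ℂ (fun _ => W) y =
      (Fintype.card (Subgroup.centralizer {g}) : ℂ)⁻¹ • ∑ c : Subgroup.centralizer {g},
        if y * g * y⁻¹ = x ∧ k * y = y * c then ρ c else 0 := by
    ext w
    simp only [LinearMap.comp_apply, LinearMap.proj_apply, Submodule.subtype_apply,
      LinearMap.smul_apply, LinearMap.sum_apply]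
    refine (V_act_e_apply g ρ x k _ y).trans ?_
    rw [inducedProj_apply]
    by_cases h : y * g * y⁻¹ = x
    · rw [if_pos h]
      congr 1
      refine Finset.sum_congr rfl fun c _ => ?_
      -- A function concentrated at `y`, projected and then translated by `k`, returns to `y` only
      -- through those `c` with `k y = y c`.
      have : k⁻¹ * y * c = y ↔ k * y = y * c := by
        rw [mul_assoc, inv_mul_eq_iff_eq_mul, eq_comm]
      by_cases hc : k * y = y * c
      · rw [if_pos ⟨h, hc⟩, this.2 hc]; simp
      · rw [if_neg (fun hh => hc hh.2), LinearMap.single_apply, Pi.single_eq_of_ne (fun hh => hc (this.1 hh))]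
        simp
    · simp [h]
  rw [h2, map_smul, map_sum, smul_eq_mul]
  congr 1
  refine Finset.sum_congr rfl fun c _ => ?_
  split_ifs <;> simp

/-- A form of Frobenius reciprocity: after conjugating back by `y`, each of the `|G|` values of `y`
contributes the same sum over the centralizer. It is applied to `F x k = χ(x, k⁻¹)` for scalar
products, and to `F x k = χ(k, x)` for the `S`-matrix. -/
theorem sum_char_V (F : G → G → ℂ)
    (hF : ∀ x a b, F (x * a * x⁻¹) (x * b * x⁻¹) = F a b) :
    ∑ x, ∑ k, (V g ρ).char x k * F x k =
      (Fintype.card G : ℂ) * (Fintype.card (Subgroup.centralizer {g}) : ℂ)⁻¹ *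
        ∑ c : Subgroup.centralizer {g}, LinearMap.trace ℂ W (ρ c) * F g c := by
  simp only [char_V, Finset.mul_sum, Finset.sum_mul]
  have h1 : ∀ x : G, ∑ k : G, ∑ y : G, ∑ c : Subgroup.centralizer {g},
      (Fintype.card (Subgroup.centralizer {g}) : ℂ)⁻¹ *
        (if y * g * y⁻¹ = x ∧ k * y = y * c then LinearMap.trace ℂ W (ρ c) else 0) * F x k =
      ∑ y : G, ∑ c : Subgroup.centralizer {g}, ∑ k : G,
      (Fintype.card (Subgroup.centralizer {g}) : ℂ)⁻¹ *
        (if y * g * y⁻¹ = x ∧ k * y = y * c then LinearMap.trace ℂ W (ρ c) else 0) * F x k := by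
    intro x
    rw [Finset.sum_comm]
    exact Finset.sum_congr rfl fun y _ => Finset.sum_comm
  simp only [h1]
  rw [Finset.sum_comm]
  have h2 : ∀ y : G, ∑ x : G, ∑ c : Subgroup.centralizer {g}, ∑ k : G,
      (Fintype.card (Subgroup.centralizer {g}) : ℂ)⁻¹ *
        (if y * g * y⁻¹ = x ∧ k * y = y * c then LinearMap.trace ℂ W (ρ c) else 0) * F x k =
      ∑ c : Subgroup.centralizer {g}, (Fintype.card (Subgroup.centralizer {g}) : ℂ)⁻¹ *
        (LinearMap.trace ℂ W (ρ c) * F g c) := by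
    intro y
    rw [Finset.sum_eq_single (y * g * y⁻¹)]
    · refine Finset.sum_congr rfl fun c _ => ?_
      rw [Finset.sum_eq_single (y * c * y⁻¹)]
      · rw [hF, if_pos ⟨rfl, by group⟩, mul_assoc]
      · intro k _ hk
        rw [if_neg]
        · simp
        · rintro ⟨-, hh⟩
          exact hk (by rw [← hh]; group)
      · simp
    · intro x _ hx
      refine Finset.sum_eq_zero fun c _ => Finset.sum_eq_zero fun k _ => ?_
      rw [if_neg (fun hh => hx hh.1.symm)]
      simp
    · simp
  simp only [h2, Finset.sum_const, Finset.card_univ, nsmul_eq_mul]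
  rw [Finset.mul_sum]
  exact Finset.sum_congr rfl fun c _ => by ring

theorem char_V_of_not_conj {x : G} (k : G) (h : ∀ y, y * g * y⁻¹ ≠ x) : (V g ρ).char x k = 0 := by
  rw [char_V]
  simp [h]

/-- Only the `y` in the centralizer contribute, and each contributes the trace of a conjugate of `ρ
k`; their number cancels the normalizing factor. -/
theorem char_V_self (k : Subgroup.centralizer {g}) :
    (V g ρ).char g k = LinearMap.trace ℂ W (ρ k) := by
  classical
  rw [char_V]
  have h1 : ∀ y : G, (∑ c : Subgroup.centralizer {g}, if y * g * y⁻¹ = g ∧ (k : G) * y = y * c then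
        LinearMap.trace ℂ W (ρ c) else 0) =
      if y ∈ Subgroup.centralizer {g} then LinearMap.trace ℂ W (ρ k) else 0 := by
    intro y
    have hy : y * g * y⁻¹ = g ↔ y ∈ Subgroup.centralizer {g} := by
      rw [Subgroup.mem_centralizer_singleton_iff, mul_inv_eq_iff_eq_mul]
    by_cases h : y ∈ Subgroup.centralizer {g}
    · rw [if_pos h]
      set y' : Subgroup.centralizer {g} := ⟨y, h⟩
      rw [Finset.sum_eq_single (y'⁻¹ * k * y')]
      · rw [if_pos ⟨hy.2 h, by simp [y', mul_assoc]⟩]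
        simp only [map_mul]
        rw [mul_assoc, LinearMap.trace_mul_comm, mul_assoc, ← map_mul, mul_inv_cancel, map_one, mul_one]
      · intro c _ hc
        rw [if_neg]
        rintro ⟨-, hh⟩
        apply hc
        ext
        simp [y', mul_assoc, hh]
      · simp
    · simp [h, hy]
  simp only [h1]
  rw [← Finset.sum_filter, Finset.sum_const, nsmul_eq_mul, ← mul_assoc]
  have h2 : (Finset.univ.filter fun y => y ∈ Subgroup.centralizer {g}).card =
      Fintype.card (Subgroup.centralizer {g}) := by
    rw [Fintype.card_subtype]
  rw [h2, inv_mul_cancel₀ (by simp), one_mul]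

theorem pairing_V (X : DMod G) : pairing (V g ρ) X =
    (Fintype.card (Subgroup.centralizer {g}) : ℂ)⁻¹ *
      ∑ c : Subgroup.centralizer {g}, LinearMap.trace ℂ W (ρ c) * X.char g (c : G)⁻¹ := by
  have h1 : ∀ x : G, ∑ k, (V g ρ).char x k⁻¹ * X.char x k =
      ∑ k, (V g ρ).char x k * X.char x k⁻¹ := fun x => by
    rw [← Equiv.sum_comp (Equiv.inv G)]
    simp
  rw [pairing]
  simp only [h1]
  rw [sum_char_V g ρ (fun x k => X.char x k⁻¹), ← mul_assoc, ← mul_assoc, inv_mul_cancel₀ (by simp), one_mul]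
  intro x a b
  rw [← X.char_conj x a b⁻¹]
  congr 1
  group

theorem sEntry_V (Y : DMod G) : sEntry (V g ρ) Y =
    (Fintype.card G : ℂ) * (Fintype.card (Subgroup.centralizer {g}) : ℂ)⁻¹ *
      ∑ c : Subgroup.centralizer {g}, LinearMap.trace ℂ W (ρ c) * Y.char c g := by
  rw [sEntry_eq]
  exact sum_char_V g ρ (fun x k => Y.char k x) fun x a b => Y.char_conj x b a

/-- At a point `y` only the term of `∑ e_x x` with `x = y g y⁻¹` survives. It evaluates `f` at `x⁻¹
y = y g⁻¹`, which is `ρ(g) f(y)`. -/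
theorem isTwist_V (c : ℂ) (hc : ∀ w, ρ ⟨g, Subgroup.mem_centralizer_singleton_iff.2 rfl⟩ w = c • w) :
    IsTwist (V g ρ) (c • LinearMap.id) := by
  refine isTwist_smul_id _ _ fun f => ?_
  rw [map_sum, LinearMap.sum_apply]
  refine Subtype.ext (funext fun y => ?_)
  refine (map_sum (LinearMap.proj y ∘ₗ (inducedSpace g ρ).subtype) _ _).trans ?_
  refine (Finset.sum_congr rfl fun x _ => V_act_e_apply g ρ x x f y).trans ?_
  rw [Finset.sum_ite_eq, if_pos (Finset.mem_univ _)]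
  set g' : Subgroup.centralizer {g} := ⟨g, Subgroup.mem_centralizer_singleton_iff.2 rfl⟩
  have h2 : (y * g * y⁻¹)⁻¹ * y = y * (g'⁻¹ : Subgroup.centralizer {g}) := by
    simp [g', mul_assoc]
  rw [h2, (f : inducedSpace g ρ).2, inv_inv, hc]
  rfl

end simple

end DMod
end

/-! ### The character table, the order of the group and the projection onto the symmetric group. -/

noncomputable section

namespace BinOct

open DrinfeldDouble

section liftMonoid
variable {M : Type*} [Monoid M] (Z A B C : M) (hz : Z ^ 2 = 1) (hA : A ^ 2 = Z) (hB : B ^ 2 = Z)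
    (hC : C ^ 2 = Z) (hAB : (A * B) ^ 3 = Z) (hBC : (B * C) ^ 3 = Z) (hAC : (A * C) ^ 2 = Z)

theorem liftMonoid_z : liftMonoid Z A B C hz hA hB hC hAB hBC hAC z = Z := by simp [liftMonoid]
theorem liftMonoid_t1 : liftMonoid Z A B C hz hA hB hC hAB hBC hAC t1 = A := by simp [liftMonoid]
theorem liftMonoid_t2 : liftMonoid Z A B C hz hA hB hC hAB hBC hAC t2 = B := by simp [liftMonoid]
theorem liftMonoid_t3 : liftMonoid Z A B C hz hA hB hC hAB hBC hAC t3 = C := by simp [liftMonoid]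

/-- The values at the representatives of the conjugacy classes of a homomorphism to a monoid. -/
theorem liftMonoid_classRep (j : Fin 8) : liftMonoid Z A B C hz hA hB hC hAB hBC hAC (classRep j) =
    ![1, Z, A, A * C, A * B, Z * A * B, A * B * C, Z * A * B * C] j := by
  fin_cases j <;>
    simp [classRep, liftMonoid_z, liftMonoid_t1, liftMonoid_t2, liftMonoid_t3]

end liftMonoid

theorem matRep_character {n : ℕ} (φ : BinOct →* Matrix (Fin n) (Fin n) ℂ) (x : BinOct) :
    (matRep φ).character x = (φ x).trace := by
  change LinearMap.trace ℂ _ (Matrix.toLin' (φ x)) = _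
  rw [Matrix.trace_toLin'_eq]

theorem intRep_character {n : ℕ} (φ : BinOct →* Matrix (Fin n) (Fin n) ℤ) (x : BinOct) :
    (intRep φ).character x = ((φ x).trace : ℤ) := by
  rw [intRep, matRep_character]
  change ((φ x).map (Int.castRingHom ℂ)).trace = _
  simp [Matrix.trace]

theorem chi1_character (j : Fin 8) : chi1.character (classRep j) = 1 := by
  rw [chi1, intRep_character, liftMonoid_classRep]
  have : (![1, 1, 1, 1 * 1, 1 * 1, 1 * 1 * 1, 1 * 1 * 1, 1 * 1 * 1 * 1] j :
    Matrix (Fin 1) (Fin 1) ℤ).trace = 1 := by revert j; decide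
  rw [this, Int.cast_one]

theorem chiEps_character (j : Fin 8) :
    chiEps.character (classRep j) = ((![1, 1, -1, 1, 1, 1, -1, -1] j : ℤ) : ℂ) := by
  rw [chiEps, intRep_character, liftMonoid_classRep]
  congr 1
  revert j; decide

theorem chi2_character (j : Fin 8) :
    chi2.character (classRep j) = ((![2, 2, 0, 2, -1, -1, 0, 0] j : ℤ) : ℂ) := by
  rw [chi2, intRep_character, liftMonoid_classRep]
  congr 1
  revert j; decide

theorem chi3_character (j : Fin 8) :
    chi3.character (classRep j) = ((![3, 3, 1, -1, 0, 0, -1, -1] j : ℤ) : ℂ) := by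
  rw [chi3, intRep_character, liftMonoid_classRep]
  congr 1
  revert j; decide

theorem chi3p_character (j : Fin 8) :
    chi3p.character (classRep j) = ((![3, 3, -1, -1, 0, 0, 1, 1] j : ℤ) : ℂ) := by
  rw [chi3p, intRep_character, liftMonoid_classRep]
  congr 1
  revert j; decide

theorem psi2_character (j : Fin 8) : psi2.character (classRep j) =
    ![2, -2, 0, 0, 1, -1, ((√2 : ℝ) : ℂ), -((√2 : ℝ) : ℂ)] j := by
  rw [psi2, matRep_character, liftMonoid_classRep]
  have h1 := Complex.I_sq
  have h2 := sqrt_two_sq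
  fin_cases j <;> simp [spinA, spinB, spinC, Matrix.trace_fin_two, Matrix.mul_fin_two] <;> grind

theorem psi2p_character (j : Fin 8) : psi2p.character (classRep j) =
    ![2, -2, 0, 0, 1, -1, -((√2 : ℝ) : ℂ), ((√2 : ℝ) : ℂ)] j := by
  rw [psi2p, matRep_character, liftMonoid_classRep]
  have h1 := Complex.I_sq
  have h2 := sqrt_two_sq
  fin_cases j <;> simp [spinA, spinB, spinC, Matrix.trace_fin_two, Matrix.mul_fin_two] <;> grind

theorem psi4_character (j : Fin 8) : psi4.character (classRep j) =
    ((![4, -4, 0, 0, -1, 1, 0, 0] j : ℤ) : ℂ) := by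
  rw [psi4, Representation.char_tensor, Pi.mul_apply, chi2_character, psi2_character]
  fin_cases j <;> norm_num

/-- The irreducible characters, as a table of numbers. -/
def charTab : Fin 8 → Fin 8 → ℂ := fun i j =>
  ![((1 : ℤ) : ℂ), ((![1, 1, -1, 1, 1, 1, -1, -1] j : ℤ) : ℂ), ((![2, 2, 0, 2, -1, -1, 0, 0] j : ℤ) : ℂ),
    ((![3, 3, 1, -1, 0, 0, -1, -1] j : ℤ) : ℂ), ((![3, 3, -1, -1, 0, 0, 1, 1] j : ℤ) : ℂ),
    ![2, -2, 0, 0, 1, -1, ((√2 : ℝ) : ℂ), -((√2 : ℝ) : ℂ)] j,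
    ![2, -2, 0, 0, 1, -1, -((√2 : ℝ) : ℂ), ((√2 : ℝ) : ℂ)] j,
    ((![4, -4, 0, 0, -1, 1, 0, 0] j : ℤ) : ℂ)] i

theorem characterTable_eq : characterTable =
      !![1, 1, 1, 1, 1, 1, 1, 1;
        1, 1, -1, 1, 1, 1, -1, -1;
        2, 2, 0, 2, -1, -1, 0, 0;
        3, 3, 1, -1, 0, 0, -1, -1;
        3, 3, -1, -1, 0, 0, 1, 1;
        2, -2, 0, 0, 1, -1, ((√2 : ℝ) : ℂ), -((√2 : ℝ) : ℂ);
        2, -2, 0, 0, 1, -1, -((√2 : ℝ) : ℂ), ((√2 : ℝ) : ℂ);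
        4, -4, 0, 0, -1, 1, 0, 0] := by
  simp only [characterTable, chi1_character, chiEps_character, chi2_character, chi3_character,
    chi3p_character, psi2_character, psi2p_character, psi4_character]
  ext i j
  fin_cases i <;> fin_cases j <;> simp

theorem orderOf_z : orderOf z = 2 :=
  orderOf_aux 2 (6, 0, 0, 6) code_z (by norm_num) (by decide +kernel) (by decide +kernel)

/-- The 48 codes in `SL₂(𝔽₇)` are distinct, which excludes any collapse among the normal forms. -/
theorem normalForm_bijective : Function.Bijective normalForm := by
  refine ⟨fun p q hpq => ?_, normalForm_surjective⟩
  have h : ∀ p q, codeNF p = codeNF q → p = q := by decide +kernel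
  exact h p q (by rw [← code_normalForm, ← code_normalForm, hpq])

theorem card_eq : Fintype.card BinOct = 48 := by
  rw [← Fintype.card_of_bijective normalForm_bijective]
  rfl

theorem exists_projection : ∃ π : BinOct →* Equiv.Perm (Fin 4), Function.Surjective π ∧
    π.ker = Subgroup.zpowers z ∧ π t1 = Equiv.swap 0 1 ∧ π t2 = Equiv.swap 1 2 ∧
      π t3 = Equiv.swap 2 3 := by
  let π : BinOct →* Equiv.Perm (Fin 4) := lift 1 (Equiv.swap 0 1) (Equiv.swap 1 2) (Equiv.swap 2 3)
    (by decide) (by decide) (by decide) (by decide) (by decide) (by decide) (by decide)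
  have hz : π z = 1 := lift_z ..
  have h1 : π t1 = Equiv.swap 0 1 := lift_t1 ..
  have h2 : π t2 = Equiv.swap 1 2 := lift_t2 ..
  have h3 : π t3 = Equiv.swap 2 3 := lift_t3 ..
  -- The images of the normal forms, spelled out so that surjectivity and the kernel become finite
  -- checks.
  let F : Fin 4 × Fin 3 × Fin 4 → Equiv.Perm (Fin 4) := fun p =>
    Equiv.swap 0 1 ^ (p.1 : ℕ) * ![1, Equiv.swap 1 2, Equiv.swap 1 2 * Equiv.swap 0 1] p.2.1 *
      ![1, Equiv.swap 2 3, Equiv.swap 2 3 * Equiv.swap 1 2,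
        Equiv.swap 2 3 * Equiv.swap 1 2 * Equiv.swap 0 1] p.2.2
  have hF : ∀ p, π (normalForm p) = F p := by
    rintro ⟨a, b, c⟩
    simp only [normalForm, map_mul, map_pow, F, h1]
    congr 1
    · congr 1
      fin_cases b <;> simp [coset2, h1, h2]
    · fin_cases c <;> simp [coset3, h1, h2, h3]
  refine ⟨π, fun s => ?_, ?_, h1, h2, h3⟩
  · have : ∀ s, ∃ p, F p = s := by decide +kernel
    obtain ⟨p, hp⟩ := this s
    exact ⟨normalForm p, (hF p).trans hp⟩
  · refine le_antisymm (fun x hx => ?_) ?_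
    · obtain ⟨p, rfl⟩ := normalForm_surjective x
      rw [MonoidHom.mem_ker, hF] at hx
      -- The code `(6, 0, 0, 6)` is that of `-1`, the image of `z`; the kernel consists of its
      -- powers with exponents 0 and 1.
      have : ∀ p, F p = 1 → codeNF p = cpow (6, 0, 0, 6) 0 ∨ codeNF p = cpow (6, 0, 0, 6) 1 := by
        decide +kernel
      have mem : ∀ k : ℕ, codeNF p = cpow (6, 0, 0, 6) k → normalForm p ∈ Subgroup.zpowers z :=
        fun k hk => by
          rw [show normalForm p = z ^ k from
            code_injective (by rw [code_normalForm, code_pow, code_z, hk])]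
          exact Subgroup.npow_mem_zpowers z k
      exact (this p hx).elim (mem 0) (mem 1)
    · rw [Subgroup.zpowers_le, MonoidHom.mem_ker, hz]

end BinOct
end

/-! ### Labels, conjugacy classes and the character values of the labelled modules. -/

noncomputable section

namespace BinOct

open DrinfeldDouble DMod

/-- The orders of the cyclic centralizers of the representatives of the noncentral classes. -/
def cycOrder : Fin 6 → ℕ := ![4, 8, 6, 6, 8, 8]

/-- The labels of the simple modules; they also label the conjugacy classes of pairs of commuting
elements. -/
abbrev Label : Type := (Fin 2 × Fin 8) ⊕ (Σ r : Fin 6, Fin (cycOrder r))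

/-- Representatives of the noncentral conjugacy classes. -/
def cycRep : Fin 6 → BinOct := ![t1, t1 * t3, t1 * t2, z * t1 * t2, t1 * t2 * t3, z * t1 * t2 * t3]

/-- Generators of their centralizers. -/
def cycGen : Fin 6 → BinOct := ![t1, h, t1 * t2, t1 * t2, t1 * t2 * t3, t1 * t2 * t3]

theorem centralizer_cycRep (r : Fin 6) :
    Subgroup.centralizer {cycRep r} = Subgroup.zpowers (cycGen r) :=
  match r with
  | 0 => centralizer_t1
  | 1 => centralizer_t1t3
  | 2 => centralizer_t1t2
  | 3 => centralizer_zt1t2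
  | 4 => centralizer_t1t2t3
  | 5 => centralizer_zt1t2t3

theorem orderOf_cycGen (r : Fin 6) : orderOf (cycGen r) = cycOrder r :=
  match r with
  | 0 => orderOf_t1
  | 1 => orderOf_h
  | 2 => orderOf_t1t2
  | 3 => orderOf_t1t2
  | 4 => orderOf_t1t2t3
  | 5 => orderOf_t1t2t3

theorem cycOrder_pos (r : Fin 6) : 0 < cycOrder r := by revert r; decide

instance (r : Fin 6) : NeZero (cycOrder r) := ⟨(cycOrder_pos r).ne'⟩

/-- The powers of the generator, as elements of the centralizer. -/
def cycPow (r : Fin 6) (k : ℕ) : Subgroup.centralizer {cycRep r} :=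
  ⟨cycGen r ^ k, by rw [centralizer_cycRep]; exact Subgroup.npow_mem_zpowers _ k⟩

theorem cycPow_bijective (r : Fin 6) :
    Function.Bijective fun k : Fin (cycOrder r) => cycPow r k := by
  constructor
  · intro k l hkl
    have h1 : cycGen r ^ (k : ℕ) = cycGen r ^ (l : ℕ) := congrArg Subtype.val hkl
    exact Fin.ext (pow_injOn_Iio_orderOf (by simp [orderOf_cycGen]) (by simp [orderOf_cycGen]) h1)
  · rintro ⟨x, hx⟩
    rw [centralizer_cycRep, mem_zpowers_iff_mem_range_orderOf, Finset.mem_image] at hx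
    obtain ⟨k, hk, rfl⟩ := hx
    exact ⟨⟨k, by rwa [Finset.mem_range, orderOf_cycGen] at hk⟩, rfl⟩

theorem sum_centralizer_cycRep (r : Fin 6) (f : Subgroup.centralizer {cycRep r} → ℂ) :
    ∑ c, f c = ∑ k : Fin (cycOrder r), f (cycPow r k) :=
  ((cycPow_bijective r).sum_comp f).symm

theorem card_centralizer_cycRep (r : Fin 6) :
    Fintype.card (Subgroup.centralizer {cycRep r}) = cycOrder r := by
  rw [← Fintype.card_of_bijective (cycPow_bijective r), Fintype.card_fin]

/-- The representation is determined by the image of the generator of the cyclic centralizer, so all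
its values are powers of `ω`. -/
theorem cyclicRep_pow {g c : BinOct} (hc : Subgroup.centralizer {g} = Subgroup.zpowers c) (ω : ℂ)
    (hω : ω ^ orderOf c = 1) (k : ℕ) (hk : c ^ k ∈ Subgroup.centralizer {g}) :
    cyclicRep hc ω hω ⟨c ^ k, hk⟩ = ω ^ k • LinearMap.id := by
  have h0 : c ∈ Subgroup.centralizer {g} := by rw [hc]; exact Subgroup.mem_zpowers c
  have h1 : cyclicRep hc ω hω ⟨c, h0⟩ = ω • LinearMap.id := by
    ext
    simp [cyclicRep, monoidHomOfForallMemZpowers_apply_gen]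
  rw [show (⟨c ^ k, hk⟩ : Subgroup.centralizer {g}) = ⟨c, h0⟩ ^ k from rfl, map_pow, h1, smul_pow]
  congr 1
  exact one_pow k

theorem z_central (x : BinOct) : x * z = z * x := by
  have h : ∀ p, cmul (codeNF p) (6, 0, 0, 6) = cmul (6, 0, 0, 6) (codeNF p) := by decide +kernel
  obtain ⟨p, rfl⟩ := normalForm_surjective x
  exact code_injective (by rw [code_mul, code_mul, code_z, code_normalForm, h])

theorem z_pow_central (a : ℕ) (x : BinOct) : x * z ^ a = z ^ a * x :=
  (Commute.pow_right (z_central x) a)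

/-- The element `1` or `z`, together with the fact that all elements centralize it. -/
theorem mem_centralizer_z_pow (a : ℕ) (x : BinOct) : x ∈ Subgroup.centralizer {z ^ a} :=
  Subgroup.mem_centralizer_singleton_iff.2 (z_pow_central a x)

theorem sum_centralizer_z_pow (a : ℕ) (f : BinOct → ℂ) :
    ∑ c : Subgroup.centralizer {z ^ a}, f c = ∑ x, f x := by
  refine Function.Bijective.sum_comp (e := fun c : Subgroup.centralizer {z ^ a} => (c : BinOct))
    ⟨Subtype.val_injective, fun x => ⟨⟨x, mem_centralizer_z_pow a x⟩, rfl⟩⟩ f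

theorem card_centralizer_z_pow (a : ℕ) : Fintype.card (Subgroup.centralizer {z ^ a}) = 48 := by
  rw [← card_eq]
  exact Fintype.card_of_bijective (f := fun c : Subgroup.centralizer {z ^ a} => (c : BinOct))
    ⟨Subtype.val_injective, fun x => ⟨⟨x, mem_centralizer_z_pow a x⟩, rfl⟩⟩

/-- The class of an element given in normal form, its representative being in `classRep`. -/
def classIndex (p : Fin 4 × Fin 3 × Fin 4) : Fin 8 :=
  ![![![0, 2, 4, 7], ![2, 4, 2, 4], ![4, 7, 3, 7]], ![![2, 3, 7, 5], ![4, 6, 4, 2], ![2, 4, 7, 3]],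
    ![![1, 2, 5, 6], ![2, 5, 2, 5], ![5, 6, 3, 6]], ![![2, 3, 6, 4], ![5, 7, 5, 2], ![2, 5, 6, 3]]]
    p.1 p.2.1 p.2.2

/-- The codes of the representatives of the conjugacy classes. -/
def classCode : Fin 8 → ℕ × ℕ × ℕ × ℕ :=
  ![(1, 0, 0, 1), (6, 0, 0, 6), (0, 6, 1, 0), (4, 2, 2, 3), (5, 0, 0, 3), (2, 0, 0, 4),
    (3, 1, 2, 1), (4, 6, 5, 6)]

theorem code_classRep (i : Fin 8) : code (classRep i) = classCode i := by
  fin_cases i <;> simp [classRep, classCode, code_mul, code_one, code_z, code_t1, code_t2, code_t3, cmul]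

theorem conj_eq_of_code {x g g' : BinOct} (hh : cmul (code x) (code g) = cmul (code g') (code x)) :
    x * g * x⁻¹ = g' :=
  mul_inv_eq_of_eq_mul (code_injective (by rw [code_mul, code_mul, hh]))

/-- A conjugating element is found by a search through the codes; the condition is written without
inverses, as an equality of two products. -/
theorem classRep_conj (p : Fin 4 × Fin 3 × Fin 4) :
    ∃ x, x * classRep (classIndex p) * x⁻¹ = normalForm p := by
  have h1 : ∀ p, ∃ q, cmul (codeNF q) (classCode (classIndex p)) = cmul (codeNF p) (codeNF q) := by
    decide +kernel
  obtain ⟨q, hq⟩ := h1 p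
  exact ⟨normalForm q, conj_eq_of_code (by simpa only [code_classRep, code_normalForm] using hq)⟩

theorem classRep_not_conj {i j : Fin 8} (hij : i ≠ j) (x : BinOct) :
    x * classRep i * x⁻¹ ≠ classRep j := by
  have h1 : ∀ i j : Fin 8, i ≠ j → ∀ q,
      cmul (codeNF q) (classCode i) ≠ cmul (classCode j) (codeNF q) := by
    decide +kernel
  obtain ⟨q, rfl⟩ := normalForm_surjective x
  intro hh
  apply h1 i j hij q
  rw [← code_classRep, ← code_classRep, ← code_normalForm, ← code_mul, ← code_mul, ← hh]
  simp

/-- The sizes of the conjugacy classes. -/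
def classSize : Fin 8 → ℕ := ![1, 1, 12, 6, 8, 8, 6, 6]

theorem sum_class_function (f : BinOct → ℂ) (hf : ∀ x g, f (x * g * x⁻¹) = f g) :
    ∑ x, f x = ∑ i, (classSize i : ℂ) * f (classRep i) := by
  rw [← normalForm_bijective.sum_comp]
  have h1 : ∀ p, f (normalForm p) = f (classRep (classIndex p)) := fun p => by
    obtain ⟨x, hx⟩ := classRep_conj p
    rw [← hx, hf]
  simp only [h1]
  rw [← Finset.sum_fiberwise Finset.univ classIndex]
  refine Finset.sum_congr rfl fun i _ => ?_
  have h2 : (Finset.univ.filter fun p => classIndex p = i).card = classSize i := by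
    revert i; decide +kernel
  rw [Finset.sum_congr rfl fun p hp => by rw [(Finset.mem_filter.1 hp).2], Finset.sum_const, h2,
    nsmul_eq_mul]

/-- The modules attached to a central element. -/
def centralModule (g : BinOct) : Fin 8 → DMod BinOct :=
  ![VC g chi1, VC g chiEps, VC g chi2, VC g chi3, VC g chi3p, VC g psi2, VC g psi2p, VC g psi4]

section labelled

variable (Z : Fin 6 → ℂ) (hZ : ∀ r, IsPrimitiveRoot (Z r) (cycOrder r))

theorem root_pow_orderOf (hZ : ∀ r, IsPrimitiveRoot (Z r) (cycOrder r)) (r : Fin 6) (k : ℕ) : (Z r ^ k) ^ orderOf (cycGen r) = 1 := by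
  rw [orderOf_cycGen, root_pow (hZ r).pow_eq_one]

/-- The simple modules. -/
def simpleModule : Label → DMod BinOct
  | .inl (a, i) => centralModule (z ^ (a : ℕ)) i
  | .inr ⟨r, k⟩ => DMod.V (cycRep r)
      (cyclicRep (centralizer_cycRep r) (Z r ^ (k : ℕ)) (root_pow_orderOf Z hZ r k))

/-- The representatives of the conjugacy classes of pairs of commuting elements. -/
def pairFst : Label → BinOct
  | .inl (a, _) => z ^ (a : ℕ)
  | .inr ⟨r, _⟩ => cycRep r

def pairSnd : Label → BinOct
  | .inl (_, i) => classRep i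
  | .inr ⟨r, k⟩ => cycGen r ^ (k : ℕ)

/-- The values of the characters of the simple modules. -/
def simpleChar : Label → Label → ℂ
  | .inl (a, i), .inl (b, j) => if a = b then charTab i j else 0
  | .inr ⟨r, k⟩, .inr ⟨s, l⟩ => if r = s then Z r ^ ((k : ℕ) * (l : ℕ)) else 0
  | _, _ => 0

/-- The class of the first member of a pair. -/
def labelClass : Label → Fin 8
  | .inl (a, _) => ![0, 1] a
  | .inr ⟨r, _⟩ => r.natAdd 2

theorem pairFst_eq (p : Label) : pairFst p = classRep (labelClass p) := by
  rcases p with ⟨a, i⟩ | ⟨r, k⟩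
  · fin_cases a
    · exact pow_zero z
    · exact pow_one z
  · fin_cases r <;> rfl

theorem centralModule_char (g x : BinOct) (hx : x ∈ Subgroup.centralizer {g}) (i : Fin 8) :
    (centralModule g i).char g x = ![chi1.character x, chiEps.character x, chi2.character x,
      chi3.character x, chi3p.character x, psi2.character x, psi2p.character x,
      psi4.character x] i := by
  fin_cases i <;> exact DMod.char_V_self g _ ⟨x, hx⟩

theorem charTab_eq (i j : Fin 8) : ![chi1.character (classRep j), chiEps.character (classRep j),
    chi2.character (classRep j), chi3.character (classRep j), chi3p.character (classRep j),
    psi2.character (classRep j), psi2p.character (classRep j), psi4.character (classRep j)] i =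
      charTab i j := by
  simp only [chi1_character, chiEps_character, chi2_character, chi3_character,
    chi3p_character, psi2_character, psi2p_character, psi4_character, charTab, Int.cast_one]

/-- A simple module, its support and the representation inducing it. -/
theorem simpleModule_char_of_not_conj (l : Label) {x : BinOct} (k : BinOct)
    (hx : ∀ y, y * pairFst l * y⁻¹ ≠ x) : (simpleModule Z hZ l).char x k = 0 := by
  rcases l with ⟨a, i⟩ | ⟨r, k⟩
  · fin_cases i <;> exact DMod.char_V_of_not_conj _ _ _ hx
  · exact DMod.char_V_of_not_conj _ _ _ hx

theorem simpleModule_char_cyc (r : Fin 6) (j : Fin (cycOrder r)) (k : ℕ) :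
    (simpleModule Z hZ (.inr ⟨r, j⟩)).char (cycRep r) (cycGen r ^ k) = Z r ^ ((j : ℕ) * k) := by
  refine (DMod.char_V_self (cycRep r) _ (cycPow r k)).trans ?_
  rw [cycPow, cyclicRep_pow, map_smul, LinearMap.trace_id, Module.finrank_self, Nat.cast_one,
    smul_eq_mul, mul_one, pow_mul]

/-- The table is block diagonal: modules supported on another class vanish at the pair, and over a
common class the value is that of the inducing representation. -/
theorem simpleModule_char (l p : Label) :
    (simpleModule Z hZ l).char (pairFst p) (pairSnd p) = simpleChar Z l p := by
  have h1 : ∀ a b : Fin 2, (![0, 1] a : Fin 8) = ![0, 1] b → a = b := by decide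
  have h2 : ∀ (a : Fin 2) (s : Fin 6), (![0, 1] a : Fin 8) ≠ s.natAdd 2 := by decide
  have h3 : ∀ r s : Fin 6, (r.natAdd 2 : Fin 8) = s.natAdd 2 → r = s := by decide
  by_cases hlp : labelClass l = labelClass p
  · rcases l with ⟨a, i⟩ | ⟨r, k⟩ <;> rcases p with ⟨b, j⟩ | ⟨s, m⟩
    · have hab : a = b := h1 a b hlp
      subst hab
      simp only [simpleChar, if_true]
      exact (centralModule_char _ _ (mem_centralizer_z_pow _ _) i).trans (charTab_eq i j)
    · exact absurd hlp (h2 a s)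
    · exact absurd hlp (h2 b r).symm
    · have hrs : r = s := h3 r s hlp
      subst hrs
      simp only [simpleChar, if_true]
      exact simpleModule_char_cyc Z hZ r k m
  · rw [simpleModule_char_of_not_conj]
    · rcases l with ⟨a, i⟩ | ⟨r, k⟩ <;> rcases p with ⟨b, j⟩ | ⟨s, m⟩
      · have hab : a ≠ b := fun hh => hlp (by rw [hh]; rfl)
        simp [simpleChar, hab]
      · rfl
      · rfl
      · have hrs : r ≠ s := fun hh => hlp (by subst hh; rfl)
        simp [simpleChar, hrs]
    · rw [pairFst_eq, pairFst_eq]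
      exact classRep_not_conj hlp

end labelled

end BinOct
end

/-! ### Orthonormality and completeness of the 56 simple modules. -/

noncomputable section

namespace DMod

variable {G : Type} [Group G] [Fintype G] [DecidableEq G] {W : Type} [AddCommGroup W] [Module ℂ W]
  [FiniteDimensional ℂ W]

/-- The reciprocity formula applied to the indicator function of `k = 1`. -/
theorem finrank_V (g : G) (ρ : Representation ℂ (Subgroup.centralizer {g}) W) :
    (Module.finrank ℂ (V g ρ).carrier : ℂ) = (Fintype.card G : ℂ) *
      (Fintype.card (Subgroup.centralizer {g}) : ℂ)⁻¹ * Module.finrank ℂ W := by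
  have h1 := sum_char_V g ρ (fun _ k => if k = 1 then 1 else 0)
    (fun x a b => by simp)
  simp only [mul_ite, mul_one, mul_zero, Finset.sum_ite_eq', Finset.mem_univ, if_true] at h1
  rw [finrank_eq_sum_char, h1]
  congr 1
  rw [Finset.sum_eq_single 1]
  · simp
  · intro c _ hc
    exact if_neg fun hh => hc (Subtype.ext hh)
  · simp

end DMod

namespace BinOct

open DrinfeldDouble DMod

theorem pairing_VC {W : Type} [AddCommGroup W] [Module ℂ W] [FiniteDimensional ℂ W]
    (ρ : Representation ℂ BinOct W) (a : ℕ) (X : DMod BinOct) :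
    pairing (VC (z ^ a) ρ) X = 48⁻¹ * ∑ i, (classSize i : ℂ) *
      (ρ.character (classRep i) * X.char (z ^ a) (classRep i)⁻¹) := by
  rw [VC, DMod.pairing_V, card_centralizer_z_pow,
    ← sum_class_function (fun x => ρ.character x * X.char (z ^ a) x⁻¹)]
  · exact congrArg _ (sum_centralizer_z_pow a (fun x => ρ.character x * X.char (z ^ a) x⁻¹))
  · intro x g
    rw [Representation.char_conj]
    congr 1
    have h1 : x * z ^ a * x⁻¹ = z ^ a := by rw [z_pow_central, mul_inv_cancel_right]
    conv_lhs => rw [← h1]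
    rw [← X.char_conj x (z ^ a) g⁻¹]
    congr 1
    group

theorem sEntry_VC {W : Type} [AddCommGroup W] [Module ℂ W] [FiniteDimensional ℂ W]
    (ρ : Representation ℂ BinOct W) (a : ℕ) (X : DMod BinOct) :
    sEntry (VC (z ^ a) ρ) X = ∑ i, (classSize i : ℂ) *
      (ρ.character (classRep i) * X.char (classRep i) (z ^ a)) := by
  rw [VC, DMod.sEntry_V, card_centralizer_z_pow, card_eq,
    ← sum_class_function (fun x => ρ.character x * X.char x (z ^ a))]
  · rw [show ((48 : ℕ) : ℂ) * ((48 : ℕ) : ℂ)⁻¹ = 1 by norm_num, one_mul]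
    exact sum_centralizer_z_pow a (fun x => ρ.character x * X.char x (z ^ a))
  · intro x g
    rw [Representation.char_conj]
    congr 1
    have h1 : x * z ^ a * x⁻¹ = z ^ a := by rw [z_pow_central, mul_inv_cancel_right]
    conv_lhs => rw [← h1]
    exact X.char_conj x _ _

/-- Row orthogonality; the entries are real, so no conjugation is needed. -/
theorem charTab_orthogonal (a b : Fin 8) :
    ∑ i, (classSize i : ℂ) * (charTab a i * charTab b i) = if a = b then 48 else 0 := by
  have h2 := sqrt_two_sq
  fin_cases a <;> fin_cases b <;> simp [Fin.sum_univ_succ, charTab, classSize] <;> grind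

/-- The dimensions of the simple modules. -/
def simpleDim : Label → ℕ
  | .inl (_, i) => ![1, 1, 2, 3, 3, 2, 2, 4] i
  | .inr ⟨r, _⟩ => 48 / cycOrder r

theorem charTab_regular (j : Fin 8) :
    ∑ i, ((![1, 1, 2, 3, 3, 2, 2, 4] i : ℕ) : ℂ) * charTab i j = if j = 0 then 48 else 0 := by
  have h2 := sqrt_two_sq
  fin_cases j <;> simp [Fin.sum_univ_succ, charTab] <;> grind

theorem sum_root_pow {n : ℕ} [NeZero n] {ζ : ℂ} (hζ : IsPrimitiveRoot ζ n) (m : ℕ) :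
    ∑ k : Fin n, ζ ^ ((k : ℕ) * m) = if n ∣ m then (n : ℂ) else 0 := by
  have h1 : ∀ k : ℕ, ζ ^ (k * m) = (ζ ^ m) ^ k := fun k => by rw [mul_comm, pow_mul]
  simp only [h1]
  rw [Fin.sum_univ_eq_sum_range (fun k => (ζ ^ m) ^ k)]
  split_ifs with h
  · rw [(hζ.pow_eq_one_iff_dvd m).2 h]
    simp
  · have h2 : ζ ^ m ≠ 1 := fun hh => h ((hζ.pow_eq_one_iff_dvd m).1 hh)
    rw [geom_sum_eq h2, ← pow_mul, mul_comm, pow_mul, hζ.pow_eq_one, one_pow, sub_self, zero_div]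

/-- Every conjugacy class is closed under inversion, which allows the inverses in the scalar
products to be dropped at the central elements. The search uses `c q c = q`, a form of `q c q⁻¹ =
c⁻¹` without inverses. -/
theorem classRep_inv_conj (i : Fin 8) : ∃ x, x * classRep i * x⁻¹ = (classRep i)⁻¹ := by
  have h1 : ∀ i, ∃ q, cmul (cmul (classCode i) (codeNF q)) (classCode i) = codeNF q := by
    decide +kernel
  obtain ⟨q, hq⟩ := h1 i
  refine ⟨normalForm q, ?_⟩
  have h2 : classRep i * normalForm q * classRep i = normalForm q :=
    code_injective (by rw [code_mul, code_mul, code_classRep, code_normalForm, hq])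
  rw [mul_inv_eq_iff_eq_mul, eq_inv_mul_iff_mul_eq, ← mul_assoc, h2]

/-- Conjugate `g` to its class representative; `k` then lies in the centralizer. If that is the
whole group, `k` can be conjugated further to a representative, and otherwise it is a power of the
chosen generator. -/
theorem exists_pair {g k : BinOct} (hgk : g * k = k * g) :
    ∃ p x, x * pairFst p * x⁻¹ = g ∧ x * pairSnd p * x⁻¹ = k := by
  obtain ⟨q, rfl⟩ := normalForm_surjective g
  obtain ⟨x, hx⟩ := classRep_conj q
  set i := classIndex q
  rw [← hx] at hgk ⊢
  have hk : x⁻¹ * k * x ∈ Subgroup.centralizer {classRep i} := by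
    rw [Subgroup.mem_centralizer_singleton_iff]
    calc x⁻¹ * k * x * classRep i = x⁻¹ * (k * (x * classRep i * x⁻¹)) * x := by group
      _ = _ := by rw [← hgk]; group
  have central : ∀ a : Fin 2, classRep i = z ^ (a : ℕ) →
      ∃ p y, y * pairFst p * y⁻¹ = x * classRep i * x⁻¹ ∧ y * pairSnd p * y⁻¹ = k := by
    intro a ha
    obtain ⟨q', hq'⟩ := normalForm_surjective (x⁻¹ * k * x)
    obtain ⟨y, hy⟩ := classRep_conj q'
    refine ⟨.inl (a, classIndex q'), x * y, ?_, ?_⟩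
    · rw [ha]
      simp only [pairFst]
      rw [z_pow_central, z_pow_central, mul_inv_cancel_right, mul_inv_cancel_right]
    · simp only [pairSnd]
      calc x * y * classRep (classIndex q') * (x * y)⁻¹
          = x * (y * classRep (classIndex q') * y⁻¹) * x⁻¹ := by group
        _ = k := by rw [hy, hq']; group
  have noncentral : ∀ r : Fin 6, classRep i = cycRep r →
      ∃ p y, y * pairFst p * y⁻¹ = x * classRep i * x⁻¹ ∧ y * pairSnd p * y⁻¹ = k := by
    intro r hr
    rw [hr] at hk
    obtain ⟨m, hm⟩ := (cycPow_bijective r).2 ⟨_, hk⟩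
    refine ⟨.inr ⟨r, m⟩, x, by rw [hr]; rfl, ?_⟩
    have hm' : cycGen r ^ (m : ℕ) = x⁻¹ * k * x := congrArg Subtype.val hm
    simp only [pairSnd]
    rw [hm']
    group
  generalize i = i' at *
  fin_cases i'
  · exact central 0 (pow_zero z).symm
  · exact central 1 (pow_one z).symm
  · exact noncentral 0 rfl
  · exact noncentral 1 rfl
  · exact noncentral 2 rfl
  · exact noncentral 3 rfl
  · exact noncentral 4 rfl
  · exact noncentral 5 rfl

theorem char_ext {X Y : DMod BinOct}
    (h : ∀ p, X.char (pairFst p) (pairSnd p) = Y.char (pairFst p) (pairSnd p)) :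
    X.char = Y.char := by
  funext g k
  by_cases hgk : g * k = k * g
  · obtain ⟨p, x, rfl, rfl⟩ := exists_pair hgk
    rw [DMod.char_conj, DMod.char_conj, h]
  · rw [X.char_eq_zero hgk, Y.char_eq_zero hgk]

section labelled

variable (Z : Fin 6 → ℂ) (hZ : ∀ r, IsPrimitiveRoot (Z r) (cycOrder r))

theorem pairing_central (a : Fin 2) (i : Fin 8) (X : DMod BinOct) :
    pairing (simpleModule Z hZ (.inl (a, i))) X = 48⁻¹ * ∑ j, (classSize j : ℂ) *
      (charTab i j * X.char (z ^ (a : ℕ)) (classRep j)⁻¹) := by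
  simp only [← charTab_eq]
  fin_cases i <;> exact pairing_VC _ _ _

theorem pairing_cyc (r : Fin 6) (k : Fin (cycOrder r)) (X : DMod BinOct) :
    pairing (simpleModule Z hZ (.inr ⟨r, k⟩)) X = (cycOrder r : ℂ)⁻¹ * ∑ j : Fin (cycOrder r),
      Z r ^ ((k : ℕ) * (j : ℕ)) * X.char (cycRep r) (cycGen r ^ (j : ℕ))⁻¹ := by
  rw [simpleModule, DMod.pairing_V, card_centralizer_cycRep, sum_centralizer_cycRep]
  congr 1
  refine Finset.sum_congr rfl fun j _ => ?_
  rw [cycPow, cyclicRep_pow, map_smul, LinearMap.trace_id, Module.finrank_self, Nat.cast_one,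
    smul_eq_mul, mul_one, pow_mul]

theorem pairing_eq_zero_of_class {l m : Label} (hlm : labelClass l ≠ labelClass m) :
    pairing (simpleModule Z hZ l) (simpleModule Z hZ m) = 0 := by
  rw [pairing]
  refine mul_eq_zero_of_right _ (Finset.sum_eq_zero fun g _ => Finset.sum_eq_zero fun k _ => ?_)
  by_cases h1 : ∃ y, y * pairFst l * y⁻¹ = g
  · obtain ⟨y, rfl⟩ := h1
    rw [simpleModule_char_of_not_conj Z hZ m, mul_zero]
    intro x hx
    apply classRep_not_conj hlm (x⁻¹ * y)
    rw [← pairFst_eq, ← pairFst_eq]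
    calc x⁻¹ * y * pairFst l * (x⁻¹ * y)⁻¹ = x⁻¹ * (y * pairFst l * y⁻¹) * x := by group
      _ = _ := by rw [← hx]; group
  · push Not at h1
    rw [simpleModule_char_of_not_conj Z hZ l _ h1, zero_mul]

/-- Over distinct classes the supports are disjoint. Over a common class the product is that of two
characters of the centralizer: row orthogonality at `1` and `z`, geometric sums elsewhere. -/
theorem pairing_simple (l m : Label) :
    pairing (simpleModule Z hZ l) (simpleModule Z hZ m) = if l = m then 1 else 0 := by
  by_cases hlm : labelClass l = labelClass m
  · have h2 : ∀ (a : Fin 2) (s : Fin 6), (![0, 1] a : Fin 8) ≠ s.natAdd 2 := by decide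
    rcases l with ⟨a, i⟩ | ⟨r, k⟩ <;> rcases m with ⟨b, j⟩ | ⟨s, m⟩
    · have h1 : ∀ a b : Fin 2, (![0, 1] a : Fin 8) = ![0, 1] b → a = b := by decide
      obtain rfl : a = b := h1 a b hlm
      have h3 : ∀ c, (simpleModule Z hZ (.inl (a, j))).char (z ^ (a : ℕ)) (classRep c)⁻¹ =
          charTab j c := fun c => by
        obtain ⟨x, hx⟩ := classRep_inv_conj c
        have h4 : x * z ^ (a : ℕ) * x⁻¹ = z ^ (a : ℕ) := by
          rw [z_pow_central, mul_inv_cancel_right]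
        rw [← hx]
        conv_lhs => rw [← h4]
        rw [DMod.char_conj]
        refine (simpleModule_char Z hZ (.inl (a, j)) (.inl (a, c))).trans ?_
        simp [simpleChar]
      rw [pairing_central]
      simp only [h3]
      rw [charTab_orthogonal]
      by_cases hij : i = j <;> simp [hij]
    · exact absurd hlm (h2 a s)
    · exact absurd hlm (h2 b r).symm
    · have h1 : ∀ r s : Fin 6, (r.natAdd 2 : Fin 8) = s.natAdd 2 → r = s := by decide
      obtain rfl : r = s := h1 r s hlm
      -- The inverse is rewritten with the exponent `n - 1` in order to keep natural exponents; the
      -- divisibility condition below holds since `m (n - 1)` is congruent to `-m` modulo `n`.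
      have h3 : ∀ j : ℕ, (cycGen r ^ j)⁻¹ = cycGen r ^ ((cycOrder r - 1) * j) := fun j => by
        rw [inv_eq_iff_mul_eq_one, ← pow_add]
        have : j + (cycOrder r - 1) * j = cycOrder r * j := by
          rw [← one_add_mul, Nat.add_sub_of_le (show 1 ≤ cycOrder r from cycOrder_pos r)]
        rw [this, pow_mul, ← orderOf_cycGen, pow_orderOf_eq_one, one_pow]
      rw [pairing_cyc]
      simp only [h3, simpleModule_char_cyc, ← pow_add]
      have h4 : ∀ j : Fin (cycOrder r), (k : ℕ) * j + m * ((cycOrder r - 1) * j) =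
          j * (k + m * (cycOrder r - 1)) := fun j => by ring
      have h5 : ∀ (r : Fin 6) (k m : Fin (cycOrder r)),
          cycOrder r ∣ k + m * (cycOrder r - 1) ↔ k = m := by decide +kernel
      simp only [h4]
      rw [sum_root_pow (hZ r)]
      simp only [h5]
      by_cases hkm : k = m <;> simp [hkm, (cycOrder_pos r).ne']
  · rw [pairing_eq_zero_of_class Z hZ hlm, if_neg (fun hh => hlm (by rw [hh]))]

theorem simpleModule_isSimple (l : Label) : (simpleModule Z hZ l).IsSimple :=
  isSimple_of_pairing_eq_one (by rw [pairing_simple, if_pos rfl])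

/-- The norm of `X` can be computed from its character, so `X` is automatically simple and Schur's
lemma applies. -/
theorem iso_of_char_eq {X : DMod BinOct} {l : Label} (h : X.char = (simpleModule Z hZ l).char) :
    Iso X (simpleModule Z hZ l) := by
  have h1 : pairing X X = 1 := by rw [pairing_congr h h, pairing_simple, if_pos rfl]
  refine iso_of_pairing_ne_zero (isSimple_of_pairing_eq_one h1) (simpleModule_isSimple Z hZ l) ?_
  rw [pairing_congr h rfl, pairing_simple, if_pos rfl]
  exact one_ne_zero

theorem eq_of_iso {l m : Label} (h : Iso (simpleModule Z hZ l) (simpleModule Z hZ m)) : l = m := by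
  by_contra hlm
  have h1 := pairing_simple Z hZ l m
  rw [pairing_congr h.char_eq rfl, pairing_simple, if_pos rfl, if_neg hlm] at h1
  exact one_ne_zero h1

/-- The regular character: the identity-column relations of the character table at the central
elements, and vanishing sums of roots of unity at the other classes. -/
theorem sum_simpleChar (hZ : ∀ r, IsPrimitiveRoot (Z r) (cycOrder r)) (p : Label) :
    ∑ l, (simpleDim l : ℂ) * simpleChar Z l p = if pairSnd p = 1 then 48 else 0 := by
  rw [Fintype.sum_sum_type]
  rcases p with ⟨b, j⟩ | ⟨s, t⟩
  · have h1 : classRep j = 1 ↔ j = 0 := by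
      refine ⟨fun hh => ?_, by rintro rfl; rfl⟩
      by_contra hj
      exact classRep_not_conj hj 1 (by rw [hh]; simp [classRep])
    rw [Fintype.sum_prod_type, Finset.sum_comm]
    simp only [simpleChar, mul_zero, Finset.sum_const_zero, add_zero, mul_ite, simpleDim,
      Finset.sum_ite_eq', Finset.mem_univ, if_true, pairSnd, h1]
    exact charTab_regular j
  · have h1 : cycGen s ^ (t : ℕ) = 1 ↔ cycOrder s ∣ t := by
      have h3 := orderOf_dvd_iff_pow_eq_one (x := cycGen s) (n := (t : ℕ))
      rw [orderOf_cycGen] at h3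
      exact h3.symm
    rw [Fintype.sum_sigma, Finset.sum_eq_single s]
    · simp only [simpleChar, mul_zero, Finset.sum_const_zero, zero_add, if_true, simpleDim, pairSnd,
        h1]
      rw [← Finset.mul_sum, sum_root_pow (hZ s)]
      have h2 : ∀ s, 48 / cycOrder s * cycOrder s = 48 := by decide
      split_ifs
      · rw [← Nat.cast_mul, h2]; norm_num
      · simp
    · intro r _ hr
      exact Finset.sum_eq_zero fun k _ => by simp [simpleChar, hr]
    · simp

theorem sum_simpleModule_char (g k : BinOct) :
    ∑ l, (simpleDim l : ℂ) * (simpleModule Z hZ l).char g k = if k = 1 then 48 else 0 := by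
  by_cases hgk : g * k = k * g
  · obtain ⟨p, x, rfl, rfl⟩ := exists_pair hgk
    simp only [DMod.char_conj, simpleModule_char, conj_eq_one_iff]
    exact sum_simpleChar Z hZ p
  · rw [if_neg (fun hh => hgk (by rw [hh, mul_one, one_mul]))]
    exact Finset.sum_eq_zero fun l _ => by rw [DMod.char_eq_zero _ hgk, mul_zero]

/-- By the regular character, the scalar products of the labelled modules with `X`, weighted by
dimensions, add up to `dim X`. If `X` were isomorphic to none of them, they would all vanish and `X`
would be zero. -/
theorem exists_iso {X : DMod BinOct} (hX : X.IsSimple) : ∃ l, Iso X (simpleModule Z hZ l) := by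
  have h1 : ∑ l, (simpleDim l : ℂ) * pairing (simpleModule Z hZ l) X =
      Module.finrank ℂ X.carrier := by
    simp only [pairing, Finset.mul_sum]
    rw [Finset.sum_comm, finrank_eq_sum_char]
    refine Finset.sum_congr rfl fun g _ => ?_
    rw [Finset.sum_comm, Finset.sum_eq_single 1]
    · have h2 : ∀ l, (simpleDim l : ℂ) * ((Fintype.card BinOct : ℂ)⁻¹ *
          ((simpleModule Z hZ l).char g 1⁻¹ * X.char g 1)) =
          (Fintype.card BinOct : ℂ)⁻¹ * X.char g 1 *
            ((simpleDim l : ℂ) * (simpleModule Z hZ l).char g 1) := fun l => by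
        rw [inv_one]; ring
      simp only [h2]
      rw [← Finset.mul_sum, sum_simpleModule_char, if_pos rfl, card_eq]
      push_cast
      ring
    · intro k _ hk
      have h2 : ∀ l, (simpleDim l : ℂ) * ((Fintype.card BinOct : ℂ)⁻¹ *
          ((simpleModule Z hZ l).char g k⁻¹ * X.char g k)) =
          (Fintype.card BinOct : ℂ)⁻¹ * X.char g k *
            ((simpleDim l : ℂ) * (simpleModule Z hZ l).char g k⁻¹) := fun l => by
        ring
      simp only [h2]
      rw [← Finset.mul_sum, sum_simpleModule_char, if_neg (by simpa using hk), mul_zero]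
    · simp
  by_contra! hc
  have h2 : ∀ l, pairing (simpleModule Z hZ l) X = 0 := fun l => by
    by_contra hl
    exact hc l (iso_of_pairing_ne_zero (simpleModule_isSimple Z hZ l) hX hl).symm
  simp only [h2, mul_zero, Finset.sum_const_zero] at h1
  have := hX.1
  exact Module.finrank_pos.ne (Nat.cast_injective ((Nat.cast_zero).trans h1))

theorem finrank_simpleModule (l : Label) :
    Module.finrank ℂ (simpleModule Z hZ l).carrier = simpleDim l := by
  rw [← Nat.cast_inj (R := ℂ)]
  rcases l with ⟨a, i⟩ | ⟨r, k⟩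
  · have h1 : ((48 : ℕ) : ℂ) * ((48 : ℕ) : ℂ)⁻¹ = 1 := by norm_num
    fin_cases i <;> refine (DMod.finrank_V _ _).trans ?_ <;>
      rw [card_eq, card_centralizer_z_pow, h1] <;> simp [simpleDim]
  · refine (DMod.finrank_V _ _).trans ?_
    rw [card_eq, card_centralizer_cycRep, Module.finrank_self]
    fin_cases r <;> norm_num [simpleDim, cycOrder]

end labelled

end BinOct
end

/-! ### Tensoring with `ε`, degrees, and the exchange of the members of a commuting pair. -/

noncomputable section

namespace DMod

variable {G : Type} [Group G] [Fintype G] [DecidableEq G] {W : Type} [AddCommGroup W] [Module ℂ W]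
  [FiniteDimensional ℂ W]

open DrinfeldDouble

/-- A central element acts on the induced module through the inducing representation. -/
theorem V_act_ofGroup (g : G) (ρ : Representation ℂ (Subgroup.centralizer {g}) W)
    (x : Subgroup.centralizer {g}) (hx : ∀ y : G, y * x = x * y) (c : ℂ)
    (hc : ρ x = c • LinearMap.id) : (V g ρ).act (ofGroup (x : G)) = c • LinearMap.id := by
  refine LinearMap.ext fun f => Subtype.ext (funext fun y => ?_)
  rw [ofGroup, map_sum, LinearMap.sum_apply]
  refine (map_sum (LinearMap.proj y ∘ₗ (inducedSpace g ρ).subtype) _ _).trans ?_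
  refine (Finset.sum_congr rfl fun x' _ => V_act_e_apply g ρ x' x f y).trans ?_
  rw [Finset.sum_ite_eq, if_pos (Finset.mem_univ _)]
  have h2 : (x : G)⁻¹ * y = y * (x⁻¹ : Subgroup.centralizer {g}) := by
    rw [Subgroup.coe_inv, inv_mul_eq_iff_eq_mul, ← mul_assoc, ← hx, mul_inv_cancel_right]
  rw [h2, (f : inducedSpace g ρ).2, inv_inv, hc]
  rfl

end DMod

namespace BinOct

open DrinfeldDouble DMod

theorem liftMonoid_one {M : Type*} [Monoid M] (h1 h2 h3 h4 h5 h6 h7) (x : BinOct) :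
    liftMonoid (1 : M) 1 1 1 h1 h2 h3 h4 h5 h6 h7 x = 1 := by
  obtain ⟨⟨a, b, c⟩, rfl⟩ := normalForm_surjective x
  simp only [normalForm, map_mul, map_pow, liftMonoid_t1, one_pow, one_mul]
  fin_cases b <;> fin_cases c <;>
    simp [coset2, coset3, liftMonoid_t1, liftMonoid_t2, liftMonoid_t3]

theorem chi1_apply (x : BinOct) : chi1 x = LinearMap.id := by
  change Matrix.toLin' (Matrix.map (liftMonoid _ _ _ _ _ _ _ _ _ _ _ x) _) = _
  rw [liftMonoid_one]
  simp

theorem matRep_z {n : ℕ} (φ : BinOct →* Matrix (Fin n) (Fin n) ℂ) (c : ℂ)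
    (h : φ z = c • 1) : matRep φ z = c • LinearMap.id := by
  change Matrix.toLin' (φ z) = _
  rw [h, map_smul, Matrix.toLin'_one]

theorem intRep_z {n : ℕ} (φ : BinOct →* Matrix (Fin n) (Fin n) ℤ)
    (h : φ z = 1) : intRep φ z = (1 : ℂ) • LinearMap.id := by
  refine matRep_z _ 1 ?_
  change (φ z).map (Int.castRingHom ℂ) = (1 : ℂ) • (1 : Matrix (Fin n) (Fin n) ℂ)
  rw [h]
  simp

theorem psi2_z : psi2 z = (-1 : ℂ) • LinearMap.id := by
  refine matRep_z _ _ ?_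
  rw [liftMonoid_z, neg_one_smul]

theorem psi2p_z : psi2p z = (-1 : ℂ) • LinearMap.id := by
  refine matRep_z _ _ ?_
  rw [liftMonoid_z, neg_one_smul]

theorem psi4_z : psi4 z = (-1 : ℂ) • LinearMap.id := by
  have h : chi2 z = (1 : ℂ) • LinearMap.id := intRep_z _ (liftMonoid_z ..)
  change TensorProduct.map (chi2 z) (psi2 z) = _
  rw [h, psi2_z, one_smul, TensorProduct.map_smul_right, TensorProduct.map_id]

/-- The inducing representation is trivial and everything centralizes `z`, so the induced space
consists of the constant functions. -/
theorem epsObj_act_e (g k : BinOct) :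
    epsObj.act (e g k) = if g = z then LinearMap.id else 0 := by
  refine LinearMap.ext fun f => Subtype.ext (funext fun y => ?_)
  refine (V_act_e_apply z _ g k f y).trans ?_
  have h1 : y * z * y⁻¹ = z := by rw [z_central, mul_inv_cancel_right]
  have h2 : ∀ x : BinOct, (f : inducedSpace z _).1 x = (f : inducedSpace z _).1 1 := fun x => by
    have h3 := (f : inducedSpace z _).2 1 ⟨x, by simpa using mem_centralizer_z_pow 1 x⟩
    rw [one_mul] at h3
    refine h3.trans ?_
    change chi1 _ _ = _
    rw [chi1_apply, LinearMap.id_apply]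
  rw [h1, h2]
  by_cases hg : g = z
  · rw [if_pos hg.symm, if_pos hg]
    exact (h2 y).symm
  · rw [if_neg (Ne.symm hg), if_neg hg]
    rfl

theorem finrank_epsObj : Module.finrank ℂ epsObj.carrier = 1 := by
  rw [← Nat.cast_inj (R := ℂ)]
  refine (DMod.finrank_V _ _).trans ?_
  have h1 := card_centralizer_z_pow 1
  rw [pow_one] at h1
  rw [card_eq, h1]
  simp

theorem epsObj_char (g k : BinOct) : epsObj.char g k = if g = z then 1 else 0 := by
  rw [DMod.char, epsObj_act_e]
  split_ifs
  · rw [LinearMap.trace_id, finrank_epsObj, Nat.cast_one]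
  · exact map_zero _

/-- The character of `ε` is the indicator of `z` in its first variable, and convolution with it
translates by `z⁻¹ = z`. -/
theorem eps_tensor_char (X : DMod BinOct) (g k : BinOct) :
    (tensor epsObj X).char g k = X.char (z * g) k := by
  rw [DMod.char_tensor]
  simp only [epsObj_char, ite_mul, one_mul, zero_mul, Finset.sum_ite_eq', Finset.mem_univ, if_true]
  rw [inv_eq_of_mul_eq_one_left (show z * z = 1 by rw [← pow_two, z_sq])]

theorem doubleBraiding_eps (X : DMod BinOct) :
    doubleBraiding epsObj X = TensorProduct.map LinearMap.id (X.act (ofGroup z)) := by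
  rw [doubleBraiding_eq, Finset.sum_eq_single z]
  · simp only [epsObj_act_e, if_true]
    have h1 : ∑ k : BinOct, X.act (ofGroup z * delta k) = X.act (ofGroup z) := by
      rw [← map_sum, ← Finset.mul_sum, sum_delta, mul_one]
    rw [← h1]
    ext v w
    simp [TensorProduct.tmul_sum]
  · intro g _ hg
    refine Finset.sum_eq_zero fun k _ => ?_
    rw [epsObj_act_e, if_neg hg]
    exact TensorProduct.map_zero_left _
  · simp

theorem hasDegree_of_act {X : DMod BinOct} {d : ZMod 2}
    (h : X.act (ofGroup z) = ((-1 : ℂ) ^ d.val) • LinearMap.id) : HasDegree d X := by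
  rw [HasDegree, doubleBraiding_eps, h, TensorProduct.map_smul_right, TensorProduct.map_id]

theorem sEntry_of_hasDegree {X : DMod BinOct} {d : ZMod 2} (h : HasDegree d X) :
    sEntry epsObj X = (-1 : ℂ) ^ d.val * Module.finrank ℂ X.carrier := by
  rw [sEntry, h]
  refine (traceR_eq (tensor epsObj X) _).trans ?_
  refine (map_smul (LinearMap.trace ℂ (epsObj.carrier ⊗[ℂ] X.carrier)) _ _).trans ?_
  rw [LinearMap.trace_id, Module.finrank_tensorProduct, finrank_epsObj, one_mul, smul_eq_mul]

/-- The `S`-entry with `ε` is the sign of the degree times the dimension. It depends only on the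
character, and the dimension of a simple module is nonzero. -/
theorem hasDegree_of_iso {X Y : DMod BinOct} {d : ZMod 2} (h : HasDegree d X) (hXY : Iso X Y)
    {d' : ZMod 2} (hX : X.IsSimple) (hY : HasDegree d' Y) : d = d' := by
  have := hX.1
  obtain ⟨φ, _⟩ := id hXY
  have h1 : (Module.finrank ℂ X.carrier : ℂ) ≠ 0 := Nat.cast_ne_zero.2 Module.finrank_pos.ne'
  have h2 := sEntry_of_hasDegree h
  rw [sEntry_congr rfl hXY.char_eq, sEntry_of_hasDegree hY, ← φ.finrank_eq] at h2
  have h3 := mul_right_cancel₀ h1 h2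
  have h4 : ∀ d : ZMod 2, d = 0 ∨ d = 1 := by decide
  rcases h4 d with rfl | rfl <;> rcases h4 d' with rfl | rfl <;>
    first | rfl | (exfalso; norm_num [ZMod.val_one] at h3)

/-- The permutation of the labels given by tensoring with `ε`; it also describes the multiplication
by `z` of the first members of the pairs of commuting elements. -/
def epsLabel : Label → Label
  | .inl (a, i) => .inl (1 - a, i)
  | .inr ⟨0, k⟩ => .inr ⟨0, (-k : Fin 4)⟩
  | .inr ⟨1, k⟩ => .inr ⟨1, (-k : Fin 8)⟩
  | .inr ⟨2, k⟩ => .inr ⟨3, k⟩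
  | .inr ⟨3, k⟩ => .inr ⟨2, k⟩
  | .inr ⟨4, k⟩ => .inr ⟨5, k⟩
  | .inr ⟨5, k⟩ => .inr ⟨4, k⟩

/-- The degree of a simple module. -/
def labelDegree : Label → ZMod 2
  | .inl (_, i) => ![0, 0, 0, 0, 0, 1, 1, 1] i
  | .inr ⟨_, k⟩ => (k : ℕ)

/-- The codes of the members of the pairs. -/
def codeFst : Label → ℕ × ℕ × ℕ × ℕ := fun p => classCode (labelClass p)

def codeSnd : Label → ℕ × ℕ × ℕ × ℕ
  | .inl (_, i) => classCode i
  | .inr ⟨r, k⟩ => cpow (![(0, 6, 1, 0), (6, 4, 4, 4), (5, 0, 0, 3), (5, 0, 0, 3), (3, 1, 2, 1),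
      (3, 1, 2, 1)] r) k

theorem code_pairFst (p : Label) : code (pairFst p) = codeFst p := by
  rw [pairFst_eq, code_classRep, codeFst]

theorem code_pairSnd (p : Label) : code (pairSnd p) = codeSnd p := by
  rcases p with ⟨a, i⟩ | ⟨r, k⟩
  · exact code_classRep i
  · rw [pairSnd, code_pow, codeSnd]
    congr 1
    fin_cases r <;> simp [cycGen, h, code_mul, code_z, code_t1, code_t2, code_t3, cmul]

/-- Both members of the pair are conjugated by one and the same element. The signs in `epsLabel`
come from `z t₁ = t₁⁻¹` and `z t₁t₃ = (t₁t₃)⁻¹`: conjugating back to the representative inverts the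
generator of the centralizer. -/
theorem epsLabel_conj (p : Label) : ∃ x, x * pairFst (epsLabel p) * x⁻¹ = z * pairFst p ∧
    x * pairSnd (epsLabel p) * x⁻¹ = pairSnd p := by
  have h1 : ∀ p, ∃ q, cmul (codeNF q) (codeFst (epsLabel p)) =
      cmul (cmul (6, 0, 0, 6) (codeFst p)) (codeNF q) ∧
      cmul (codeNF q) (codeSnd (epsLabel p)) = cmul (codeSnd p) (codeNF q) := by
    decide +kernel
  obtain ⟨q, hq1, hq2⟩ := h1 p
  exact ⟨normalForm q,
    conj_eq_of_code (by rwa [code_normalForm, code_pairFst, code_mul, code_z, code_pairFst]),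
    conj_eq_of_code (by rwa [code_normalForm, code_pairSnd, code_pairSnd])⟩

/-- The class of a pair with its two members exchanged. -/
def swapLabel : Label → Label
  | .inl (0, i) => ![.inl (0, 0), .inl (1, 0), .inr ⟨0, (0 : Fin 4)⟩, .inr ⟨1, (0 : Fin 8)⟩,
      .inr ⟨2, (0 : Fin 6)⟩, .inr ⟨3, (0 : Fin 6)⟩, .inr ⟨4, (0 : Fin 8)⟩, .inr ⟨5, (0 : Fin 8)⟩] i
  | .inl (1, i) => ![.inl (0, 1), .inl (1, 1), .inr ⟨0, (2 : Fin 4)⟩, .inr ⟨1, (4 : Fin 8)⟩,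
      .inr ⟨2, (3 : Fin 6)⟩, .inr ⟨3, (3 : Fin 6)⟩, .inr ⟨4, (4 : Fin 8)⟩, .inr ⟨5, (4 : Fin 8)⟩] i
  | .inr ⟨0, k⟩ => (![.inl (0, 2), .inr ⟨0, (1 : Fin 4)⟩, .inl (1, 2), .inr ⟨0, (3 : Fin 4)⟩] :
      Fin 4 → Label) k
  | .inr ⟨1, k⟩ => (![.inl (0, 3), .inr ⟨5, (6 : Fin 8)⟩, .inr ⟨1, (2 : Fin 8)⟩,
      .inr ⟨4, (2 : Fin 8)⟩, .inl (1, 3), .inr ⟨4, (6 : Fin 8)⟩, .inr ⟨1, (6 : Fin 8)⟩,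
      .inr ⟨5, (2 : Fin 8)⟩] : Fin 8 → Label) k
  | .inr ⟨2, k⟩ => (![.inl (0, 4), .inr ⟨2, (1 : Fin 6)⟩, .inr ⟨3, (5 : Fin 6)⟩, .inl (1, 4),
      .inr ⟨3, (1 : Fin 6)⟩, .inr ⟨2, (5 : Fin 6)⟩] : Fin 6 → Label) k
  | .inr ⟨3, k⟩ => (![.inl (0, 5), .inr ⟨2, (4 : Fin 6)⟩, .inr ⟨3, (2 : Fin 6)⟩, .inl (1, 5),
      .inr ⟨3, (4 : Fin 6)⟩, .inr ⟨2, (2 : Fin 6)⟩] : Fin 6 → Label) k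
  | .inr ⟨4, k⟩ => (![.inl (0, 6), .inr ⟨4, (1 : Fin 8)⟩, .inr ⟨1, (3 : Fin 8)⟩,
      .inr ⟨5, (7 : Fin 8)⟩, .inl (1, 6), .inr ⟨5, (1 : Fin 8)⟩, .inr ⟨1, (5 : Fin 8)⟩,
      .inr ⟨4, (7 : Fin 8)⟩] : Fin 8 → Label) k
  | .inr ⟨5, k⟩ => (![.inl (0, 7), .inr ⟨4, (5 : Fin 8)⟩, .inr ⟨1, (7 : Fin 8)⟩,
      .inr ⟨5, (3 : Fin 8)⟩, .inl (1, 7), .inr ⟨5, (5 : Fin 8)⟩, .inr ⟨1, (1 : Fin 8)⟩,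
      .inr ⟨4, (3 : Fin 8)⟩] : Fin 8 → Label) k

/-- Certifies the exchange table: for each label a single element conjugates the tabulated pair to
the exchanged one. -/
theorem swapLabel_conj (p : Label) : ∃ x, x * pairFst (swapLabel p) * x⁻¹ = pairSnd p ∧
    x * pairSnd (swapLabel p) * x⁻¹ = pairFst p := by
  have h1 : ∀ p, ∃ q, cmul (codeNF q) (codeFst (swapLabel p)) = cmul (codeSnd p) (codeNF q) ∧
      cmul (codeNF q) (codeSnd (swapLabel p)) = cmul (codeFst p) (codeNF q) := by
    decide +kernel
  obtain ⟨q, hq1, hq2⟩ := h1 p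
  exact ⟨normalForm q,
    conj_eq_of_code (by rwa [code_normalForm, code_pairFst, code_pairSnd]),
    conj_eq_of_code (by rwa [code_normalForm, code_pairSnd, code_pairFst])⟩

section labelled

variable (Z : Fin 6 → ℂ) (hZ : ∀ r, IsPrimitiveRoot (Z r) (cycOrder r))

theorem simpleModule_char_swap (l p : Label) :
    (simpleModule Z hZ l).char (pairSnd p) (pairFst p) = simpleChar Z l (swapLabel p) := by
  obtain ⟨x, h1, h2⟩ := swapLabel_conj p
  rw [← h1, ← h2, DMod.char_conj, simpleModule_char]

theorem root_neg {n : ℕ} [NeZero n] {ζ : ℂ} (hζ : ζ ^ n = 1) (j k : Fin n) :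
    ζ ^ ((j : ℕ) * ((-k : Fin n) : ℕ)) = ζ ^ (((-j : Fin n) : ℕ) * (k : ℕ)) := by
  have h1 : ∀ k : Fin n, ∀ x : ℂ, x ^ n = 1 → x ^ ((-k : Fin n) : ℕ) = (x ^ (k : ℕ))⁻¹ := by
    intro k x hx
    refine eq_inv_of_mul_eq_one_left ?_
    have h2 := congrArg Fin.val (neg_add_cancel k)
    rw [Fin.val_add, Fin.val_zero] at h2
    obtain ⟨c, hc⟩ := Nat.dvd_of_mod_eq_zero h2
    rw [← pow_add, hc, pow_mul, hx, one_pow]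
  rw [pow_mul, h1 k _ (by rw [← pow_mul, mul_comm, pow_mul, hζ, one_pow]), pow_mul,
    h1 j _ hζ, inv_pow]

/-- The permutation of the pairs is transposed into the same permutation of the modules. Classes
interchanged by `z` must carry the same root of unity, whence `h23` and `h45`; at `t₁` and `t₁t₃`
the sign moves from one exponent to the other. -/
theorem simpleChar_epsLabel (hZ : ∀ r, IsPrimitiveRoot (Z r) (cycOrder r))
    (h23 : Z 2 = Z 3) (h45 : Z 4 = Z 5) (l p : Label) :
    simpleChar Z l (epsLabel p) = simpleChar Z (epsLabel l) p := by
  have h0 : ∀ a b : Fin 2, a = 1 - b ↔ 1 - a = b := by decide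
  rcases l with ⟨a, i⟩ | ⟨r, k⟩ <;> rcases p with ⟨b, j⟩ | ⟨s, m⟩
  · simp [simpleChar, epsLabel, h0]
  · fin_cases s <;> rfl
  · fin_cases r <;> rfl
  · fin_cases r <;> fin_cases s <;> simp [simpleChar, epsLabel, h23, h45]
    · exact root_neg (hZ 0).pow_eq_one k m
    · exact root_neg (hZ 1).pow_eq_one k m

theorem eps_tensor_iso (h23 : Z 2 = Z 3) (h45 : Z 4 = Z 5) (l : Label) :
    Iso (tensor epsObj (simpleModule Z hZ l)) (simpleModule Z hZ (epsLabel l)) := by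
  refine iso_of_char_eq Z hZ (char_ext fun p => ?_)
  obtain ⟨x, h1, h2⟩ := epsLabel_conj p
  rw [eps_tensor_char, simpleModule_char, ← simpleChar_epsLabel Z hZ h23 h45, ← h1]
  conv_lhs => rw [← h2]
  rw [DMod.char_conj, simpleModule_char]

theorem centralModule_act_z (a : ℕ) (i : Fin 8) : (centralModule (z ^ a) i).act (ofGroup z) =
    ((-1 : ℂ) ^ (![0, 0, 0, 0, 0, 1, 1, 1] i : ZMod 2).val) • LinearMap.id := by
  have key : ∀ {W : Type} [AddCommGroup W] [Module ℂ W] [FiniteDimensional ℂ W]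
      (ρ : Representation ℂ BinOct W) (c : ℂ) (d : ℕ), ρ z = c • LinearMap.id → c = (-1) ^ d →
      (VC (z ^ a) ρ).act (ofGroup z) = ((-1 : ℂ) ^ d) • LinearMap.id := by
    rintro W _ _ _ ρ c d h rfl
    exact V_act_ofGroup (z ^ a) _ ⟨z, mem_centralizer_z_pow a z⟩ z_central _ h
  have h0 : (1 : ℂ) = (-1) ^ (0 : ZMod 2).val := by simp
  have h1 : (-1 : ℂ) = (-1) ^ (1 : ZMod 2).val := by simp [ZMod.val_one]
  fin_cases i
  · exact key _ 1 _ (intRep_z _ (liftMonoid_z ..)) h0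
  · exact key _ 1 _ (intRep_z _ (liftMonoid_z ..)) h0
  · exact key _ 1 _ (intRep_z _ (liftMonoid_z ..)) h0
  · exact key _ 1 _ (intRep_z _ (liftMonoid_z ..)) h0
  · exact key _ 1 _ (intRep_z _ (liftMonoid_z ..)) h0
  · exact key _ (-1) _ psi2_z h1
  · exact key _ (-1) _ psi2p_z h1
  · exact key _ (-1) _ psi4_z h1

theorem cycGen_pow_half (r : Fin 6) : cycGen r ^ (cycOrder r / 2) = z := by
  have h1 : ∀ r : Fin 6, codeSnd (.inr ⟨r, ⟨cycOrder r / 2, Nat.div_lt_self (cycOrder_pos r) one_lt_two⟩⟩) =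
      (6, 0, 0, 6) := by decide +kernel
  exact code_injective ((code_pairSnd _).trans ((h1 r).trans code_z.symm))

theorem root_half {n : ℕ} {ζ : ℂ} (hζ : IsPrimitiveRoot ζ n) (hn : 0 < n) (h2 : 2 ∣ n) :
    ζ ^ (n / 2) = -1 := by
  obtain ⟨m, rfl⟩ := h2
  rw [Nat.mul_div_cancel_left _ two_pos]
  exact (hζ.pow hn (mul_comm 2 m)).eq_neg_one_of_two_right

/-- The double braiding with `ε` is the action of `z`. Over a noncentral class, `z` is the generator
raised to half its order, so it acts by `(-1)^k`. -/
theorem simpleModule_hasDegree (l : Label) :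
    HasDegree (labelDegree l) (simpleModule Z hZ l) := by
  apply hasDegree_of_act
  rcases l with ⟨a, i⟩ | ⟨r, k⟩
  · exact centralModule_act_z a i
  · have h1 : (cycPow r (cycOrder r / 2) : BinOct) = z := cycGen_pow_half r
    have h2 : ∀ r, 2 ∣ cycOrder r := by decide
    have h3 := V_act_ofGroup (cycRep r)
      (cyclicRep (centralizer_cycRep r) (Z r ^ (k : ℕ)) (root_pow_orderOf Z hZ r k))
      (cycPow r (cycOrder r / 2)) (fun y => by rw [h1, z_central]) _ (cyclicRep_pow _ _ _ _ _)
    rw [h1] at h3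
    refine h3.trans ?_
    congr 1
    rw [← pow_mul, mul_comm, pow_mul, root_half (hZ r) (cycOrder_pos r) (h2 r), labelDegree,
      ZMod.val_natCast, neg_one_pow_eq_pow_mod_two]

theorem labelDegree_eq {X : DMod BinOct} (hX : X.IsSimple) {d : ZMod 2} (h : HasDegree d X)
    {l : Label} (hl : Iso X (simpleModule Z hZ l)) : d = labelDegree l :=
  hasDegree_of_iso h hl hX (simpleModule_hasDegree Z hZ l)

end labelled

end BinOct
end

/-! ### Entries of the crossed `S`-matrix. -/

noncomputable section

namespace BinOct

open DrinfeldDouble DMod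

/-- The sum giving the entries of the `S`-matrix on the labels. -/
def labelS (Z : Fin 6 → ℂ) : Label → Label → ℂ
  | .inl (a, i), m => ∑ j, (classSize j : ℂ) *
      (charTab i j * simpleChar Z m (swapLabel (.inl (a, j))))
  | .inr ⟨r, k⟩, m => 48 * (cycOrder r : ℂ)⁻¹ *
      ∑ j : Fin (cycOrder r), Z r ^ ((k : ℕ) * (j : ℕ)) * simpleChar Z m (swapLabel (.inr ⟨r, j⟩))

/-- The reciprocity formula requires the other character at pairs whose first member centralizes the
representative and whose second member is the representative itself; these are the exchanged pairs,
read from `swapLabel`. -/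
theorem sEntry_simple (Z : Fin 6 → ℂ) (hZ : ∀ r, IsPrimitiveRoot (Z r) (cycOrder r)) (l m : Label) :
    sEntry (simpleModule Z hZ l) (simpleModule Z hZ m) = labelS Z l m := by
  rcases l with ⟨a, i⟩ | ⟨r, k⟩
  · have key : ∀ j, simpleChar Z m (swapLabel (.inl (a, j))) =
        (simpleModule Z hZ m).char (classRep j) (z ^ (a : ℕ)) := fun j =>
      (simpleModule_char_swap Z hZ m (.inl (a, j))).symm
    simp only [labelS, key, ← charTab_eq]
    fin_cases i <;> exact sEntry_VC _ _ _
  · have key : ∀ j, simpleChar Z m (swapLabel (.inr ⟨r, j⟩)) =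
        (simpleModule Z hZ m).char (cycGen r ^ (j : ℕ)) (cycRep r) := fun j =>
      (simpleModule_char_swap Z hZ m (.inr ⟨r, j⟩)).symm
    rw [simpleModule, DMod.sEntry_V, card_centralizer_cycRep, sum_centralizer_cycRep, card_eq]
    simp only [labelS, key]
    push_cast
    congr 1
    refine Finset.sum_congr rfl fun j _ => ?_
    rw [cycPow, cyclicRep_pow, map_smul, LinearMap.trace_id, Module.finrank_self, Nat.cast_one,
      smul_eq_mul, mul_one, pow_mul]

/-- The labels of the chosen simple modules of degree `0`. -/
def rowLabel : Fin 13 → Label :=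
  ![.inl (1, 4), .inr ⟨2, (0 : Fin 6)⟩, .inl (1, 2), .inl (0, 0), .inr ⟨5, (0 : Fin 8)⟩,
    .inr ⟨4, (6 : Fin 8)⟩, .inr ⟨4, (2 : Fin 8)⟩, .inr ⟨1, (2 : Fin 8)⟩, .inl (1, 3), .inl (1, 1),
    .inr ⟨2, (4 : Fin 6)⟩, .inr ⟨2, (2 : Fin 6)⟩, .inr ⟨5, (4 : Fin 8)⟩]

/-- The labels of the chosen simple modules of degree `1`. -/
def colLabel : Fin 13 → Label :=
  ![.inr ⟨1, (1 : Fin 8)⟩, .inr ⟨1, (3 : Fin 8)⟩, .inr ⟨0, (1 : Fin 4)⟩, .inl (0, 7), .inl (0, 5),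
    .inl (0, 6), .inr ⟨4, (5 : Fin 8)⟩, .inr ⟨4, (3 : Fin 8)⟩, .inr ⟨4, (7 : Fin 8)⟩,
    .inr ⟨4, (1 : Fin 8)⟩, .inr ⟨3, (1 : Fin 6)⟩, .inr ⟨3, (5 : Fin 6)⟩, .inr ⟨3, (3 : Fin 6)⟩]

/-- The chosen roots of unity. -/
def rootFamily (ζ6 ζ8 : ℂ) : Fin 6 → ℂ := ![ζ8 ^ 2, ζ8, ζ6, ζ6, ζ8, ζ8]

/-- The numerators of the entries of the Fourier matrix. -/
def geckMalleNum (s : ℂ) : Matrix (Fin 13) (Fin 13) ℂ := !![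
    3, 3, 6, -6, -3, -3, -3, -3, -3, -3, 0, 0, 0;
    0, 0, 0, -4, 4, 4, 0, 0, 0, 0, 4, 4, -8;
    -6, -6, 0, -4, -2, -2, 0, 0, 0, 0, 4, 4, 4;
    3, 3, 6, 2, 1, 1, 3, 3, 3, 3, 4, 4, 4;
    s, -s, 0, 0, -s, s, s, s, -s, -s, 0, 0, 0;
    s, -s, 0, 0, s, -s, -s, s, -s, s, 0, 0, 0;
    s, -s, 0, 0, s, -s, s, -s, s, -s, 0, 0, 0;
    0, 0, 0, 0, 0, 0, 6, -6, -6, 6, 0, 0, 0;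
    3, 3, -6, -6, -3, -3, 3, 3, 3, 3, 0, 0, 0;
    -3, -3, 6, -2, -1, -1, 3, 3, 3, 3, -4, -4, -4;
    0, 0, 0, -4, 4, 4, 0, 0, 0, 0, 4, -8, 4;
    0, 0, 0, -4, 4, 4, 0, 0, 0, 0, -8, 4, 4;
    s, -s, 0, 0, -s, s, -s, -s, s, s, 0, 0, 0]

section entries

variable {ζ6 ζ8 : ℂ}

/-- The sum with the exchange table substituted, for the class of `t₁t₃`; the factor is the size `48
/ 8` of the class. The next three lemmas do the same for the other noncentral classes met by the
rows. -/
theorem labelS_t1t3 (k : Fin 8) (m : Label) (Z : Fin 6 → ℂ) (χ : Label → ℂ)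
    (hχ : χ = simpleChar Z m) (w : ℂ) (hw : Z 1 = w) : labelS Z (.inr ⟨1, k⟩) m =
    6 * (χ (.inl (0, 3)) + w ^ (k : ℕ) * χ (.inr ⟨5, (6 : Fin 8)⟩) +
      w ^ ((k : ℕ) * 2) * χ (.inr ⟨1, (2 : Fin 8)⟩) + w ^ ((k : ℕ) * 3) * χ (.inr ⟨4, (2 : Fin 8)⟩) +
      w ^ ((k : ℕ) * 4) * χ (.inl (1, 3)) + w ^ ((k : ℕ) * 5) * χ (.inr ⟨4, (6 : Fin 8)⟩) +
      w ^ ((k : ℕ) * 6) * χ (.inr ⟨1, (6 : Fin 8)⟩) +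
      w ^ ((k : ℕ) * 7) * χ (.inr ⟨5, (2 : Fin 8)⟩)) := by
  subst hχ hw
  change 48 * (8 : ℂ)⁻¹ * ∑ j : Fin 8, _ = _
  rw [Fin.sum_univ_eight]
  change 48 * (8 : ℂ)⁻¹ * (Z 1 ^ ((k : ℕ) * 0) * _ + Z 1 ^ ((k : ℕ) * 1) * _ + _ + _ + _ + _ + _ + _) = _
  rw [mul_zero, pow_zero, one_mul, mul_one, show (48 : ℂ) * 8⁻¹ = 6 by norm_num]
  rfl

theorem labelS_t1t2 (k : Fin 6) (m : Label) (Z : Fin 6 → ℂ) (χ : Label → ℂ)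
    (hχ : χ = simpleChar Z m) (w : ℂ) (hw : Z 2 = w) : labelS Z (.inr ⟨2, k⟩) m =
    8 * (χ (.inl (0, 4)) + w ^ (k : ℕ) * χ (.inr ⟨2, (1 : Fin 6)⟩) +
      w ^ ((k : ℕ) * 2) * χ (.inr ⟨3, (5 : Fin 6)⟩) + w ^ ((k : ℕ) * 3) * χ (.inl (1, 4)) +
      w ^ ((k : ℕ) * 4) * χ (.inr ⟨3, (1 : Fin 6)⟩) +
      w ^ ((k : ℕ) * 5) * χ (.inr ⟨2, (5 : Fin 6)⟩)) := by
  subst hχ hw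
  change 48 * (6 : ℂ)⁻¹ * ∑ j : Fin 6, _ = _
  rw [Fin.sum_univ_six]
  change 48 * (6 : ℂ)⁻¹ * (Z 2 ^ ((k : ℕ) * 0) * _ + Z 2 ^ ((k : ℕ) * 1) * _ + _ + _ + _ + _) = _
  rw [mul_zero, pow_zero, one_mul, mul_one, show (48 : ℂ) * 6⁻¹ = 8 by norm_num]
  rfl

theorem labelS_t1t2t3 (k : Fin 8) (m : Label) (Z : Fin 6 → ℂ) (χ : Label → ℂ)
    (hχ : χ = simpleChar Z m) (w : ℂ) (hw : Z 4 = w) : labelS Z (.inr ⟨4, k⟩) m =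
    6 * (χ (.inl (0, 6)) + w ^ (k : ℕ) * χ (.inr ⟨4, (1 : Fin 8)⟩) +
      w ^ ((k : ℕ) * 2) * χ (.inr ⟨1, (3 : Fin 8)⟩) + w ^ ((k : ℕ) * 3) * χ (.inr ⟨5, (7 : Fin 8)⟩) +
      w ^ ((k : ℕ) * 4) * χ (.inl (1, 6)) + w ^ ((k : ℕ) * 5) * χ (.inr ⟨5, (1 : Fin 8)⟩) +
      w ^ ((k : ℕ) * 6) * χ (.inr ⟨1, (5 : Fin 8)⟩) +
      w ^ ((k : ℕ) * 7) * χ (.inr ⟨4, (7 : Fin 8)⟩)) := by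
  subst hχ hw
  change 48 * (8 : ℂ)⁻¹ * ∑ j : Fin 8, _ = _
  rw [Fin.sum_univ_eight]
  change 48 * (8 : ℂ)⁻¹ * (Z 4 ^ ((k : ℕ) * 0) * _ + Z 4 ^ ((k : ℕ) * 1) * _ + _ + _ + _ + _ + _ + _) = _
  rw [mul_zero, pow_zero, one_mul, mul_one, show (48 : ℂ) * 8⁻¹ = 6 by norm_num]
  rfl

theorem labelS_zt1t2t3 (k : Fin 8) (m : Label) (Z : Fin 6 → ℂ) (χ : Label → ℂ)
    (hχ : χ = simpleChar Z m) (w : ℂ) (hw : Z 5 = w) : labelS Z (.inr ⟨5, k⟩) m =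
    6 * (χ (.inl (0, 7)) + w ^ (k : ℕ) * χ (.inr ⟨4, (5 : Fin 8)⟩) +
      w ^ ((k : ℕ) * 2) * χ (.inr ⟨1, (7 : Fin 8)⟩) + w ^ ((k : ℕ) * 3) * χ (.inr ⟨5, (3 : Fin 8)⟩) +
      w ^ ((k : ℕ) * 4) * χ (.inl (1, 7)) + w ^ ((k : ℕ) * 5) * χ (.inr ⟨5, (5 : Fin 8)⟩) +
      w ^ ((k : ℕ) * 6) * χ (.inr ⟨1, (1 : Fin 8)⟩) +
      w ^ ((k : ℕ) * 7) * χ (.inr ⟨4, (3 : Fin 8)⟩)) := by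
  subst hχ hw
  change 48 * (8 : ℂ)⁻¹ * ∑ j : Fin 8, _ = _
  rw [Fin.sum_univ_eight]
  change 48 * (8 : ℂ)⁻¹ * (Z 5 ^ ((k : ℕ) * 0) * _ + Z 5 ^ ((k : ℕ) * 1) * _ + _ + _ + _ + _ + _ + _) = _
  rw [mul_zero, pow_zero, one_mul, mul_one, show (48 : ℂ) * 8⁻¹ = 6 by norm_num]
  rfl

/-- As a rewriting rule it lowers every power of `ζ6` to an exponent below three; `pow_add_four`
does the same for `ζ8` below four. -/
theorem pow_add_three (h6 : ζ6 ^ 2 = ζ6 - 1) (n : ℕ) : ζ6 ^ (n + 3) = -ζ6 ^ n := by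
  have h : ζ6 ^ 3 = -1 := by grind
  rw [pow_add, h, mul_neg_one]

theorem pow_add_four (h8 : ζ8 ^ 4 = -1) (n : ℕ) : ζ8 ^ (n + 4) = -ζ8 ^ n := by
  rw [pow_add, h8, mul_neg_one]

/-- In this row and in the twelve others, each entry becomes a polynomial identity modulo the
relations of `ζ6` and `ζ8`, with `√2` replaced by `ζ8 - ζ8³`. The factor 2 is `24 / 12`. -/
theorem labelS_row0 (h6 : ζ6 ^ 2 = ζ6 - 1) (h8 : ζ8 ^ 4 = -1)
    (hs : ((√2 : ℝ) : ℂ) = ζ8 - ζ8 ^ 3) (j : Fin 13) :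
    labelS (rootFamily ζ6 ζ8) (rowLabel 0) (colLabel j) =
      2 * geckMalleNum (3 * ((√2 : ℝ) : ℂ)) 0 j := by
  rw [show rowLabel 0 = .inl (1, 4) from rfl, labelS, Fin.sum_univ_eight]
  fin_cases j <;> simp [simpleChar, rootFamily, colLabel, geckMalleNum, charTab, swapLabel,
    classSize, hs, pow_add_three h6, pow_add_four h8] <;> grind

theorem labelS_row1 (h6 : ζ6 ^ 2 = ζ6 - 1) (h8 : ζ8 ^ 4 = -1)
    (hs : ((√2 : ℝ) : ℂ) = ζ8 - ζ8 ^ 3) (j : Fin 13) :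
    labelS (rootFamily ζ6 ζ8) (rowLabel 1) (colLabel j) =
      2 * geckMalleNum (3 * ((√2 : ℝ) : ℂ)) 1 j := by
  refine (labelS_t1t2 0 (colLabel j) (rootFamily ζ6 ζ8) _ rfl ζ6 rfl).trans ?_
  fin_cases j <;> simp [simpleChar, rootFamily, colLabel, geckMalleNum, charTab, swapLabel,
    classSize, hs, pow_add_three h6, pow_add_four h8] <;> grind

theorem labelS_row2 (h6 : ζ6 ^ 2 = ζ6 - 1) (h8 : ζ8 ^ 4 = -1)
    (hs : ((√2 : ℝ) : ℂ) = ζ8 - ζ8 ^ 3) (j : Fin 13) :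
    labelS (rootFamily ζ6 ζ8) (rowLabel 2) (colLabel j) =
      2 * geckMalleNum (3 * ((√2 : ℝ) : ℂ)) 2 j := by
  rw [show rowLabel 2 = .inl (1, 2) from rfl, labelS, Fin.sum_univ_eight]
  fin_cases j <;> simp [simpleChar, rootFamily, colLabel, geckMalleNum, charTab, swapLabel,
    classSize, hs, pow_add_three h6, pow_add_four h8] <;> grind

theorem labelS_row3 (h6 : ζ6 ^ 2 = ζ6 - 1) (h8 : ζ8 ^ 4 = -1)
    (hs : ((√2 : ℝ) : ℂ) = ζ8 - ζ8 ^ 3) (j : Fin 13) :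
    labelS (rootFamily ζ6 ζ8) (rowLabel 3) (colLabel j) =
      2 * geckMalleNum (3 * ((√2 : ℝ) : ℂ)) 3 j := by
  rw [show rowLabel 3 = .inl (0, 0) from rfl, labelS, Fin.sum_univ_eight]
  fin_cases j <;> simp [simpleChar, rootFamily, colLabel, geckMalleNum, charTab, swapLabel,
    classSize, hs, pow_add_three h6, pow_add_four h8] <;> grind

theorem labelS_row4 (h6 : ζ6 ^ 2 = ζ6 - 1) (h8 : ζ8 ^ 4 = -1)
    (hs : ((√2 : ℝ) : ℂ) = ζ8 - ζ8 ^ 3) (j : Fin 13) :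
    labelS (rootFamily ζ6 ζ8) (rowLabel 4) (colLabel j) =
      2 * geckMalleNum (3 * ((√2 : ℝ) : ℂ)) 4 j := by
  refine (labelS_zt1t2t3 0 (colLabel j) (rootFamily ζ6 ζ8) _ rfl ζ8 rfl).trans ?_
  fin_cases j <;> simp [simpleChar, rootFamily, colLabel, geckMalleNum, charTab, swapLabel,
    classSize, hs, pow_add_three h6, pow_add_four h8] <;> grind

theorem labelS_row5 (h6 : ζ6 ^ 2 = ζ6 - 1) (h8 : ζ8 ^ 4 = -1)
    (hs : ((√2 : ℝ) : ℂ) = ζ8 - ζ8 ^ 3) (j : Fin 13) :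
    labelS (rootFamily ζ6 ζ8) (rowLabel 5) (colLabel j) =
      2 * geckMalleNum (3 * ((√2 : ℝ) : ℂ)) 5 j := by
  refine (labelS_t1t2t3 6 (colLabel j) (rootFamily ζ6 ζ8) _ rfl ζ8 rfl).trans ?_
  fin_cases j <;> simp [simpleChar, rootFamily, colLabel, geckMalleNum, charTab, swapLabel,
    classSize, hs, pow_add_three h6, pow_add_four h8] <;> grind

theorem labelS_row6 (h6 : ζ6 ^ 2 = ζ6 - 1) (h8 : ζ8 ^ 4 = -1)
    (hs : ((√2 : ℝ) : ℂ) = ζ8 - ζ8 ^ 3) (j : Fin 13) :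
    labelS (rootFamily ζ6 ζ8) (rowLabel 6) (colLabel j) =
      2 * geckMalleNum (3 * ((√2 : ℝ) : ℂ)) 6 j := by
  refine (labelS_t1t2t3 2 (colLabel j) (rootFamily ζ6 ζ8) _ rfl ζ8 rfl).trans ?_
  fin_cases j <;> simp [simpleChar, rootFamily, colLabel, geckMalleNum, charTab, swapLabel,
    classSize, hs, pow_add_three h6, pow_add_four h8] <;> grind

theorem labelS_row7 (h6 : ζ6 ^ 2 = ζ6 - 1) (h8 : ζ8 ^ 4 = -1)
    (hs : ((√2 : ℝ) : ℂ) = ζ8 - ζ8 ^ 3) (j : Fin 13) :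
    labelS (rootFamily ζ6 ζ8) (rowLabel 7) (colLabel j) =
      2 * geckMalleNum (3 * ((√2 : ℝ) : ℂ)) 7 j := by
  refine (labelS_t1t3 2 (colLabel j) (rootFamily ζ6 ζ8) _ rfl ζ8 rfl).trans ?_
  fin_cases j <;> simp [simpleChar, rootFamily, colLabel, geckMalleNum, charTab, swapLabel,
    classSize, hs, pow_add_three h6, pow_add_four h8] <;> grind

theorem labelS_row8 (h6 : ζ6 ^ 2 = ζ6 - 1) (h8 : ζ8 ^ 4 = -1)
    (hs : ((√2 : ℝ) : ℂ) = ζ8 - ζ8 ^ 3) (j : Fin 13) :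
    labelS (rootFamily ζ6 ζ8) (rowLabel 8) (colLabel j) =
      2 * geckMalleNum (3 * ((√2 : ℝ) : ℂ)) 8 j := by
  rw [show rowLabel 8 = .inl (1, 3) from rfl, labelS, Fin.sum_univ_eight]
  fin_cases j <;> simp [simpleChar, rootFamily, colLabel, geckMalleNum, charTab, swapLabel,
    classSize, hs, pow_add_three h6, pow_add_four h8] <;> grind

theorem labelS_row9 (h6 : ζ6 ^ 2 = ζ6 - 1) (h8 : ζ8 ^ 4 = -1)
    (hs : ((√2 : ℝ) : ℂ) = ζ8 - ζ8 ^ 3) (j : Fin 13) :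
    labelS (rootFamily ζ6 ζ8) (rowLabel 9) (colLabel j) =
      2 * geckMalleNum (3 * ((√2 : ℝ) : ℂ)) 9 j := by
  rw [show rowLabel 9 = .inl (1, 1) from rfl, labelS, Fin.sum_univ_eight]
  fin_cases j <;> simp [simpleChar, rootFamily, colLabel, geckMalleNum, charTab, swapLabel,
    classSize, hs, pow_add_three h6, pow_add_four h8] <;> grind

theorem labelS_row10 (h6 : ζ6 ^ 2 = ζ6 - 1) (h8 : ζ8 ^ 4 = -1)
    (hs : ((√2 : ℝ) : ℂ) = ζ8 - ζ8 ^ 3) (j : Fin 13) :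
    labelS (rootFamily ζ6 ζ8) (rowLabel 10) (colLabel j) =
      2 * geckMalleNum (3 * ((√2 : ℝ) : ℂ)) 10 j := by
  refine (labelS_t1t2 4 (colLabel j) (rootFamily ζ6 ζ8) _ rfl ζ6 rfl).trans ?_
  fin_cases j <;> simp [simpleChar, rootFamily, colLabel, geckMalleNum, charTab, swapLabel,
    classSize, hs, pow_add_three h6, pow_add_four h8] <;> grind

theorem labelS_row11 (h6 : ζ6 ^ 2 = ζ6 - 1) (h8 : ζ8 ^ 4 = -1)
    (hs : ((√2 : ℝ) : ℂ) = ζ8 - ζ8 ^ 3) (j : Fin 13) :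
    labelS (rootFamily ζ6 ζ8) (rowLabel 11) (colLabel j) =
      2 * geckMalleNum (3 * ((√2 : ℝ) : ℂ)) 11 j := by
  refine (labelS_t1t2 2 (colLabel j) (rootFamily ζ6 ζ8) _ rfl ζ6 rfl).trans ?_
  fin_cases j <;> simp [simpleChar, rootFamily, colLabel, geckMalleNum, charTab, swapLabel,
    classSize, hs, pow_add_three h6, pow_add_four h8] <;> grind

theorem labelS_row12 (h6 : ζ6 ^ 2 = ζ6 - 1) (h8 : ζ8 ^ 4 = -1)
    (hs : ((√2 : ℝ) : ℂ) = ζ8 - ζ8 ^ 3) (j : Fin 13) :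
    labelS (rootFamily ζ6 ζ8) (rowLabel 12) (colLabel j) =
      2 * geckMalleNum (3 * ((√2 : ℝ) : ℂ)) 12 j := by
  refine (labelS_zt1t2t3 4 (colLabel j) (rootFamily ζ6 ζ8) _ rfl ζ8 rfl).trans ?_
  fin_cases j <;> simp [simpleChar, rootFamily, colLabel, geckMalleNum, charTab, swapLabel,
    classSize, hs, pow_add_three h6, pow_add_four h8] <;> grind

theorem labelS_eq (h6 : ζ6 ^ 2 = ζ6 - 1) (h8 : ζ8 ^ 4 = -1) (hs : ((√2 : ℝ) : ℂ) = ζ8 - ζ8 ^ 3)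
    (i j : Fin 13) : labelS (rootFamily ζ6 ζ8) (rowLabel i) (colLabel j) =
      2 * geckMalleNum (3 * ((√2 : ℝ) : ℂ)) i j :=
  match i with
  | 0 => labelS_row0 h6 h8 hs j
  | 1 => labelS_row1 h6 h8 hs j
  | 2 => labelS_row2 h6 h8 hs j
  | 3 => labelS_row3 h6 h8 hs j
  | 4 => labelS_row4 h6 h8 hs j
  | 5 => labelS_row5 h6 h8 hs j
  | 6 => labelS_row6 h6 h8 hs j
  | 7 => labelS_row7 h6 h8 hs j
  | 8 => labelS_row8 h6 h8 hs j
  | 9 => labelS_row9 h6 h8 hs j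
  | 10 => labelS_row10 h6 h8 hs j
  | 11 => labelS_row11 h6 h8 hs j
  | 12 => labelS_row12 h6 h8 hs j

end entries

end BinOct
end

/-! ### Twists, orbit representatives and the dimension of the degree zero component. -/

noncomputable section

namespace BinOct

open DrinfeldDouble DMod

section labelled

variable (Z : Fin 6 → ℂ) (hZ : ∀ r, IsPrimitiveRoot (Z r) (cycOrder r))

/-- The exponent expressing the representative of a class through the generator of its
centralizer. -/
def cycExp : Fin 6 → ℕ := ![1, 6, 1, 4, 1, 5]

theorem cycExp_lt : ∀ r, cycExp r < cycOrder r := by decide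

theorem codeSnd_cycExp : ∀ r : Fin 6,
    codeSnd (.inr ⟨r, ⟨cycExp r, cycExp_lt r⟩⟩) = classCode (r.natAdd 2) := by
  decide +kernel

theorem cycGen_pow_cycExp (r : Fin 6) : cycGen r ^ cycExp r = cycRep r :=
  code_injective ((code_pairSnd (.inr ⟨r, ⟨cycExp r, cycExp_lt r⟩⟩)).trans ((codeSnd_cycExp r).trans
    (code_pairFst (.inr ⟨r, ⟨cycExp r, cycExp_lt r⟩⟩)).symm))

/-- The scalar by which the twist acts on a simple module. -/
def labelTwist : Label → ℂ
  | .inl (a, i) => ((-1 : ℂ) ^ (![0, 0, 0, 0, 0, 1, 1, 1] i : ZMod 2).val) ^ (a : ℕ)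
  | .inr ⟨r, k⟩ => (Z r ^ (k : ℕ)) ^ cycExp r

/-- The twist is `ρ(g)`: a sign or one for central `g`, and otherwise the power `cycExp` of the
value at the generator of the centralizer. -/
theorem simpleModule_isTwist (l : Label) :
    IsTwist (simpleModule Z hZ l) (labelTwist Z l • LinearMap.id) := by
  rcases l with ⟨a, i⟩ | ⟨r, k⟩
  · have key : ∀ {W : Type} [AddCommGroup W] [Module ℂ W] [FiniteDimensional ℂ W]
        (ρ : Representation ℂ BinOct W) (c : ℂ) (d : ℕ), ρ z = c • LinearMap.id → c = (-1) ^ d →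
        IsTwist (VC (z ^ (a : ℕ)) ρ) ((((-1 : ℂ) ^ d) ^ (a : ℕ)) • LinearMap.id) := by
      rintro W _ _ _ ρ c d h rfl
      refine DMod.isTwist_V _ _ _ fun w => ?_
      change ρ (z ^ (a : ℕ)) w = _
      have : ∀ a : Fin 2, a = 0 ∨ a = 1 := by decide
      rcases this a with rfl | rfl
      · simp
      · simp [h]
    have h0 : (1 : ℂ) = (-1) ^ (0 : ZMod 2).val := by simp
    have h1 : (-1 : ℂ) = (-1) ^ (1 : ZMod 2).val := by simp [ZMod.val_one]
    fin_cases i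
    · exact key _ 1 _ (intRep_z _ (liftMonoid_z ..)) h0
    · exact key _ 1 _ (intRep_z _ (liftMonoid_z ..)) h0
    · exact key _ 1 _ (intRep_z _ (liftMonoid_z ..)) h0
    · exact key _ 1 _ (intRep_z _ (liftMonoid_z ..)) h0
    · exact key _ 1 _ (intRep_z _ (liftMonoid_z ..)) h0
    · exact key _ (-1) _ psi2_z h1
    · exact key _ (-1) _ psi2p_z h1
    · exact key _ (-1) _ psi4_z h1
  · refine DMod.isTwist_V _ _ _ fun w => ?_
    have h1 : (⟨cycRep r, Subgroup.mem_centralizer_singleton_iff.2 rfl⟩ :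
        Subgroup.centralizer {cycRep r}) = cycPow r (cycExp r) :=
      Subtype.ext (cycGen_pow_cycExp r).symm
    rw [h1, cycPow, cyclicRep_pow]
    rfl

theorem isTwist_of_eq {X Y : DMod BinOct} (h : X = Y) {c : ℂ} (hY : IsTwist Y (c • LinearMap.id)) :
    IsTwist X (c • LinearMap.id) := by
  subst h
  exact hY

/-- Translates orbits of modules into orbits of labels, so that the transversality statements can be
decided on the 56 labels. -/
theorem iso_simple_iff {X : DMod BinOct} {l : Label} (hl : Iso X (simpleModule Z hZ l))
    (h23 : Z 2 = Z 3) (h45 : Z 4 = Z 5) (m : Label) :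
    (Iso X (simpleModule Z hZ m) ∨ Iso X (tensor epsObj (simpleModule Z hZ m))) ↔
      (l = m ∨ l = epsLabel m) := by
  have h1 := eps_tensor_iso Z hZ h23 h45 m
  constructor
  · rintro (h | h)
    · exact Or.inl (eq_of_iso Z hZ (hl.symm.trans h))
    · exact Or.inr (eq_of_iso Z hZ (hl.symm.trans (h.trans h1)))
  · rintro (rfl | rfl)
    · exact Or.inl hl
    · exact Or.inr (hl.trans h1.symm)

theorem rowLabel_spec (i : Fin 13) :
    labelDegree (rowLabel i) = 0 ∧ epsLabel (rowLabel i) ≠ rowLabel i := by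
  revert i
  decide +kernel

theorem exists_rowLabel : ∀ l, labelDegree l = 0 ∧ epsLabel l ≠ l → ∃ i, (l = rowLabel i ∨ l = epsLabel (rowLabel i)) ∧
      ∀ j, (l = rowLabel j ∨ l = epsLabel (rowLabel j)) → j = i := by
  decide +kernel

theorem colLabel_spec : (∀ i, labelDegree (colLabel i) = 1) ∧
    ∀ l, labelDegree l = 1 → ∃ i, (l = colLabel i ∨ l = epsLabel (colLabel i)) ∧
      ∀ j, (l = colLabel j ∨ l = epsLabel (colLabel j)) → j = i := by
  decide +kernel

theorem rowLabel_transversal (h23 : Z 2 = Z 3) (h45 : Z 4 = Z 5) :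
    IsOrbitTransversal IsRowObject fun i => simpleModule Z hZ (rowLabel i) := by
  refine ⟨fun i => ⟨simpleModule_isSimple Z hZ _, ?_, fun h => ?_⟩, ?_⟩
  · rw [← (rowLabel_spec i).1]
    exact simpleModule_hasDegree Z hZ _
  · exact (rowLabel_spec i).2
      (eq_of_iso Z hZ ((eps_tensor_iso Z hZ h23 h45 _).symm.trans h))
  · rintro X ⟨hX, hd, hs⟩
    obtain ⟨l, hl⟩ := exists_iso Z hZ hX
    simp only [iso_simple_iff Z hZ hl h23 h45]
    refine exists_rowLabel l ⟨(labelDegree_eq Z hZ hX hd hl).symm, fun he => hs ?_⟩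
    -- A fixed label would give `X` a nontrivial stabilizer: the tensor product with `ε` sees `X`
    -- only through its character.
    have h1 : Iso (tensor epsObj X) (simpleModule Z hZ (epsLabel l)) := by
      refine iso_of_char_eq Z hZ ?_
      rw [← (eps_tensor_iso Z hZ h23 h45 l).char_eq]
      funext g k
      rw [eps_tensor_char, eps_tensor_char, hl.char_eq]
    rw [he] at h1
    exact h1.trans hl.symm

theorem colLabel_transversal (h23 : Z 2 = Z 3) (h45 : Z 4 = Z 5) :
    IsOrbitTransversal IsColObject fun i => simpleModule Z hZ (colLabel i) := by
  refine ⟨fun i => ⟨simpleModule_isSimple Z hZ _, ?_⟩, ?_⟩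
  · rw [← colLabel_spec.1 i]
    exact simpleModule_hasDegree Z hZ _
  · rintro X ⟨hX, hd⟩
    obtain ⟨l, hl⟩ := exists_iso Z hZ hX
    simp only [iso_simple_iff Z hZ hl h23 h45]
    exact colLabel_spec.2 l (labelDegree_eq Z hZ hX hd hl).symm

/-- The labels of degree `d` are in bijection with the isomorphism classes of simple modules of
degree `d`; the representative picked by `out` is only isomorphic to the labelled module, which
suffices for dimensions. -/
theorem componentDim_eq (hZ : ∀ r, IsPrimitiveRoot (Z r) (cycOrder r)) (d : ZMod 2) :
    componentDim d =
      ((∑ l : {l : Label // labelDegree l = d}, simpleDim l.1 ^ 2 : ℕ) : ℂ) := by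
  have hdeg (l : {l : Label // labelDegree l = d}) : HasDegree d (simpleModule Z hZ l.1) := by
    obtain ⟨l, rfl⟩ := l
    exact simpleModule_hasDegree Z hZ l
  let f : {l : Label // labelDegree l = d} → Quotient (simpleSetoid d) := fun l =>
    Quotient.mk _ ⟨simpleModule Z hZ l.1, simpleModule_isSimple Z hZ l.1, hdeg l⟩
  have hf : Function.Bijective f := by
    constructor
    · intro l m hlm
      exact Subtype.ext (eq_of_iso Z hZ (Quotient.exact hlm))
    · intro c
      obtain ⟨⟨X, hX, hd⟩, rfl⟩ := Quotient.exists_rep c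
      obtain ⟨l, hl⟩ := exists_iso Z hZ hX
      exact ⟨⟨l, (labelDegree_eq Z hZ hX hd hl).symm⟩, Quotient.sound hl.symm⟩
  rw [componentDim, ← finsum_comp_equiv (Equiv.ofBijective f hf), finsum_eq_sum_of_fintype,
    Nat.cast_sum]
  refine Finset.sum_congr rfl fun l _ => ?_
  have h1 : Iso (f l).out.1 (simpleModule Z hZ l.1) := Quotient.exact (Quotient.out_eq (f l))
  obtain ⟨φ, -⟩ := h1
  rw [dimL_eq, dimR_eq, Equiv.ofBijective_apply, φ.finrank_eq, finrank_simpleModule, Nat.cast_pow,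
    pow_two]

/-- The value is `2 · 24²`, half of `48²`. -/
theorem sum_simpleDim_zero :
    ∑ l : {l : Label // labelDegree l = 0}, simpleDim l.1 ^ 2 = 1152 := by
  decide +kernel

end labelled

section main

variable {ζ6 ζ8 : ℂ}

theorem rootFamily_primitive (h6 : IsPrimitiveRoot ζ6 6) (h8 : IsPrimitiveRoot ζ8 8) (r : Fin 6) :
    IsPrimitiveRoot (rootFamily ζ6 ζ8 r) (cycOrder r) :=
  match r with
  | 0 => h8.pow (by norm_num) rfl
  | 1 => h8
  | 2 => h6
  | 3 => h6
  | 4 => h8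
  | 5 => h8

/-- Needed for the members labelled by an exponent 0 or 1, where the stated root of unity and the
corresponding power are equal but not by definition. -/
theorem cyclicRep_congr {g c : BinOct} (hc : Subgroup.centralizer {g} = Subgroup.zpowers c)
    {ω ω' : ℂ} (h : ω ^ orderOf c = 1) (h' : ω' ^ orderOf c = 1) (hω : ω = ω') :
    DMod.V g (cyclicRep hc ω h) = DMod.V g (cyclicRep hc ω' h') := by
  subst hω
  rfl

theorem rowReps_eq (h6 : IsPrimitiveRoot ζ6 6) (h8 : IsPrimitiveRoot ζ8 8) :
    rowReps ζ6 ζ8 h6.pow_eq_one h8.pow_eq_one = fun i =>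
      simpleModule (rootFamily ζ6 ζ8) (rootFamily_primitive h6 h8) (rowLabel i) := by
  funext i
  have h1 : z ^ 1 = z := pow_one z
  have h0 : z ^ 0 = 1 := pow_zero z
  fin_cases i
  · exact congrArg (fun g => VC g chi3p) h1.symm
  · exact cyclicRep_congr _ _ _ (pow_zero ζ6).symm
  · exact congrArg (fun g => VC g chi2) h1.symm
  · exact congrArg (fun g => VC g chi1) h0.symm
  · exact cyclicRep_congr _ _ _ (pow_zero ζ8).symm
  · rfl
  · rfl
  · rfl
  · exact congrArg (fun g => VC g chi3) h1.symm
  · exact congrArg (fun g => VC g chiEps) h1.symm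
  · rfl
  · rfl
  · rfl

theorem colReps_eq (h6 : IsPrimitiveRoot ζ6 6) (h8 : IsPrimitiveRoot ζ8 8) :
    colReps ζ6 ζ8 h6.pow_eq_one h8.pow_eq_one = fun i =>
      simpleModule (rootFamily ζ6 ζ8) (rootFamily_primitive h6 h8) (colLabel i) := by
  funext i
  have h0 : z ^ 0 = 1 := pow_zero z
  fin_cases i
  · exact cyclicRep_congr _ _ _ (pow_one ζ8).symm
  · rfl
  · exact cyclicRep_congr _ _ _ (pow_one (ζ8 ^ 2)).symm
  · exact congrArg (fun g => VC g psi4) h0.symm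
  · exact congrArg (fun g => VC g psi2) h0.symm
  · exact congrArg (fun g => VC g psi2p) h0.symm
  · rfl
  · rfl
  · rfl
  · exact cyclicRep_congr _ _ _ (pow_one ζ8).symm
  · exact cyclicRep_congr _ _ _ (pow_one ζ6).symm
  · rfl
  · rfl

theorem frobenius1_eq (h6 : ζ6 ^ 2 = ζ6 - 1) (h8 : ζ8 ^ 4 = -1) :
    frobenius1 (ζ6 ^ 2) (ζ8 ^ 2) = Matrix.diagonal
      fun i => (labelTwist (rootFamily ζ6 ζ8) (rowLabel i))⁻¹ := by
  rw [frobenius1]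
  congr 1
  funext i
  refine eq_inv_of_mul_eq_one_left ?_
  fin_cases i <;> simp [labelTwist, rootFamily, rowLabel, cycExp, ← pow_mul, pow_add_three h6,
    pow_add_four h8] <;> grind

/-- The matrix being raised to the power `-2` already contains inverse twists, so the result is
minus the diagonal matrix of squared twists. -/
theorem frobenius2_eq (h6 : ζ6 ^ 2 = ζ6 - 1) (h8 : ζ8 ^ 4 = -1) :
    frobenius2 (ζ6 ^ 2) (ζ8 ^ 2) = -(Matrix.diagonal
      fun i => (labelTwist (rootFamily ζ6 ζ8) (colLabel i))⁻¹) ^ (-2 : ℤ) := by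
  set t := fun i => labelTwist (rootFamily ζ6 ζ8) (colLabel i) with ht
  have h1 : ∀ i, ![1, 1, 1, -1, -1, -1, -ζ8 ^ 2, ζ8 ^ 2, ζ8 ^ 2, -ζ8 ^ 2, -ζ6 ^ 2, -(ζ6 ^ 2) ^ 2, -1] i =
      -(t i * t i) := fun i => by
    fin_cases i <;> simp [ht, labelTwist, rootFamily, colLabel, cycExp, ← pow_mul,
      pow_add_three h6, pow_add_four h8, ZMod.val_one] <;> grind
  have h60 : ζ6 ≠ 0 := fun h => by rw [h] at h6; norm_num at h6
  have h80 : ζ8 ≠ 0 := fun h => by rw [h] at h8; norm_num at h8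
  have h2 : ∀ i, t i ≠ 0 := fun i hi => by
    -- If a twist were zero, the corresponding entry of `F₂` would vanish, whereas all of them are
    -- roots of unity.
    have h3 := h1 i
    rw [hi] at h3
    fin_cases i <;> simp [h60, h80] at h3
  have h4 : (Matrix.diagonal fun i => (t i)⁻¹) ^ (-2 : ℤ) = Matrix.diagonal fun i => t i * t i := by
    rw [show (-2 : ℤ) = -((2 : ℕ) : ℤ) from rfl, Matrix.zpow_neg_natCast]
    refine Matrix.inv_eq_right_inv ?_
    rw [pow_two, Matrix.diagonal_mul_diagonal, Matrix.diagonal_mul_diagonal, ← Matrix.diagonal_one]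
    congr 1
    funext i
    have := h2 i
    field_simp
  rw [h4, frobenius2, Matrix.diagonal_neg]
  congr 1
  funext i
  exact h1 i

end main

end BinOct

end

/-! ### Assembly. -/

theorem mainTheorem6 (ζ6 ζ8 : ℂ) (h6 : IsPrimitiveRoot ζ6 6) (h8 : IsPrimitiveRoot ζ8 8)
    (hζ : ζ8 + ζ8⁻¹ = (√2 : ℝ)) :
    let X : Fin 13 → DMod BinOct := BinOct.rowReps ζ6 ζ8 h6.pow_eq_one h8.pow_eq_one
    let Y : Fin 13 → DMod BinOct := BinOct.colReps ζ6 ζ8 h6.pow_eq_one h8.pow_eq_one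
    (orderOf BinOct.z = 2 ∧
      ∃ π : BinOct →* Equiv.Perm (Fin 4), Function.Surjective π ∧
        π.ker = Subgroup.zpowers BinOct.z ∧ π BinOct.t1 = Equiv.swap 0 1 ∧
        π BinOct.t2 = Equiv.swap 1 2 ∧ π BinOct.t3 = Equiv.swap 2 3) ∧
    BinOct.characterTable =
      !![1, 1, 1, 1, 1, 1, 1, 1;
        1, 1, -1, 1, 1, 1, -1, -1;
        2, 2, 0, 2, -1, -1, 0, 0;
        3, 3, 1, -1, 0, 0, -1, -1;
        3, 3, -1, -1, 0, 0, 1, 1;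
        2, -2, 0, 0, 1, -1, ((√2 : ℝ) : ℂ), -((√2 : ℝ) : ℂ);
        2, -2, 0, 0, 1, -1, -((√2 : ℝ) : ℂ), ((√2 : ℝ) : ℂ);
        4, -4, 0, 0, -1, 1, 0, 0] ∧
    BinOct.IsOrbitTransversal BinOct.IsRowObject X ∧
    BinOct.IsOrbitTransversal BinOct.IsColObject Y ∧
    BinOct.componentDim 0 / 2 = 24 ^ 2 ∧
    (24 : ℂ)⁻¹ • BinOct.crossedS X Y = geckMalle ∧
    ∃ θ0 θ1 : Fin 13 → ℂ,
      (∀ i, DMod.IsTwist (X i) (θ0 i • LinearMap.id)) ∧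
      (∀ j, DMod.IsTwist (Y j) (θ1 j • LinearMap.id)) ∧
      frobenius1 (ζ6 ^ 2) (ζ8 ^ 2) = Matrix.diagonal (fun i => (θ0 i)⁻¹) ∧
      frobenius2 (ζ6 ^ 2) (ζ8 ^ 2) =
        -(Matrix.diagonal (fun j => (θ1 j)⁻¹)) ^ (-2 : ℤ) := by
  intro X Y
  have hZ := BinOct.rootFamily_primitive h6 h8
  have hX : X = fun i => BinOct.simpleModule _ hZ (BinOct.rowLabel i) := BinOct.rowReps_eq h6 h8
  have hY : Y = fun i => BinOct.simpleModule _ hZ (BinOct.colLabel i) := BinOct.colReps_eq h6 h8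
  have e8 : ζ8 ^ 4 = -1 := BinOct.root_half h8 (by norm_num) (by norm_num)
  have e6 : ζ6 ^ 2 = ζ6 - 1 := by
    have h1 : ζ6 ^ 3 = -1 := BinOct.root_half h6 (by norm_num) (by norm_num)
    -- The relation `ζ6³ + 1 = (ζ6 + 1)(ζ6² - ζ6 + 1) = 0` leaves only the second factor, since `-1`
    -- has order 2.
    have h2 : ζ6 + 1 ≠ 0 := fun h => by
      refine h6.pow_ne_one_of_pos_of_lt (l := 2) (by norm_num) (by norm_num) ?_
      rw [eq_neg_of_add_eq_zero_left h]
      norm_num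
    refine mul_left_cancel₀ h2 ?_
    linear_combination h1
  have hs : ((√2 : ℝ) : ℂ) = ζ8 - ζ8 ^ 3 := by
    -- From `ζ8⁴ = -1` the inverse of `ζ8` is `-ζ8³`.
    rw [← hζ, inv_eq_of_mul_eq_one_right (b := -ζ8 ^ 3) (by linear_combination -e8)]
    ring
  refine ⟨⟨BinOct.orderOf_z, BinOct.exists_projection⟩, BinOct.characterTable_eq,
    hX ▸ BinOct.rowLabel_transversal _ hZ rfl rfl,
    hY ▸ BinOct.colLabel_transversal _ hZ rfl rfl, ?_, ?_,
    fun i => BinOct.labelTwist (BinOct.rootFamily ζ6 ζ8) (BinOct.rowLabel i),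
    fun i => BinOct.labelTwist (BinOct.rootFamily ζ6 ζ8) (BinOct.colLabel i),
    fun i => BinOct.isTwist_of_eq (congrFun hX i) (BinOct.simpleModule_isTwist _ hZ _),
    fun i => BinOct.isTwist_of_eq (congrFun hY i) (BinOct.simpleModule_isTwist _ hZ _),
    BinOct.frobenius1_eq e6 e8, BinOct.frobenius2_eq e6 e8⟩
  · rw [BinOct.componentDim_eq _ hZ, BinOct.sum_simpleDim_zero]
    norm_num
  · have hg : geckMalle = (1 / 12 : ℂ) • BinOct.geckMalleNum (3 * ((√2 : ℝ) : ℂ)) := rfl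
    rw [hg, hX, hY]
    ext i j
    simp only [Matrix.smul_apply, BinOct.crossedS, Matrix.of_apply, BinOct.sEntry_simple,
      BinOct.labelS_eq e6 e8 hs, smul_eq_mul]
    ring
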